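/- Let $\Delta\ge 3$ be an integer, let $q>1$ be real, and let $\mathcal T$ be the infinite $\Delta$-regular tree with edge set $E$. For a finite set $\Lambda\subset E$ with set of endpoints $V(\Lambda)$ and a partition $\xi$ of $V(\Lambda)$, let $$\mu^{\xi}_{\Lambda,p,q}(\eta)\;\propto\; p^{|\eta|}(1-p)^{|\Lambda\setminus\eta|}\,q^{c(\eta,\xi)},\qquad \eta\subseteq\Lambda,$$ where $c(\eta,\xi)$ is the number of connected components of the graph $(V(\Lambda),\eta)$ after identifying vertices in the same class of $\xi$. A wired random-cluster (DLR) measure on $\mathcal T$ is a probability measure $\nu$ on $\{0,1\}^{E}$ (product $\sigma$-algebra) such that for every finite $\Lambda\subset E$ and every $\eta\in\{0,1\}^{\Lambda}$, $$\nu\big(A(\Lambda)=\eta \,\big|\, A(E\setminus\Lambda)\big)=\mu^{\xi(A)}_{\Lambda,p,q}(\eta)\qquad \nu\text{-almost surely},$$ where $A(S)$ is the restriction of $A$ to $S\subseteq E$, and $\xi(A)$ is the partition of $V(\Lambda)$ in which two vertices are in the same class if they lie in the same connected component of the graph $(V(\mathcal T),A(E\setminus\Lambda))$, or both lie in infinite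 components of it (all infinite components are wired together at infinity). Then for every $p$ with $$p_{\mathsf s}:=\frac{q}{\Delta+q-2}<p<1$$ there exists exactly one wired random-cluster measure on $\mathcal T$ with parameters $p,q$. -/

import Mathlib

noncomputable section

namespace RandomCluster

open MeasureTheory

variable {V : Type*} {G : SimpleGraph V}

/-- The vertices of the finite graph spanned by a finite edge set `Λ`, i.e. the endpoints of the
edges in `Λ`. -/
def verts (Λ : Finset G.edgeSet) : Set V :=
  {v | ∃ e ∈ Λ, v ∈ (e : Sym2 V)}

/-- `c(η, ξ)`: the number of connected components of the graph with vertex set `verts Λ` and edge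
set the `η`-open edges of `Λ`, where in addition vertices in the same class of the boundary
condition `ξ` (a partition of `verts Λ`) are identified. `Quot` divides by the equivalence relation
generated by the given relation. -/
def numClusters (Λ : Finset G.edgeSet) (ξ : Setoid (verts Λ)) (η : Λ → Bool) : ℕ :=
  Nat.card (Quot fun u v : verts Λ =>
    (∃ e : Λ, η e = true ∧ ((e : G.edgeSet) : Sym2 V) = s((u : V), (v : V))) ∨ ξ u v)

/-- The unnormalised weight `p ^ |η| * (1 - p) ^ |Λ \ η| * q ^ c(η, ξ)`. -/
def weight (p q : ℝ) (Λ : Finset G.edgeSet) (ξ : Setoid (verts Λ)) (η : Λ → Bool) : ℝ :=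
  p ^ Nat.card {e : Λ // η e = true} * (1 - p) ^ Nat.card {e : Λ // η e = false} *
    q ^ numClusters Λ ξ η

open Classical in
/-- The partition function: the sum of all weights. -/
def partitionFunction (p q : ℝ) (Λ : Finset G.edgeSet) (ξ : Setoid (verts Λ)) : ℝ :=
  ∑ η : Λ → Bool, weight p q Λ ξ η

/-- The probability of `η` under the random-cluster measure on the finite graph `(verts Λ, Λ)` with
boundary condition `ξ`. -/
def finiteProb (p q : ℝ) (Λ : Finset G.edgeSet) (ξ : Setoid (verts Λ)) (η : Λ → Bool) : ℝ :=
  weight p q Λ ξ η / partitionFunction p q Λ ξ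

/-- The graph on `V` formed by the open edges of `A` that do not belong to `Λ`. -/
def exteriorGraph (Λ : Finset G.edgeSet) (A : G.edgeSet → Bool) : SimpleGraph V :=
  SimpleGraph.fromEdgeSet {e | ∃ h : e ∈ G.edgeSet, (⟨e, h⟩ : G.edgeSet) ∉ Λ ∧ A ⟨e, h⟩ = true}

/-- The component of `v` in the graph `H` is infinite. -/
def InInfiniteCluster (H : SimpleGraph V) (v : V) : Prop :=
  {w | H.Reachable v w}.Infinite

/-- The partition of the vertices into components of `H`, with all infinite components merged into
a single class (wired together at infinity). -/
def wiredAtInfinity (H : SimpleGraph V) : Setoid V where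
  r u v := H.Reachable u v ∨ (InInfiniteCluster H u ∧ InInfiniteCluster H v)
  iseqv := by
    have key : ∀ {u v : V}, H.Reachable u v → InInfiniteCluster H u → InInfiniteCluster H v :=
      fun huv hu => hu.mono fun _ hw => huv.symm.trans hw
    refine ⟨fun u => Or.inl (SimpleGraph.Reachable.refl u), ?_, ?_⟩
    · rintro u v (h | ⟨hu, hv⟩)
      · exact Or.inl h.symm
      · exact Or.inr ⟨hv, hu⟩
    · rintro u v w (h | ⟨hu, hv⟩) (h' | ⟨hv', hw⟩)
      · exact Or.inl (h.trans h')
      · exact Or.inr ⟨key h.symm hv', hw⟩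
      · exact Or.inr ⟨hu, key h' hv⟩
      · exact Or.inr ⟨hu, hw⟩

/-- The boundary condition on `verts Λ` induced by the configuration `A` outside `Λ`, all infinite
components of the exterior configuration being wired together. -/
def inducedBoundary (Λ : Finset G.edgeSet) (A : G.edgeSet → Bool) : Setoid (verts Λ) :=
  (wiredAtInfinity (exteriorGraph Λ A)).comap Subtype.val

/-- The sigma-algebra on `{0,1} ^ E` generated by the states of the edges outside `Λ`. -/
@[reducible] def exteriorSigma (Λ : Finset G.edgeSet) : MeasurableSpace (G.edgeSet → Bool) :=
  MeasurableSpace.comap (fun A (e : {e : G.edgeSet // e ∉ Λ}) => A e) inferInstance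

/-- Infinite-volume (DLR) random-cluster measures on `G` with all infinite components wired
together: probability measures `ν` on `{0,1} ^ E` (with the product sigma-algebra) such that for
every finite edge set `Λ` and every `η ∈ {0,1} ^ Λ`, the conditional probability of `A(Λ) = η` given
the configuration outside `Λ` is `ν`-almost surely the finite-volume random-cluster probability of
`η` with the induced boundary condition. -/
structure IsWiredGibbsMeasure (G : SimpleGraph V) (p q : ℝ) (ν : Measure (G.edgeSet → Bool)) :
    Prop where
  isProbabilityMeasure : IsProbabilityMeasure ν
  dlr : ∀ (Λ : Finset G.edgeSet) (η : Λ → Bool),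
    ν[({A | ∀ e : Λ, A e = η e} : Set (G.edgeSet → Bool)).indicator (fun _ => (1 : ℝ)) |
        exteriorSigma Λ]
      =ᵐ[ν] fun A => finiteProb p q Λ (inducedBoundary Λ A) η

end RandomCluster

end

/-! Root the tree and let `d = Δ - 1` be the number of children of a non-root vertex. Put on each
vertex at depth `n` the indicator `T.extinct A v` that the open cluster below it is finite. Inside
the ball of radius `n`, a cluster contributes `q` if all its depth-`n` vertices have field `1`, and
`1` otherwise; this is `1 + (q - 1) * ∏ x`. All infinite clusters together contribute one more
factor, which depends only on the exterior and cancels after normalization (`pow_clusterCount_ball`,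
`sumOver_ball_configProb`). The DLR property thus becomes: for every `n`, the `ν`-mean of `F` is the
`ν`-mean of `ballMean` with field `extinct`. The weight is affine in every field value, so summing
out the last level only replaces the field `x` by `push x`, a product of the messages `msg`
(`sumOver_lev_wt`, `ballMean_push`).

On the regular part, constant fields evolve by `x ↦ msg x ^ d`. The condition `p > p_s` reads `p +
(1 - p) q < d p`. It makes the fixed point `1` unstable and leaves exactly one fixed point `z` in
`(0, 1)` (`exists_msgGap_sign`).

Uniqueness: the claim is that `push^k (extinct A)` tends to `z` in mean under every DLR measure,
which determines all local expectations. The lower bound is monotonicity, as the iterates from `0`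
increase to `z`. For the upper bound, a logarithm turns `push` into sums of a concave-like function
of the children; up to truncation at a level `c < -log z` this function is at least linear with
slope `a > 1 / d`. The recursion `low` bounds it below by a polynomial that is increasing on the
unit cube and affine in every edge variable. Since each edge is open with conditional probability at
least `r = p / (p + (1 - p) q)`, the mean of such a polynomial is at least its value at the constant
`r` (`EdgeBound.le_integral`). There the recursion is deterministic, it starts at a positive level
because `d r > 1`, and it climbs to `1` (`one_sub_low_le`). So the mean of `push^k (extinct A)` is
asymptotically at most `exp (-c)`; finally `c` tends to `-log z`.

Existence: the constant field `z` gives consistent local expectations, hence a measure `ν` by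
compactness. Resampling a ball inside a larger one is exact, with inner field `pull^k z = z ^
openDesc A k v`. Under `ν` this tends in mean to `extinct`: a generation of bounded positive size
dies out in the next one with probability bounded below, so generation sizes tend to `0` or to
infinity (`tendsto_integral_pow_openDesc`). Passing to the limit gives the DLR property. -/

noncomputable section

namespace RandomCluster

open scoped Classical
open MeasureTheory Filter Topology Finset

/-- A rooted, locally finite tree with vertex set `V` and edge set `E`, each edge `e` being directed
away from the root, from `tl e` to `hd e`. -/
structure RootedTree (V E : Type*) where
  root : V
  tl : E → V
  hd : E → V
  ch : V → Finset E
  depth : V → ℕ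
  mem_ch : ∀ v e, e ∈ ch v ↔ tl e = v
  hd_injective : Function.Injective hd
  depth_root : depth root = 0
  depth_hd : ∀ e, depth (hd e) = depth (tl e) + 1
  exists_hd : ∀ v, v ≠ root → ∃ e, hd e = v

/-! ### Sums over the states of finitely many edges -/

section Glue

variable {E : Type*}

/-- The configuration which agrees with `A` off `L` and whose open edges in `L` are those in `O`. -/
def glue (L O : Finset E) (A : E → Bool) : E → Bool :=
  fun e => if e ∈ L then decide (e ∈ O) else A e

/-- The sum of `F` over all configurations that agree with `A` off `L`. -/
def sumOver (L : Finset E) (F : (E → Bool) → ℝ) (A : E → Bool) : ℝ :=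
  ∑ O ∈ L.powerset, F (glue L O A)

theorem glue_of_mem {L O : Finset E} {A : E → Bool} {e : E} (h : e ∈ L) :
    glue L O A e = decide (e ∈ O) := by simp [glue, h]

theorem glue_of_notMem {L O : Finset E} {A : E → Bool} {e : E} (h : e ∉ L) :
    glue L O A e = A e := by simp [glue, h]

theorem sumOver_empty (F : (E → Bool) → ℝ) (A : E → Bool) : sumOver ∅ F A = F A := by
  have : glue ∅ ∅ A = A := by ext e; simp [glue]
  simp [sumOver, this]

theorem sumOver_congr {L : Finset E} {F F' : (E → Bool) → ℝ} {A A' : E → Bool}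
    (hA : ∀ e ∉ L, A e = A' e) (hF : ∀ B, (∀ e ∉ L, B e = A e) → F B = F' B) :
    sumOver L F A = sumOver L F' A' := by
  refine Finset.sum_congr rfl fun O _ => ?_
  have : glue L O A = glue L O A' := by
    ext e; by_cases h : e ∈ L <;> simp [glue, h, hA]
  rw [← this]
  exact hF _ fun e he => glue_of_notMem he

theorem sumOver_insert {L : Finset E} {e : E} (he : e ∉ L) (F : (E → Bool) → ℝ) (A : E → Bool) :
    sumOver (insert e L) F A =
      sumOver L (fun B => F (Function.update B e false) + F (Function.update B e true)) A := by
  rw [sumOver, Finset.sum_powerset_insert he, sumOver, ← Finset.sum_add_distrib]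
  refine Finset.sum_congr rfl fun O hO => ?_
  have heO : e ∉ O := fun h => he (Finset.mem_powerset.1 hO h)
  congr 2 <;> ext e' <;> by_cases h : e' = e <;> simp [glue, h, heO]

theorem sumOver_union {L L' : Finset E} (h : Disjoint L L') (F : (E → Bool) → ℝ) (A : E → Bool) :
    sumOver (L ∪ L') F A = sumOver L (sumOver L' F) A := by
  induction L' using Finset.induction_on generalizing F A with
  | empty =>
    rw [Finset.union_empty]
    exact sumOver_congr (fun _ _ => rfl) fun B _ => (sumOver_empty F B).symm
  | insert e L' he ih =>
    rw [Finset.disjoint_insert_right] at h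
    rw [Finset.union_insert, sumOver_insert (by simp [h.1, he]), ih h.2]
    exact sumOver_congr (fun _ _ => rfl) fun B _ => (sumOver_insert he F B).symm

theorem sumOver_of_mem_iff {U L L' : Finset E} (h : Disjoint L L')
    (hU : ∀ e, e ∈ U ↔ e ∈ L ∨ e ∈ L') (F : (E → Bool) → ℝ) (A : E → Bool) :
    sumOver U F A = sumOver L (sumOver L' F) A := by
  rw [← sumOver_union h]
  congr 1
  ext e
  simp [hU]

theorem sumOver_mul_left {L : Finset E} (c : ℝ) (F : (E → Bool) → ℝ) (A : E → Bool) :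
    sumOver L (fun B => c * F B) A = c * sumOver L F A := by
  simp [sumOver, Finset.mul_sum]

theorem sumOver_mono {L : Finset E} {F F' : (E → Bool) → ℝ} {A : E → Bool}
    (h : ∀ B, (∀ e ∉ L, B e = A e) → F B ≤ F' B) : sumOver L F A ≤ sumOver L F' A :=
  Finset.sum_le_sum fun _ _ => h _ fun _ he => glue_of_notMem he

theorem sumOver_pos {L : Finset E} {F : (E → Bool) → ℝ} {A : E → Bool}
    (h : ∀ B, (∀ e ∉ L, B e = A e) → 0 < F B) : 0 < sumOver L F A :=
  Finset.sum_pos (fun _ _ => h _ fun _ he => glue_of_notMem he) ⟨∅, by simp⟩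

/-- A function of a finite product of independent two-valued variables that is affine in each of
them may be averaged by averaging each variable. -/
theorem sum_prod_affine {Φ : (E → ℝ) → ℝ}
    (hΦ : ∀ z e, ∃ a b : ℝ, ∀ t, Φ (Function.update z e t) = a + b * t)
    (P C X : E → ℝ) (L : Finset E) (hPC : ∀ e ∈ L, P e + C e ≠ 0) (z : E → ℝ) :
    ∑ O ∈ L.powerset, (∏ e ∈ L, if e ∈ O then P e else C e) *
        Φ (fun e => if e ∈ L then (if e ∈ O then X e else 1) else z e) =
      (∏ e ∈ L, (P e + C e)) *
        Φ (fun e => if e ∈ L then (P e * X e + C e) / (P e + C e) else z e) := by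
  induction L using Finset.induction_on generalizing z with
  | empty => simp
  | insert e L he ih =>
    -- Closed `e` (`key`) and open `e` (`key'`) are absorbed into the base point `z`, at coordinate
    -- `e`, so that the induction hypothesis applies to each half.
    have key : ∀ O ∈ L.powerset,
        (∏ e' ∈ insert e L, if e' ∈ O then P e' else C e') *
          Φ (fun e' => if e' ∈ insert e L then (if e' ∈ O then X e' else 1) else z e') =
        C e * ((∏ e' ∈ L, if e' ∈ O then P e' else C e') *
          Φ (fun e' => if e' ∈ L then (if e' ∈ O then X e' else 1)
            else Function.update z e 1 e')) := by
      intro O hO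
      have heO : e ∉ O := fun h => he (Finset.mem_powerset.1 hO h)
      rw [Finset.prod_insert he, if_neg heO, mul_assoc]
      congr 3
      ext e'
      by_cases h : e' = e <;> simp [h, he, heO]
    have key' : ∀ O ∈ L.powerset,
        (∏ e' ∈ insert e L, if e' ∈ insert e O then P e' else C e') *
          Φ (fun e' => if e' ∈ insert e L then (if e' ∈ insert e O then X e' else 1) else z e') =
        P e * ((∏ e' ∈ L, if e' ∈ O then P e' else C e') *
          Φ (fun e' => if e' ∈ L then (if e' ∈ O then X e' else 1)
            else Function.update z e (X e) e')) := by
      intro O hO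
      rw [Finset.prod_insert he, if_pos (Finset.mem_insert_self _ _), mul_assoc]
      congr 2
      · refine Finset.prod_congr rfl fun e' he' => ?_
        have : e' ≠ e := fun h => he (h ▸ he')
        simp [this]
      · congr 1
        ext e'
        by_cases h : e' = e <;> simp [h, he]
    rw [Finset.sum_powerset_insert he, Finset.sum_congr rfl key, Finset.sum_congr rfl key',
      ← Finset.mul_sum, ← Finset.mul_sum, ih (fun e' h => hPC e' (Finset.mem_insert_of_mem h)),
      ih (fun e' h => hPC e' (Finset.mem_insert_of_mem h)), Finset.prod_insert he]
    have h0 := hPC e (Finset.mem_insert_self _ _)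
    set y : E → ℝ := fun e' => if e' ∈ L then (P e' * X e' + C e') / (P e' + C e') else z e'
    have hy : ∀ t, (fun e' => if e' ∈ L then (P e' * X e' + C e') / (P e' + C e')
        else Function.update z e t e') = Function.update y e t := by
      intro t; ext e'
      by_cases h : e' = e <;> simp [h, he, y]
    have hy' : (fun e' => if e' ∈ insert e L then (P e' * X e' + C e') / (P e' + C e')
        else z e') = Function.update y e ((P e * X e + C e) / (P e + C e)) := by
      ext e'
      by_cases h : e' = e <;> simp [h, y]
    rw [hy, hy, hy']
    -- An affine function averaged with weights `C e` at `1` and `P e` at `X e` is the total weight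
    -- times its value at the weighted mean.
    obtain ⟨a, b, hab⟩ := hΦ y e
    rw [hab, hab, hab]
    field_simp
    ring

end Glue

/-! ### Levels, balls, and the weight with a boundary field -/

namespace RootedTree

variable {V E : Type*} (T : RootedTree V E)

/-- The edges whose lower endpoint has depth `n`. -/
def lev : ℕ → Finset E
  | 0 => T.ch T.root
  | n + 1 => (lev n).biUnion fun e => T.ch (T.hd e)

/-- The edges of the ball of radius `n` about the root. -/
def ball (n : ℕ) : Finset E := (Finset.range n).biUnion T.lev

theorem eq_root_of_depth {v : V} (h : T.depth v = 0) : v = T.root := by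
  by_contra hv
  obtain ⟨e, rfl⟩ := T.exists_hd v hv
  simp [T.depth_hd] at h

theorem ne_root_of_depth {v : V} (h : 0 < T.depth v) : v ≠ T.root := by
  rintro rfl; simp [T.depth_root] at h

theorem hd_ne_root (e : E) : T.hd e ≠ T.root :=
  T.ne_root_of_depth (by simp [T.depth_hd])

theorem mem_lev {n : ℕ} {e : E} : e ∈ T.lev n ↔ T.depth (T.tl e) = n := by
  induction n generalizing e with
  | zero =>
    rw [lev, T.mem_ch]
    exact ⟨fun h => h ▸ T.depth_root, T.eq_root_of_depth⟩
  | succ n ih =>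
    simp only [lev, Finset.mem_biUnion, ih, T.mem_ch]
    constructor
    · rintro ⟨e', h, h'⟩
      rw [h', T.depth_hd, h]
    · intro h
      obtain ⟨e', he'⟩ := T.exists_hd (T.tl e) (T.ne_root_of_depth (by omega))
      refine ⟨e', ?_, he'.symm⟩
      have := T.depth_hd e'
      rw [he'] at this
      omega

theorem mem_ball {n : ℕ} {e : E} : e ∈ T.ball n ↔ T.depth (T.tl e) < n := by
  simp [ball, mem_lev]

theorem ball_mono {m n : ℕ} (h : m ≤ n) : T.ball m ⊆ T.ball n := fun e he => by
  rw [mem_ball] at *; omega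

theorem ball_succ (n : ℕ) : T.ball (n + 1) = T.ball n ∪ T.lev n := by
  ext e; simp only [mem_ball, Finset.mem_union, mem_lev]; omega

theorem disjoint_ball_lev (n : ℕ) : Disjoint (T.ball n) (T.lev n) := by
  rw [Finset.disjoint_left]; intro e; simp only [mem_ball, mem_lev]; omega

theorem exists_subset_ball (L : Finset E) : ∃ n, 1 ≤ n ∧ L ⊆ T.ball n := by
  refine ⟨L.sup (fun e => T.depth (T.tl e)) + 1, by omega, fun e he => ?_⟩
  rw [mem_ball]
  exact Nat.lt_succ_of_le (Finset.le_sup (f := fun e => T.depth (T.tl e)) he)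

theorem countable_edges (T : RootedTree V E) : Countable E := by
  have : (Set.univ : Set E) = ⋃ n, (T.lev n : Set E) := by
    ext e; simp [mem_lev]
  rw [← Set.countable_univ_iff, this]
  exact Set.countable_iUnion fun n => (T.lev n).countable_toSet

/-- The edge message of the random-cluster model. -/
def msg (p q x : ℝ) : ℝ := (p * x + (1 - p) * (1 + (q - 1) * x)) / (p + (1 - p) * (1 + (q - 1) * x))

/-- One step of the recursion of vertex fields along the open edges of `A`. -/
def pull (A : E → Bool) (x : V → ℝ) : V → ℝ :=
  fun v => ∏ e ∈ T.ch v, if A e = true then x (T.hd e) else 1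

/-- One step of the averaged recursion of vertex fields. -/
def push (p q : ℝ) (x : V → ℝ) : V → ℝ :=
  fun v => ∏ e ∈ T.ch v, msg p q (x (T.hd e))

/-- The random-cluster weight on the ball of radius `n`: a cluster `C` has the weight
`1 + (q - 1) * ∏ v ∈ C, x v`, the product being over the vertices of `C` at depth `n`. -/
def wt (p q : ℝ) : ℕ → (E → Bool) → (V → ℝ) → ℝ
  | 0, _, x => 1 + (q - 1) * x T.root
  | n + 1, A, x =>
    (∏ e ∈ T.lev n, if A e = true then p else (1 - p) * (1 + (q - 1) * x (T.hd e))) *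
      wt p q n A (T.pull A x)

variable {T} {p q : ℝ}

theorem pull_congr {A B : E → Bool} {x y : V → ℝ} {v : V} (hA : ∀ e ∈ T.ch v, A e = B e)
    (hx : ∀ e ∈ T.ch v, x (T.hd e) = y (T.hd e)) : T.pull A x v = T.pull B y v :=
  Finset.prod_congr rfl fun e he => by rw [hA e he, hx e he]

theorem wt_congr {n : ℕ} {A B : E → Bool} {x y : V → ℝ}
    (hA : ∀ e ∈ T.ball n, A e = B e) (hx : ∀ v, T.depth v = n → x v = y v) :
    T.wt p q n A x = T.wt p q n B y := by
  induction n generalizing x y with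
  | zero => simp [wt, hx _ T.depth_root]
  | succ n ih =>
    rw [wt, wt]
    congr 1
    · refine Finset.prod_congr rfl fun e he => ?_
      rw [T.mem_lev] at he
      rw [hA e (T.mem_ball.2 (by omega)), hx (T.hd e) (by rw [T.depth_hd, he])]
    · refine ih (fun e he => hA e (T.ball_mono n.le_succ he)) fun v hv => ?_
      refine pull_congr (fun e he => hA e ?_) fun e he => hx _ ?_ <;> rw [T.mem_ch] at he
      · rw [T.mem_ball, he]; omega
      · rw [T.depth_hd, he, hv]

/-- Each edge is a child edge of exactly one vertex, so one edge variable affects only one value of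
the pulled-back field. This carries affineness from vertex variables to edge variables. -/
theorem prod_ch_update (z : E → ℝ) (e : E) (t : ℝ) :
    (fun v => ∏ e' ∈ T.ch v, Function.update z e t e') =
      Function.update (fun v => ∏ e' ∈ T.ch v, z e') (T.tl e)
        (t * ∏ e' ∈ (T.ch (T.tl e)).erase e, z e') := by
  ext v
  by_cases hv : v = T.tl e
  · subst hv
    have he : e ∈ T.ch (T.tl e) := (T.mem_ch _ _).2 rfl
    rw [Function.update_self, ← Finset.mul_prod_erase _ _ he, Function.update_self]
    congr 1
    refine Finset.prod_congr rfl fun e' he' => ?_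
    rw [Function.update_of_ne (Finset.ne_of_mem_erase he')]
  · rw [Function.update_of_ne hv]
    refine Finset.prod_congr rfl fun e' he' => ?_
    rw [Function.update_of_ne]
    rintro rfl
    exact hv ((T.mem_ch _ _).1 he').symm

/-- The value at `hd e` never enters twice: if `e` is open it occurs only in the field pulled back
to `tl e`, and if `e` is closed only in the factor of `e` itself. Hence no square arises. -/
theorem wt_affine (n : ℕ) (A : E → Bool) (x : V → ℝ) (v : V) :
    ∃ a b : ℝ, ∀ t, T.wt p q n A (Function.update x v t) = a + b * t := by
  induction n generalizing x v with
  | zero =>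
    by_cases h : T.root = v
    · exact ⟨1, q - 1, fun t => by simp [wt, h]⟩
    · exact ⟨1 + (q - 1) * x T.root, 0, fun t => by simp [wt, Function.update_of_ne h]⟩
  | succ n ih =>
    by_cases hv : ∃ e, T.hd e = v
    · obtain ⟨e, rfl⟩ := hv
      have hpull : ∀ t, T.pull A (Function.update x (T.hd e) t) = fun v => ∏ e' ∈ T.ch v,
          Function.update (fun e' => if A e' = true then x (T.hd e') else 1) e
            (if A e = true then t else 1) e' := by
        intro t; ext v
        refine Finset.prod_congr rfl fun e' _ => ?_
        by_cases h : e' = e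
        · subst h; simp
        · rw [Function.update_of_ne h, Function.update_of_ne (fun h' => h (T.hd_injective h'))]
      simp only [wt, hpull, prod_ch_update]
      obtain ⟨a, b, hab⟩ := ih (fun v => ∏ e' ∈ T.ch v,
        (if A e' = true then x (T.hd e') else 1)) (T.tl e)
      simp only [hab]
      set c := ∏ e' ∈ (T.ch (T.tl e)).erase e, (if A e' = true then x (T.hd e') else 1)
      by_cases he : e ∈ T.lev n
      · have hprod : ∀ t, (∏ e' ∈ T.lev n, if A e' = true then p else
            (1 - p) * (1 + (q - 1) * Function.update x (T.hd e) t (T.hd e'))) =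
            (if A e = true then p else (1 - p) * (1 + (q - 1) * t)) *
            ∏ e' ∈ (T.lev n).erase e, if A e' = true then p else
              (1 - p) * (1 + (q - 1) * x (T.hd e')) := by
          intro t
          rw [← Finset.mul_prod_erase _ _ he, Function.update_self]
          congr 1
          refine Finset.prod_congr rfl fun e' he' => ?_
          rw [Function.update_of_ne]
          exact fun h => Finset.ne_of_mem_erase he' (T.hd_injective h)
        simp only [hprod]
        set D := ∏ e' ∈ (T.lev n).erase e, if A e' = true then p else
              (1 - p) * (1 + (q - 1) * x (T.hd e'))
        by_cases hA : A e = true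
        · exact ⟨p * D * a, p * D * b * c, fun t => by simp only [hA, if_true]; ring⟩
        · exact ⟨(1 - p) * D * (a + b * c), (1 - p) * (q - 1) * D * (a + b * c), fun t => by
            simp only [hA]; simp only [Bool.false_eq_true, if_false]; ring⟩
      · have hprod : ∀ t, (∏ e' ∈ T.lev n, if A e' = true then p else
            (1 - p) * (1 + (q - 1) * Function.update x (T.hd e) t (T.hd e'))) =
            ∏ e' ∈ T.lev n, if A e' = true then p else
              (1 - p) * (1 + (q - 1) * x (T.hd e')) := by
          intro t
          refine Finset.prod_congr rfl fun e' he' => ?_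
          rw [Function.update_of_ne]
          exact fun h => he (T.hd_injective h ▸ he')
        simp only [hprod]
        set D := ∏ e' ∈ T.lev n, if A e' = true then p else
              (1 - p) * (1 + (q - 1) * x (T.hd e'))
        by_cases hA : A e = true
        · exact ⟨D * a, D * b * c, fun t => by simp only [hA, if_true]; ring⟩
        · exact ⟨D * (a + b * c), 0, fun t => by
            simp only [hA]; simp only [Bool.false_eq_true, if_false]; ring⟩
    · refine ⟨T.wt p q (n + 1) A x, 0, fun t => ?_⟩
      rw [zero_mul, add_zero]
      refine wt_congr (fun _ _ => rfl) fun w hw => Function.update_of_ne ?_ _ _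
      rintro rfl
      exact hv (T.exists_hd w (T.ne_root_of_depth (by omega)))

theorem pull_nonneg {A : E → Bool} {x : V → ℝ} (hx : ∀ v, 0 ≤ x v) (v : V) :
    0 ≤ T.pull A x v :=
  Finset.prod_nonneg fun e _ => by split_ifs <;> simp [hx]

theorem pull_mono {A : E → Bool} {x y : V → ℝ} (hx : ∀ v, 0 ≤ x v) (hxy : ∀ v, x v ≤ y v) (v : V) :
    T.pull A x v ≤ T.pull A y v :=
  Finset.prod_le_prod (fun e _ => by split_ifs <;> simp [hx]) fun e _ => by
    split_ifs <;> simp [hxy]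

theorem wt_pos (hp0 : 0 < p) (hp1 : p < 1) (hq : 1 < q) (n : ℕ) (A : E → Bool) {x : V → ℝ}
    (hx : ∀ v, 0 ≤ x v) : 0 < T.wt p q n A x := by
  have h1 : 0 < 1 - p := by linarith
  have h2 : 0 < q - 1 := by linarith
  induction n generalizing x with
  | zero => rw [wt]; have := hx T.root; positivity
  | succ n ih =>
    rw [wt]
    refine mul_pos (Finset.prod_pos fun e _ => ?_) (ih (pull_nonneg hx))
    have := hx (T.hd e)
    split_ifs <;> positivity

theorem wt_mono (hp0 : 0 < p) (hp1 : p < 1) (hq : 1 < q) (n : ℕ) (A : E → Bool) {x y : V → ℝ}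
    (hx : ∀ v, 0 ≤ x v) (hxy : ∀ v, x v ≤ y v) : T.wt p q n A x ≤ T.wt p q n A y := by
  have h1 : 0 < 1 - p := by linarith
  have h2 : 0 < q - 1 := by linarith
  induction n generalizing x y with
  | zero => rw [wt, wt]; have := hxy T.root; gcongr
  | succ n ih =>
    rw [wt, wt]
    refine mul_le_mul (Finset.prod_le_prod (fun e _ => ?_) fun e _ => ?_)
      (ih (pull_nonneg hx) (pull_mono hx hxy)) (wt_pos hp0 hp1 hq n A (pull_nonneg hx)).le
      (Finset.prod_nonneg fun e _ => ?_)
    · have := hx (T.hd e); split_ifs <;> positivity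
    · have := hxy (T.hd e); split_ifs
      · exact le_rfl
      · gcongr
    · have := (hx (T.hd e)).trans (hxy _); split_ifs <;> positivity

theorem continuous_wt (n : ℕ) (A : E → Bool) : Continuous fun x : V → ℝ => T.wt p q n A x := by
  induction n with
  | zero => unfold wt; fun_prop
  | succ n ih =>
    unfold wt
    refine Continuous.mul (continuous_finsetProd _ fun e _ => ?_) (ih.comp ?_)
    · split_ifs <;> fun_prop
    · refine continuous_pi fun v => continuous_finsetProd _ fun e _ => ?_
      split_ifs <;> fun_prop

theorem msg_denom_pos (hp0 : 0 < p) (hp1 : p < 1) (hq : 1 < q) {x : ℝ} (hx : 0 ≤ x) :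
    0 < p + (1 - p) * (1 + (q - 1) * x) := by
  have h1 : 0 < 1 - p := by linarith
  have h2 : 0 < q - 1 := by linarith
  positivity

theorem msg_pos (hp0 : 0 < p) (hp1 : p < 1) (hq : 1 < q) {x : ℝ} (hx : 0 ≤ x) :
    0 < msg p q x := by
  refine div_pos ?_ (msg_denom_pos hp0 hp1 hq hx)
  have h1 : 0 < 1 - p := by linarith
  have h2 : 0 < q - 1 := by linarith
  positivity

theorem msg_le_one (hp0 : 0 < p) (hp1 : p < 1) (hq : 1 < q) {x : ℝ} (hx : 0 ≤ x) (hx1 : x ≤ 1) :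
    msg p q x ≤ 1 := by
  rw [msg, div_le_one (msg_denom_pos hp0 hp1 hq hx)]
  nlinarith

theorem msg_mono (hp0 : 0 < p) (hp1 : p < 1) (hq : 1 < q) {x y : ℝ} (hx : 0 ≤ x) (hxy : x ≤ y) :
    msg p q x ≤ msg p q y := by
  rw [msg, msg, div_le_div_iff₀ (msg_denom_pos hp0 hp1 hq hx)
    (msg_denom_pos hp0 hp1 hq (hx.trans hxy))]
  have h1 : 0 < 1 - p := by linarith
  have h2 : 0 < q - 1 := by linarith
  have h3 : 0 ≤ p * (y - x) * (p + (1 - p) * q) :=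
    mul_nonneg (mul_nonneg hp0.le (by linarith)) (by nlinarith)
  nlinarith

theorem push_nonneg (hp0 : 0 < p) (hp1 : p < 1) (hq : 1 < q) {x : V → ℝ} (hx : ∀ v, 0 ≤ x v)
    (v : V) : 0 ≤ T.push p q x v :=
  Finset.prod_nonneg fun _ _ => (msg_pos hp0 hp1 hq (hx _)).le

theorem push_le_one (hp0 : 0 < p) (hp1 : p < 1) (hq : 1 < q) {x : V → ℝ} (hx : ∀ v, 0 ≤ x v)
    (hx1 : ∀ v, x v ≤ 1) (v : V) : T.push p q x v ≤ 1 :=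
  Finset.prod_le_one (fun _ _ => (msg_pos hp0 hp1 hq (hx _)).le)
    fun _ _ => msg_le_one hp0 hp1 hq (hx _) (hx1 _)

/-- Summing the weight over the states of the edges of the last level. -/
theorem sumOver_lev_wt (hp0 : 0 < p) (hp1 : p < 1) (hq : 1 < q) (n : ℕ) {x : V → ℝ}
    (hx : ∀ v, 0 ≤ x v) (A : E → Bool) :
    sumOver (T.lev n) (fun B => T.wt p q (n + 1) B x) A =
      (∏ e ∈ T.lev n, (p + (1 - p) * (1 + (q - 1) * x (T.hd e)))) *
        T.wt p q n A (T.push p q x) := by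
  have hΦ : ∀ (z : E → ℝ) (e : E), ∃ a b : ℝ, ∀ t,
      T.wt p q n A (fun v => ∏ e' ∈ T.ch v, Function.update z e t e') = a + b * t := by
    intro z e
    simp only [prod_ch_update]
    obtain ⟨a, b, hab⟩ := wt_affine (T := T) (p := p) (q := q) n A
      (fun v => ∏ e' ∈ T.ch v, z e') (T.tl e)
    exact ⟨a, b * ∏ e' ∈ (T.ch (T.tl e)).erase e, z e', fun t => by rw [hab]; ring⟩
  -- An open edge has weight `p` and transmits `x (hd e)`; a closed one completes a cluster, with
  -- weight `(1 - p) * (1 + (q - 1) * x (hd e))`, and transmits `1`. The weighted mean of what is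
  -- transmitted is `msg`.
  have := sum_prod_affine (Φ := fun z => T.wt p q n A (fun v => ∏ e' ∈ T.ch v, z e')) hΦ
    (fun _ => p) (fun e => (1 - p) * (1 + (q - 1) * x (T.hd e))) (fun e => x (T.hd e)) (T.lev n)
    (fun e _ => (msg_denom_pos hp0 hp1 hq (hx _)).ne')
    (fun e => if A e = true then x (T.hd e) else 1)
  calc _ = _ := Finset.sum_congr rfl fun O hO => ?_
    _ = _ := this
    _ = _ := ?_
  · beta_reduce
    rw [wt]
    congr 1
    · refine Finset.prod_congr rfl fun e he => ?_
      simp [glue_of_mem he]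
    · refine wt_congr (fun e he => glue_of_notMem ?_) fun v hv => ?_
      · exact Finset.disjoint_left.1 (T.disjoint_ball_lev n) he
      · refine Finset.prod_congr rfl fun e he => ?_
        have : e ∈ T.lev n := by rw [T.mem_lev, (T.mem_ch _ _).1 he, hv]
        simp [glue_of_mem this, this]
  · congr 1
    refine wt_congr (fun _ _ => rfl) fun v hv => ?_
    refine Finset.prod_congr rfl fun e he => ?_
    have : e ∈ T.lev n := by rw [T.mem_lev, (T.mem_ch _ _).1 he, hv]
    simp [this, msg]

/-- The explicit form of the weight for a field that is invariant under `pull A`. -/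
theorem wt_eq_prod {A : E → Bool} {y : V → ℝ} (hy : T.pull A y = y) (n : ℕ) :
    T.wt p q n A y = (∏ e ∈ T.ball n, if A e = true then p else 1 - p) *
      ((1 + (q - 1) * y T.root) *
        ∏ e ∈ T.ball n, if A e = true then 1 else (1 + (q - 1) * y (T.hd e))) := by
  induction n with
  | zero => simp [wt, ball]
  | succ n ih =>
    rw [wt, hy, ih, ball_succ, Finset.prod_union (T.disjoint_ball_lev n),
      Finset.prod_union (T.disjoint_ball_lev n)]
    have : (∏ e ∈ T.lev n, if A e = true then p else (1 - p) * (1 + (q - 1) * y (T.hd e))) =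
      (∏ e ∈ T.lev n, if A e = true then p else 1 - p) *
        ∏ e ∈ T.lev n, if A e = true then 1 else (1 + (q - 1) * y (T.hd e)) := by
      rw [← Finset.prod_mul_distrib]
      refine Finset.prod_congr rfl fun e _ => ?_
      split_ifs <;> ring
    rw [this]
    ring

end RootedTree

/-! ### Fixed points of the scalar message recursion -/

namespace RootedTree

section Scalar

variable {p q : ℝ} {d : ℕ}

theorem msg_eq_div (p q x : ℝ) :
    msg p q x = (1 - p + (p + (1 - p) * (q - 1)) * x) / (1 + (1 - p) * (q - 1) * x) := by
  rw [msg]; congr 1 <;> ring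

theorem msg_one (hp0 : 0 < p) (hp1 : p < 1) (hq : 1 < q) : msg p q 1 = 1 := by
  rw [msg, div_eq_one_iff_eq (msg_denom_pos hp0 hp1 hq zero_le_one).ne']; ring

/-- The logarithmic gap `log x - d * log (msg x)` of the message recursion, written so that its
derivative is easy to compute. -/
def msgGap (p q : ℝ) (d : ℕ) (x : ℝ) : ℝ :=
  d * (Real.log (1 + (1 - p) * (q - 1) * x) -
    Real.log (1 - p + (p + (1 - p) * (q - 1)) * x)) + Real.log x

variable (hp0 : 0 < p) (hp1 : p < 1) (hq : 1 < q) (hd : 2 ≤ d)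
  (hdp : p + (1 - p) * q < d * p)

include hp0 hp1 hq

theorem msgGap_eq {x : ℝ} (hx : 0 ≤ x) :
    msgGap p q d x = Real.log x - d * Real.log (msg p q x) := by
  have h1 : 0 < 1 - p := by linarith
  have h2 : 0 < q - 1 := by linarith
  rw [msgGap, msg_eq_div, Real.log_div (by positivity) (by positivity)]
  ring

theorem hasDerivAt_msgGap {x : ℝ} (hx : 0 < x) :
    HasDerivAt (msgGap p q d)
      (((1 + (1 - p) * (q - 1) * x) * (1 - p + (p + (1 - p) * (q - 1)) * x) -
        d * p * (1 + (1 - p) * (q - 1)) * x) /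
        (x * (1 + (1 - p) * (q - 1) * x) * (1 - p + (p + (1 - p) * (q - 1)) * x))) x := by
  have h1 : 0 < 1 - p := by linarith
  have h2 : 0 < q - 1 := by linarith
  have ha : 0 < 1 + (1 - p) * (q - 1) * x := by positivity
  have hb : 0 < 1 - p + (p + (1 - p) * (q - 1)) * x := by positivity
  have e1 : HasDerivAt (fun x => Real.log (1 + (1 - p) * (q - 1) * x))
      ((1 - p) * (q - 1) / (1 + (1 - p) * (q - 1) * x)) x := by
    refine HasDerivAt.log ?_ ha.ne'
    simpa using ((hasDerivAt_id x).const_mul ((1 - p) * (q - 1))).const_add 1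
  have e2 : HasDerivAt (fun x => Real.log (1 - p + (p + (1 - p) * (q - 1)) * x))
      ((p + (1 - p) * (q - 1)) / (1 - p + (p + (1 - p) * (q - 1)) * x)) x := by
    refine HasDerivAt.log ?_ hb.ne'
    simpa using ((hasDerivAt_id x).const_mul (p + (1 - p) * (q - 1))).const_add (1 - p)
  have e3 := ((e1.sub e2).const_mul (d : ℝ)).add (Real.hasDerivAt_log hx.ne')
  refine HasDerivAt.congr_deriv (f := msgGap p q d) e3 ?_
  field_simp
  ring

include hd hdp

/-- The message recursion has exactly one fixed point in `(0, 1)`. -/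
theorem exists_msgGap_sign :
    ∃ z : ℝ, 0 < z ∧ z < 1 ∧ msgGap p q d z = 0 ∧ (∀ x, 0 < x → x < z → msgGap p q d x < 0) ∧
      ∀ x, z < x → x < 1 → 0 < msgGap p q d x := by
  have h1 : 0 < 1 - p := by linarith
  have h2 : 0 < q - 1 := by linarith
  have hd0 : (0 : ℝ) < d := by positivity
  set c := (1 - p) * (q - 1) with hc
  have hc0 : 0 < c := by positivity
  -- Numerator of the derivative of `msgGap`: a quadratic with `Q 0 > 0 > Q 1`, the latter because
  -- `Q 1 = (1 + c) * (1 + c - d * p)`.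
  set Q : ℝ → ℝ := fun x => (1 + c * x) * (1 - p + (p + c) * x) - d * p * (1 + c) * x with hQ
  have hQc : Continuous Q := by fun_prop
  have hQ1 : Q 1 < 0 := by
    have : 1 + c < d * p := by rw [hc]; linarith
    simp only [hQ]; nlinarith
  have hQ0 : 0 < Q 0 := by simp only [hQ]; linarith
  obtain ⟨y, ⟨hy0, hy1⟩, hy⟩ : ∃ y ∈ Set.Icc (0 : ℝ) 1, Q y = 0 :=
    intermediate_value_Icc' zero_le_one hQc.continuousOn ⟨hQ1.le, hQ0.le⟩
  have hy0 : 0 < y := lt_of_le_of_ne hy0 (by rintro rfl; linarith)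
  have hy1 : y < 1 := lt_of_le_of_ne hy1 (by rintro rfl; linarith)
  -- Division by the known root `y`. The cofactor is increasing in `x` and negative at `1`, hence
  -- negative on all of `(-∞, 1]`, so `y` is the only sign change there.
  have hfac : ∀ x, Q x = (x - y) * (c * (p + c) * (x + y) +
      (p + c + c * (1 - p) - d * p * (1 + c))) := by
    intro x
    have : Q x = Q x - Q y := by rw [hy]; ring
    rw [this]; simp only [hQ]; ring
  have hneg : ∀ x, x ≤ 1 → c * (p + c) * (x + y) +
      (p + c + c * (1 - p) - d * p * (1 + c)) < 0 := by
    intro x hx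
    have h := hfac 1
    have : c * (p + c) * (1 + y) + (p + c + c * (1 - p) - d * p * (1 + c)) < 0 := by
      by_contra hcon
      push Not at hcon
      have := mul_nonneg (sub_pos.2 hy1).le hcon
      linarith
    have : c * (p + c) * (x + y) ≤ c * (p + c) * (1 + y) := by gcongr
    linarith
  have hder : ∀ x, 0 < x → HasDerivAt (msgGap p q d)
      (Q x / (x * (1 + c * x) * (1 - p + (p + c) * x))) x := fun x hx =>
    hasDerivAt_msgGap hp0 hp1 hq hx
  have hcont : ∀ x, 0 < x → ContinuousAt (msgGap p q d) x := fun x hx => (hder x hx).continuousAt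
  have hone : msgGap p q d 1 = 0 := by
    rw [msgGap_eq hp0 hp1 hq zero_le_one, msg_one hp0 hp1 hq]; simp
  have hanti : StrictAntiOn (msgGap p q d) (Set.Icc y 1) := by
    refine strictAntiOn_of_deriv_neg (convex_Icc _ _)
      (fun x hx => (hcont x (hy0.trans_le hx.1)).continuousWithinAt) fun x hx => ?_
    rw [interior_Icc] at hx
    have hx0 : 0 < x := hy0.trans hx.1
    rw [(hder x hx0).deriv]
    refine div_neg_of_neg_of_pos ?_ (by positivity)
    rw [hfac]
    exact mul_neg_of_pos_of_neg (sub_pos.2 hx.1) (hneg x hx.2.le)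
  have hmono : StrictMonoOn (msgGap p q d) (Set.Ioc 0 y) := by
    refine strictMonoOn_of_deriv_pos (convex_Ioc _ _)
      (fun x hx => (hcont x hx.1).continuousWithinAt) fun x hx => ?_
    rw [interior_Ioc] at hx
    have hx0 : 0 < x := hx.1
    rw [(hder x hx0).deriv]
    refine div_pos ?_ (by positivity)
    rw [hfac]
    exact mul_pos_of_neg_of_neg (sub_neg.2 hx.2) (hneg x (hx.2.trans hy1).le)
  have hpos : ∀ x, y ≤ x → x < 1 → 0 < msgGap p q d x := by
    intro x hx hx1
    rw [← hone]
    exact hanti ⟨hx, hx1.le⟩ ⟨hy1.le, le_rfl⟩ hx1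
  -- This is `msg 0 ^ d`. The gap is negative there because `msg w > msg 0 = 1 - p`; it is positive
  -- on `[y, 1)` because it decreases to `0` at `1`.
  set w := (1 - p) ^ d with hw
  have hw0 : 0 < w := by positivity
  have hw1 : w < 1 := pow_lt_one₀ h1.le (by linarith) (by omega)
  have hwneg : msgGap p q d w < 0 := by
    rw [msgGap_eq hp0 hp1 hq hw0.le]
    have : Real.log w = d * Real.log (1 - p) := by rw [hw, Real.log_pow]
    rw [this, ← mul_sub]
    refine mul_neg_of_pos_of_neg hd0 (sub_neg.2 (Real.log_lt_log h1 ?_))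
    rw [msg_eq_div, lt_div_iff₀ (by positivity)]
    have : 0 < p * (1 + c) * w := by positivity
    rw [← hc]
    nlinarith
  have hwy : w < y := by
    by_contra h
    exact absurd (hpos w (not_lt.1 h) hw1) (not_lt.2 hwneg.le)
  obtain ⟨z, ⟨hwz, hzy⟩, hz⟩ : ∃ z ∈ Set.Icc w y, msgGap p q d z = 0 :=
    intermediate_value_Icc hwy.le
      (fun x hx => (hcont x (hw0.trans_le hx.1)).continuousWithinAt)
      ⟨hwneg.le, (hpos y le_rfl hy1).le⟩
  have hz0 : 0 < z := hw0.trans_le hwz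
  refine ⟨z, hz0, hzy.trans_lt hy1, hz, fun x hx hxz => ?_, fun x hzx hx1 => ?_⟩
  · rw [← hz]
    exact hmono ⟨hx, hxz.le.trans hzy⟩ ⟨hz0, hzy⟩ hxz
  · rcases le_total y x with h | h
    · exact hpos x h hx1
    · rw [← hz]
      exact hmono ⟨hz0, hzy⟩ ⟨hz0.trans hzx, h⟩ hzx

/-- The fixed point of the message recursion, which is attracting from below, and a linear lower
bound, up to truncation, for the logarithm of the message beyond it. -/
theorem exists_msg_fixedPoint :
    ∃ z : ℝ, 0 < z ∧ z < 1 ∧ msg p q z ^ d = z ∧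
      Tendsto (fun k => (fun x => msg p q x ^ d)^[k] 0) atTop (𝓝 z) ∧
      ∀ c, 0 < c → c < -Real.log z → ∃ a : ℝ, 1 < a * d ∧ a * (d - 1) ≤ 1 ∧
        ∀ u, 0 ≤ u → msg p q (Real.exp (-u)) ≤ Real.exp (-(a * min u c)) := by
  obtain ⟨z, hz0, hz1, hz, hlt, hgt⟩ := exists_msgGap_sign hp0 hp1 hq hd hdp
  have h1 : 0 < 1 - p := by linarith
  have h2 : 0 < q - 1 := by linarith
  have hd0 : (0 : ℝ) < d := by positivity
  have hpow : ∀ {x}, 0 < x → (msgGap p q d x = 0 ↔ msg p q x ^ d = x) := by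
    intro x hx
    have hm := msg_pos hp0 hp1 hq hx.le
    rw [msgGap_eq hp0 hp1 hq hx.le, ← Real.log_pow, sub_eq_zero, eq_comm]
    exact (Real.log_injOn_pos.eq_iff (Set.mem_Ioi.2 (by positivity)) (Set.mem_Ioi.2 hx))
  have hfix := (hpow hz0).1 hz
  refine ⟨z, hz0, hz1, hfix, ?_, ?_⟩
  -- The iterates increase and stay below `z`, so they converge to a fixed point in `(0, z]`; the
  -- sign of the gap below `z` leaves only `z`.
  · set G : ℝ → ℝ := fun x => msg p q x ^ d with hG
    have hGm : ∀ x y, 0 ≤ x → x ≤ y → G x ≤ G y := fun x y hx hxy =>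
      pow_le_pow_left₀ (msg_pos hp0 hp1 hq hx).le (msg_mono hp0 hp1 hq hx hxy) d
    have hb : ∀ k, 0 ≤ G^[k] 0 ∧ G^[k] 0 ≤ z := by
      intro k
      induction k with
      | zero => simp [hz0.le]
      | succ k ih =>
        rw [Function.iterate_succ_apply']
        exact ⟨pow_nonneg (msg_pos hp0 hp1 hq ih.1).le d, (hGm _ _ ih.1 ih.2).trans hfix.le⟩
    have hmono : Monotone fun k => G^[k] 0 := by
      refine monotone_nat_of_le_succ fun k => ?_
      induction k with
      | zero => exact (hb 1).1
      | succ k ih =>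
        rw [Function.iterate_succ_apply' G k, Function.iterate_succ_apply' G (k + 1)]
        exact hGm _ _ (hb k).1 ih
    have hbdd : BddAbove (Set.range fun k => G^[k] 0) := ⟨z, by rintro _ ⟨k, rfl⟩; exact (hb k).2⟩
    have ht := tendsto_atTop_ciSup hmono hbdd
    set l := ⨆ k, G^[k] 0
    have hlz : l ≤ z := ciSup_le fun k => (hb k).2
    have hl0 : 0 < l := by
      refine lt_of_lt_of_le ?_ (le_ciSup hbdd 1)
      exact pow_pos (msg_pos hp0 hp1 hq le_rfl) d
    have hcont : ContinuousAt G l := by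
      refine ContinuousAt.pow ?_ d
      unfold msg
      refine ContinuousAt.div (by fun_prop) (by fun_prop) (msg_denom_pos hp0 hp1 hq hl0.le).ne'
    have hGl : G l = l := isFixedPt_of_tendsto_iterate ht hcont
    have : l = z := by
      refine le_antisymm hlz (not_lt.1 fun h => ?_)
      exact (hlt l hl0 h).ne ((hpow hl0).2 hGl)
    rwa [this] at ht
  · intro c hc hcz
    set h : ℝ → ℝ := fun u => -Real.log (msg p q (Real.exp (-u))) with hh
    have hmpos : ∀ u : ℝ, 0 < msg p q (Real.exp (-u)) := fun u =>
      msg_pos hp0 hp1 hq (Real.exp_pos _).le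
    have hmexp : ∀ u, msg p q (Real.exp (-u)) = Real.exp (-h u) := fun u => by
      simp only [hh, neg_neg]; rw [Real.exp_log (hmpos u)]
    have hheq : h = fun u => Real.log (1 + (1 - p) * (q - 1) * Real.exp (-u)) -
        Real.log (1 - p + (p + (1 - p) * (q - 1)) * Real.exp (-u)) := by
      ext u
      simp only [hh]
      rw [msg_eq_div, Real.log_div (by positivity) (by positivity)]
      ring
    have hdiff : Differentiable ℝ h := by
      rw [hheq]
      intro u
      refine DifferentiableAt.sub (DifferentiableAt.log (by fun_prop) (by positivity))
        (DifferentiableAt.log (by fun_prop) (by positivity))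
    have hder0 : deriv h 0 = p / (p + (1 - p) * q) := by
      have ex : HasDerivAt (fun u : ℝ => Real.exp (-u)) (-1) 0 := by
        simpa using (hasDerivAt_neg (0 : ℝ)).exp
      have e1 : HasDerivAt (fun u : ℝ => Real.log (1 + (1 - p) * (q - 1) * Real.exp (-u)))
          ((1 - p) * (q - 1) * (-1) / (1 + (1 - p) * (q - 1) * Real.exp (-0))) 0 :=
        HasDerivAt.log ((ex.const_mul _).const_add 1) (by positivity)
      have e2 : HasDerivAt (fun u : ℝ => Real.log (1 - p + (p + (1 - p) * (q - 1)) * Real.exp (-u)))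
          ((p + (1 - p) * (q - 1)) * (-1) /
            (1 - p + (p + (1 - p) * (q - 1)) * Real.exp (-0))) 0 :=
        HasDerivAt.log ((ex.const_mul _).const_add (1 - p)) (by positivity)
      rw [hheq]
      refine (e1.sub e2).deriv.trans ?_
      rw [neg_zero, Real.exp_zero]
      have h3 : p + (1 - p) * q ≠ 0 := by positivity
      have h4 : 1 + (1 - p) * (q - 1) * 1 = p + (1 - p) * q := by ring
      have h5 : 1 - p + (p + (1 - p) * (q - 1)) * 1 = p + (1 - p) * q := by ring
      rw [h4, h5]
      field_simp
      ring
    have hzero : h 0 = 0 := by simp [hh, msg_one hp0 hp1 hq]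
    -- `dslope h 0` is `h u / u`, completed by `h' 0` at `0`. Its minimum over `[0, c]` exceeds `1 /
    -- d`: at `0` by the threshold condition, elsewhere because `exp (-u) > z` makes the gap
    -- positive.
    have hkc : ContinuousOn (dslope h 0) (Set.Icc 0 c) := by
      intro u _
      refine ContinuousAt.continuousWithinAt ?_
      by_cases hu : u = 0
      · subst hu; exact continuousAt_dslope_same.2 (hdiff 0)
      · exact (continuousAt_dslope_of_ne hu).2 (hdiff u).continuousAt
    obtain ⟨w, hw, hmin⟩ := isCompact_Icc.exists_isMinOn (Set.nonempty_Icc.2 hc.le) hkc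
    have hmd : 1 < dslope h 0 w * d := by
      by_cases hw0 : w = 0
      · rw [hw0, dslope_same, hder0, div_mul_eq_mul_div, one_lt_div (by positivity)]
        linarith
      · have hw0' : 0 < w := lt_of_le_of_ne hw.1 (Ne.symm hw0)
        rw [dslope_of_ne _ hw0, slope_def_field, hzero, sub_zero, sub_zero, div_mul_eq_mul_div,
          one_lt_div hw0']
        have : 0 < msgGap p q d (Real.exp (-w)) := by
          refine hgt _ ?_ (Real.exp_lt_one_iff.2 (by linarith))
          rw [← Real.log_lt_iff_lt_exp hz0]
          linarith [hw.2]
        rw [msgGap_eq hp0 hp1 hq (Real.exp_pos _).le, Real.log_exp] at this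
        simp only [hh]
        linarith
    have hd1 : (0 : ℝ) < d - 1 := by
      have : (2 : ℝ) ≤ d := by exact_mod_cast hd
      linarith
    -- The cap `1 / (d - 1)`, still larger than `1 / d`, is what later makes the step of `low`
    -- monotone.
    refine ⟨min (dslope h 0 w) (1 / (d - 1)), ?_, ?_, ?_⟩
    · rw [min_mul_of_nonneg _ _ hd0.le]
      refine lt_min hmd ?_
      rw [div_mul_eq_mul_div, one_lt_div hd1]
      linarith
    · calc _ ≤ 1 / ((d : ℝ) - 1) * (d - 1) := by gcongr; exact min_le_right _ _
        _ = 1 := by field_simp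
    · have hsmall : ∀ u, 0 ≤ u → u ≤ c → min (dslope h 0 w) (1 / (d - 1)) * u ≤ h u := by
        intro u hu0 huc
        have hmu : dslope h 0 w ≤ dslope h 0 u := hmin ⟨hu0, huc⟩
        by_cases hu : u = 0
        · simp [hu, hzero]
        · have hu' : 0 < u := lt_of_le_of_ne hu0 (Ne.symm hu)
          rw [dslope_of_ne _ hu, slope_def_field, hzero, sub_zero, sub_zero, le_div_iff₀ hu'] at hmu
          refine le_trans ?_ hmu
          gcongr
          exact min_le_left _ _
      intro u hu
      rcases le_total u c with h' | h'
      · rw [min_eq_left h', hmexp]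
        exact Real.exp_le_exp.2 (neg_le_neg (hsmall u hu h'))
      · rw [min_eq_right h']
        refine (msg_mono hp0 hp1 hq (Real.exp_pos _).le
          (Real.exp_le_exp.2 (neg_le_neg h'))).trans ?_
        rw [hmexp]
        exact Real.exp_le_exp.2 (neg_le_neg (hsmall c hc.le le_rfl))

end Scalar

end RootedTree

/-! ### Cluster counts and consistency of the finite-volume distributions -/

section Clusters

variable {V : Type*} {G : SimpleGraph V}

theorem finite_verts (Λ : Finset G.edgeSet) : (verts Λ).Finite := by
  have : verts Λ = ⋃ e ∈ Λ, {v | v ∈ (e : Sym2 V)} := by ext v; simp [verts]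
  rw [this]
  refine Set.Finite.biUnion Λ.finite_toSet fun e _ => ?_
  induction (e : Sym2 V) with
  | _ a b =>
    refine (Set.toFinite {a, b}).subset fun v hv => ?_
    simpa using hv

instance (Λ : Finset G.edgeSet) : Finite (verts Λ) := (finite_verts Λ).to_subtype

theorem verts_mono {Λ B : Finset G.edgeSet} (h : Λ ⊆ B) : verts Λ ⊆ verts B :=
  fun _ ⟨e, he, hv⟩ => ⟨e, h he, hv⟩

theorem exteriorGraph_adj {Λ : Finset G.edgeSet} {A : G.edgeSet → Bool} {u v : V} :
    (exteriorGraph Λ A).Adj u v ↔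
      ∃ e : G.edgeSet, (e : Sym2 V) = s(u, v) ∧ e ∉ Λ ∧ A e = true := by
  rw [exteriorGraph, SimpleGraph.fromEdgeSet_adj]
  constructor
  · rintro ⟨⟨h, h1, h2⟩, -⟩
    exact ⟨⟨_, h⟩, rfl, h1, h2⟩
  · rintro ⟨⟨e, he⟩, rfl, h1, h2⟩
    exact ⟨⟨he, h1, h2⟩, G.ne_of_adj he⟩

theorem exteriorGraph_congr {Λ : Finset G.edgeSet} {A A' : G.edgeSet → Bool}
    (h : ∀ e ∉ Λ, A e = A' e) : exteriorGraph Λ A = exteriorGraph Λ A' := by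
  ext u v
  simp only [exteriorGraph_adj]
  refine exists_congr fun e => and_congr_right fun _ => and_congr_right fun he => ?_
  rw [h e he]

theorem exteriorGraph_le (Λ : Finset G.edgeSet) (A : G.edgeSet → Bool) :
    exteriorGraph Λ A ≤ exteriorGraph ∅ A := by
  intro u v
  simp only [exteriorGraph_adj]
  rintro ⟨e, h, -, h'⟩
  exact ⟨e, h, by simp, h'⟩

theorem inducedBoundary_congr {Λ : Finset G.edgeSet} {A A' : G.edgeSet → Bool}
    (h : ∀ e ∉ Λ, A e = A' e) : inducedBoundary Λ A = inducedBoundary Λ A' := by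
  rw [inducedBoundary, inducedBoundary, exteriorGraph_congr h]

theorem InInfiniteCluster.mono {H H' : SimpleGraph V} (h : H ≤ H') {v : V}
    (hv : InInfiniteCluster H v) : InInfiniteCluster H' v :=
  Set.Infinite.mono (fun _ hw => SimpleGraph.Reachable.mono h hw) hv

theorem InInfiniteCluster.of_reachable {H : SimpleGraph V} {u v : V}
    (hu : InInfiniteCluster H u) (h : H.Reachable u v) : InInfiniteCluster H v :=
  Set.Infinite.mono (fun _ hw => h.symm.trans hw) hu

theorem wiredAtInfinity_mono {H H' : SimpleGraph V} (h : H ≤ H') {u v : V}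
    (huv : wiredAtInfinity H u v) : wiredAtInfinity H' u v := by
  rcases huv with huv | ⟨hu, hv⟩
  · exact Or.inl (huv.mono h)
  · exact Or.inr ⟨hu.mono h, hv.mono h⟩

/-- The relation on the vertices of `Λ` whose classes are the clusters. -/
def clusterRel (Λ : Finset G.edgeSet) (ξ : Setoid (verts Λ)) (η : Λ → Bool) :
    verts Λ → verts Λ → Prop := fun u v =>
  (∃ e : Λ, η e = true ∧ ((e : G.edgeSet) : Sym2 V) = s((u : V), (v : V))) ∨ ξ u v

/-- Follow an open path from `u`: `u'` is the vertex of `Λ` reached by the last edge of `Λ` on it,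
so the rest of the path is exterior. -/
theorem exists_eqvGen_reachable (Λ : Finset G.edgeSet) (A : G.edgeSet → Bool) (u : verts Λ) {w : V}
    (h : (exteriorGraph ∅ A).Reachable u w) :
    ∃ u' : verts Λ, Relation.EqvGen (clusterRel Λ (inducedBoundary Λ A) fun e => A e) u u' ∧
      (exteriorGraph Λ A).Reachable u' w := by
  rw [SimpleGraph.reachable_iff_reflTransGen] at h
  induction h with
  | refl => exact ⟨u, Relation.EqvGen.refl _, SimpleGraph.Reachable.refl _⟩
  | @tail w w' _ hadj ih =>
    obtain ⟨u', hu', hw⟩ := ih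
    obtain ⟨e, he, -, hA⟩ := exteriorGraph_adj.1 hadj
    by_cases heΛ : e ∈ Λ
    · have hwΛ : w ∈ verts Λ := ⟨e, heΛ, by simp [he]⟩
      have hwΛ' : w' ∈ verts Λ := ⟨e, heΛ, by simp [he]⟩
      refine ⟨⟨w', hwΛ'⟩, ?_, SimpleGraph.Reachable.refl _⟩
      refine (hu'.trans _ _ _ (.rel _ ⟨w, hwΛ⟩ (Or.inr (Or.inl hw)))).trans _ _ _ (.rel _ _ ?_)
      exact Or.inl ⟨⟨e, heΛ⟩, hA, he⟩
    · exact ⟨u', hu', hw.trans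
        (SimpleGraph.Adj.reachable (exteriorGraph_adj.2 ⟨e, he, heΛ, hA⟩))⟩

/-- The cluster of `u` is covered by the exterior clusters of finitely many vertices of `Λ`, so one
of those is infinite. -/
theorem exists_eqvGen_infinite (Λ : Finset G.edgeSet) (A : G.edgeSet → Bool) (u : verts Λ)
    (h : InInfiniteCluster (exteriorGraph ∅ A) u) :
    ∃ u' : verts Λ, Relation.EqvGen (clusterRel Λ (inducedBoundary Λ A) fun e => A e) u u' ∧
      InInfiniteCluster (exteriorGraph Λ A) u' := by
  by_contra hcon
  push Not at hcon
  refine h (Set.Finite.subset (Set.Finite.biUnion (Set.toFinite {u' : verts Λ |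
    Relation.EqvGen (clusterRel Λ (inducedBoundary Λ A) fun e => A e) u u'})
    fun u' hu' => Set.not_infinite.1 (hcon u' hu')) fun w hw => ?_)
  obtain ⟨u', hu', hw'⟩ := exists_eqvGen_reachable Λ A u hw
  exact Set.mem_biUnion hu' hw'

/-- This makes the boundary condition intrinsic: exterior identifications together with the open
edges of `Λ` recover the partition of the full configuration. Cluster counts for different `Λ` then
become comparable. -/
theorem eqvGen_clusterRel_iff (Λ : Finset G.edgeSet) (A : G.edgeSet → Bool) (u v : verts Λ) :
    Relation.EqvGen (clusterRel Λ (inducedBoundary Λ A) fun e => A e) u v ↔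
      wiredAtInfinity (exteriorGraph ∅ A) (u : V) v := by
  constructor
  · intro h
    induction h with
    | rel u v h =>
      rcases h with ⟨e, hA, he⟩ | h
      · exact Or.inl (SimpleGraph.Adj.reachable (exteriorGraph_adj.2 ⟨e, he, by simp, hA⟩))
      · exact wiredAtInfinity_mono (exteriorGraph_le Λ A) h
    | refl => exact Setoid.refl' _ _
    | symm _ _ _ ih => exact Setoid.symm' _ ih
    | trans _ _ _ _ _ ih ih' => exact Setoid.trans' _ ih ih'
  · rintro (h | ⟨hu, hv⟩)
    · obtain ⟨u', hu', hw⟩ := exists_eqvGen_reachable Λ A u h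
      exact hu'.trans _ _ _ (.rel _ _ (Or.inr (Or.inl hw)))
    · obtain ⟨u', hu', hui⟩ := exists_eqvGen_infinite Λ A u hu
      obtain ⟨v', hv', hvi⟩ := exists_eqvGen_infinite Λ A v hv
      exact (hu'.trans _ _ _ (.rel _ _ (Or.inr (Or.inr ⟨hui, hvi⟩)))).trans _ _ _ (hv'.symm _ _)

/-- The class of `u` under the partition of the vertices induced by `H`. -/
def wiredClass (H : SimpleGraph V) (u : V) : Set V := {v | wiredAtInfinity H u v}

theorem wiredClass_eq_iff {H : SimpleGraph V} {u v : V} :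
    wiredClass H u = wiredClass H v ↔ wiredAtInfinity H u v := by
  constructor
  · intro h
    have : v ∈ wiredClass H v := (wiredAtInfinity H).refl' v
    rwa [← h] at this
  · intro h
    ext w
    exact ⟨fun hw => Setoid.trans' _ (Setoid.symm' _ h) hw, fun hw => Setoid.trans' _ h hw⟩

/-- The number of clusters of the configuration `A`, all infinite ones being identified, that meet
the vertices of `Λ`. -/
def clusterCount (Λ : Finset G.edgeSet) (A : G.edgeSet → Bool) : ℕ :=
  (wiredClass (exteriorGraph ∅ A) '' verts Λ).ncard

theorem numClusters_eq_clusterCount (Λ : Finset G.edgeSet) (A : G.edgeSet → Bool) :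
    numClusters Λ (inducedBoundary Λ A) (fun e => A e) = clusterCount Λ A := by
  let f : Quot (clusterRel Λ (inducedBoundary Λ A) fun e => A e) → Set V :=
    Quot.lift (fun u => wiredClass (exteriorGraph ∅ A) u) fun u v h =>
      wiredClass_eq_iff.2 ((eqvGen_clusterRel_iff Λ A u v).1 (.rel _ _ h))
  have hf : Function.Injective f := by
    rintro ⟨u⟩ ⟨v⟩ h
    exact Quot.eqvGen_sound ((eqvGen_clusterRel_iff Λ A u v).2 (wiredClass_eq_iff.1 h))
  have hr : Set.range f = wiredClass (exteriorGraph ∅ A) '' verts Λ := by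
    ext s
    constructor
    · rintro ⟨⟨u⟩, rfl⟩; exact ⟨u, u.2, rfl⟩
    · rintro ⟨u, hu, rfl⟩; exact ⟨Quot.mk _ ⟨u, hu⟩, rfl⟩
  rw [clusterCount, ← hr, ← Nat.card_coe_set_eq]
  exact Nat.card_congr (Equiv.ofInjective f hf)

theorem exists_reachable_verts_or {Λ : Finset G.edgeSet} {A : G.edgeSet → Bool} {u w : V}
    (h : (exteriorGraph ∅ A).Reachable u w) :
    (∃ x ∈ verts Λ, (exteriorGraph Λ A).Reachable u x) ∨ (exteriorGraph Λ A).Reachable u w := by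
  rw [SimpleGraph.reachable_iff_reflTransGen] at h
  induction h with
  | refl => exact Or.inr (SimpleGraph.Reachable.refl _)
  | @tail w w' _ hadj ih =>
    refine ih.elim Or.inl fun hw => ?_
    obtain ⟨e, he, -, hA⟩ := exteriorGraph_adj.1 hadj
    by_cases heΛ : e ∈ Λ
    · exact Or.inl ⟨w, ⟨e, heΛ, by simp [he]⟩, hw⟩
    · exact Or.inr (hw.trans (SimpleGraph.Adj.reachable (exteriorGraph_adj.2 ⟨e, he, heΛ, hA⟩)))

/-- An exterior class that misses `Λ` cannot be enlarged through `Λ`. If the class is the infinite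
one, no vertex of `Λ` is in an infinite exterior cluster, hence none is in an infinite cluster of
`A`, and every infinite cluster of `A` avoids `Λ`. -/
theorem wiredAtInfinity_iff_of_disjoint {Λ : Finset G.edgeSet} {A : G.edgeSet → Bool} {u : V}
    (h : ∀ x ∈ verts Λ, ¬ wiredAtInfinity (exteriorGraph Λ A) u x) (v : V) :
    wiredAtInfinity (exteriorGraph ∅ A) u v ↔ wiredAtInfinity (exteriorGraph Λ A) u v := by
  refine ⟨?_, wiredAtInfinity_mono (exteriorGraph_le Λ A)⟩
  have hreach : ∀ w, (exteriorGraph ∅ A).Reachable u w → (exteriorGraph Λ A).Reachable u w :=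
    fun w hw => (exists_reachable_verts_or hw).resolve_left
      fun ⟨x, hx, hux⟩ => h x hx (Or.inl hux)
  rintro (huv | ⟨hu, hv⟩)
  · exact Or.inl (hreach v huv)
  · have hu' : InInfiniteCluster (exteriorGraph Λ A) u :=
      Set.Infinite.mono hreach hu
    refine Or.inr ⟨hu', ?_⟩
    have hno : ∀ x ∈ verts Λ, ¬ InInfiniteCluster (exteriorGraph Λ A) x :=
      fun x hx hxi => h x hx (Or.inr ⟨hu', hxi⟩)
    have hno' : ∀ x ∈ verts Λ, ¬ InInfiniteCluster (exteriorGraph ∅ A) x := by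
      intro x hx hxi
      obtain ⟨x', -, hx'⟩ := exists_eqvGen_infinite Λ A ⟨x, hx⟩ hxi
      exact hno x' x'.2 hx'
    refine Set.Infinite.mono (fun w hw => ?_) hv
    refine (exists_reachable_verts_or hw).resolve_left fun ⟨x, hx, hvx⟩ => ?_
    exact hno' x hx (hv.of_reachable (hvx.mono (exteriorGraph_le Λ A)))

/-- The point is that the second summand depends only on the configuration off `Λ`; this is what
factorizes the weights on nested sets. -/
theorem clusterCount_eq_add {Λ B : Finset G.edgeSet} (h : Λ ⊆ B) (A : G.edgeSet → Bool) :
    clusterCount B A = clusterCount Λ A + (wiredClass (exteriorGraph Λ A) ''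
      {u ∈ verts B | ∀ x ∈ verts Λ, ¬ wiredAtInfinity (exteriorGraph Λ A) u x}).ncard := by
  have himg : wiredClass (exteriorGraph Λ A) ''
      {u ∈ verts B | ∀ x ∈ verts Λ, ¬ wiredAtInfinity (exteriorGraph Λ A) u x} =
      wiredClass (exteriorGraph ∅ A) ''
      {u ∈ verts B | ∀ x ∈ verts Λ, ¬ wiredAtInfinity (exteriorGraph Λ A) u x} := by
    refine Set.image_congr fun u hu => ?_
    ext v
    exact (wiredAtInfinity_iff_of_disjoint hu.2 v).symm
  have hun : wiredClass (exteriorGraph ∅ A) '' verts B =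
      wiredClass (exteriorGraph ∅ A) '' verts Λ ∪ wiredClass (exteriorGraph ∅ A) ''
      {u ∈ verts B | ∀ x ∈ verts Λ, ¬ wiredAtInfinity (exteriorGraph Λ A) u x} := by
    refine Set.Subset.antisymm ?_ (Set.union_subset (Set.image_mono (verts_mono h))
      (Set.image_mono (Set.sep_subset _ _)))
    rintro _ ⟨u, hu, rfl⟩
    by_cases hux : ∀ x ∈ verts Λ, ¬ wiredAtInfinity (exteriorGraph Λ A) u x
    · exact Or.inr ⟨u, ⟨hu, hux⟩, rfl⟩
    · push Not at hux
      obtain ⟨x, hx, hux⟩ := hux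
      exact Or.inl ⟨x, hx, (wiredClass_eq_iff.2
        (wiredAtInfinity_mono (exteriorGraph_le Λ A) hux)).symm⟩
  rw [himg, clusterCount, clusterCount, hun, Set.ncard_union_eq]
  · rw [Set.disjoint_left]
    rintro _ ⟨x, hx, rfl⟩ ⟨u, hu, hux⟩
    exact hu.2 x hx ((wiredAtInfinity_iff_of_disjoint hu.2 x).1 (wiredClass_eq_iff.1 hux))

/-- The random-cluster weight of the restriction of `A` to `Λ`, with the boundary condition induced
by `A`. -/
def configWeight (p q : ℝ) (Λ : Finset G.edgeSet) (A : G.edgeSet → Bool) : ℝ :=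
  (∏ e ∈ Λ, if A e = true then p else 1 - p) * q ^ clusterCount Λ A

theorem weight_eq_configWeight (p q : ℝ) (Λ : Finset G.edgeSet) (A : G.edgeSet → Bool) :
    weight p q Λ (inducedBoundary Λ A) (fun e => A e) = configWeight p q Λ A := by
  rw [weight, configWeight, numClusters_eq_clusterCount]
  congr 1
  rw [← Finset.prod_coe_sort, Finset.prod_ite, Finset.prod_const, Finset.prod_const,
    Nat.card_eq_fintype_card, Nat.card_eq_fintype_card, Fintype.card_subtype, Fintype.card_subtype]
  simp

theorem sum_config_eq_sum_powerset (Λ : Finset G.edgeSet) (f : (Λ → Bool) → ℝ) :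
    ∑ η : Λ → Bool, f η = ∑ O ∈ Λ.powerset, f fun e => decide ((e : G.edgeSet) ∈ O) := by
  refine Finset.sum_bij' (fun η _ => (Finset.univ.filter fun e : Λ => η e = true).map
    (Function.Embedding.subtype _)) (fun O _ e => decide ((e : G.edgeSet) ∈ O)) ?_ ?_ ?_ ?_ ?_
  · intro η _
    rw [Finset.mem_powerset]
    intro e he
    simp only [Finset.mem_map, Function.Embedding.subtype_apply] at he
    obtain ⟨e', -, rfl⟩ := he
    exact e'.2
  · intros; simp
  · intro η _
    ext e
    simp
  · intro O hO
    ext e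
    have hOe : e ∈ O → e ∈ Λ := fun h => Finset.mem_powerset.1 hO h
    simp only [Finset.mem_map, Finset.mem_filter, Finset.mem_univ, true_and,
      Function.Embedding.subtype_apply, decide_eq_true_eq]
    exact ⟨fun ⟨e', h, h'⟩ => h' ▸ h, fun h => ⟨⟨e, hOe h⟩, h, rfl⟩⟩
  · intro η _
    congr 1
    ext e
    simp

theorem partitionFunction_eq_sumOver (p q : ℝ) (Λ : Finset G.edgeSet) (A : G.edgeSet → Bool) :
    partitionFunction p q Λ (inducedBoundary Λ A) = sumOver Λ (configWeight p q Λ) A := by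
  rw [partitionFunction]
  refine Eq.trans (Eq.trans (Finset.sum_congr ?_ fun _ _ => rfl)
    (sum_config_eq_sum_powerset Λ (weight p q Λ (inducedBoundary Λ A)))) ?_
  · ext; simp
  refine Finset.sum_congr rfl fun O _ => ?_
  rw [← weight_eq_configWeight, inducedBoundary_congr (A := glue Λ O A) (A' := A)
    fun e he => glue_of_notMem he]
  congr 1
  ext e
  simp [glue]

/-- The conditional probability of the restriction of `A` to `Λ` given the restriction of `A` to the
complement of `Λ`. -/
def configProb (p q : ℝ) (Λ : Finset G.edgeSet) (A : G.edgeSet → Bool) : ℝ :=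
  configWeight p q Λ A / sumOver Λ (configWeight p q Λ) A

theorem finiteProb_eq_configProb (p q : ℝ) (Λ : Finset G.edgeSet) (A : G.edgeSet → Bool) :
    finiteProb p q Λ (inducedBoundary Λ A) (fun e => A e) = configProb p q Λ A := by
  rw [finiteProb, configProb, weight_eq_configWeight, partitionFunction_eq_sumOver]

theorem finiteProb_eq_configProb_glue (p q : ℝ) (Λ O : Finset G.edgeSet) (A : G.edgeSet → Bool) :
    finiteProb p q Λ (inducedBoundary Λ A) (fun e => decide ((e : G.edgeSet) ∈ O)) =
      configProb p q Λ (glue Λ O A) := by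
  rw [← finiteProb_eq_configProb, inducedBoundary_congr (A := glue Λ O A) (A' := A)
    fun e he => glue_of_notMem he]
  congr 1
  ext e
  simp [glue]

variable {p q : ℝ}

theorem configWeight_pos (hp0 : 0 < p) (hp1 : p < 1) (hq : 1 < q) (Λ : Finset G.edgeSet)
    (A : G.edgeSet → Bool) : 0 < configWeight p q Λ A := by
  refine mul_pos (Finset.prod_pos fun e _ => ?_) (by positivity)
  split_ifs <;> linarith

theorem configProb_nonneg (hp0 : 0 < p) (hp1 : p < 1) (hq : 1 < q) (Λ : Finset G.edgeSet)
    (A : G.edgeSet → Bool) : 0 ≤ configProb p q Λ A :=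
  div_nonneg (configWeight_pos hp0 hp1 hq Λ A).le
    (sumOver_pos fun B _ => configWeight_pos hp0 hp1 hq Λ B).le

theorem sumOver_mul_configProb (Λ : Finset G.edgeSet) (F : (G.edgeSet → Bool) → ℝ)
    (A : G.edgeSet → Bool) : sumOver Λ (fun B => F B * configProb p q Λ B) A =
      sumOver Λ (fun B => F B * configWeight p q Λ B) A / sumOver Λ (configWeight p q Λ) A := by
  rw [div_eq_mul_inv, mul_comm, ← sumOver_mul_left]
  refine sumOver_congr (fun _ _ => rfl) fun B hB => ?_
  rw [configProb, sumOver_congr (A := B) (A' := A) hB fun _ _ => rfl]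
  ring

theorem sumOver_configProb (hp0 : 0 < p) (hp1 : p < 1) (hq : 1 < q) (Λ : Finset G.edgeSet)
    (A : G.edgeSet → Bool) : sumOver Λ (configProb p q Λ) A = 1 := by
  have := sumOver_mul_configProb (p := p) (q := q) Λ (fun _ => 1) A
  simp only [one_mul] at this
  rw [this]
  exact div_self (sumOver_pos fun B _ => configWeight_pos hp0 hp1 hq Λ B).ne'

/-- The conditional distributions on nested finite edge sets are consistent. -/
theorem sumOver_configProb_of_subset (hp0 : 0 < p) (hp1 : p < 1) (hq : 1 < q)
    {Λ B : Finset G.edgeSet} (h : Λ ⊆ B) (F : (G.edgeSet → Bool) → ℝ) (A : G.edgeSet → Bool) :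
    sumOver B (fun C => sumOver Λ (fun C' => F C' * configProb p q Λ C') C * configProb p q B C) A =
      sumOver B (fun C => F C * configProb p q B C) A := by
  rw [sumOver_mul_configProb, sumOver_mul_configProb]
  congr 1
  -- The part of the weight on `B` that resampling `Λ` leaves unchanged.
  let κ : (G.edgeSet → Bool) → ℝ := fun C => (∏ e ∈ B \ Λ, if C e = true then p else 1 - p) *
    q ^ (wiredClass (exteriorGraph Λ C) ''
      {u ∈ verts B | ∀ x ∈ verts Λ, ¬ wiredAtInfinity (exteriorGraph Λ C) u x}).ncard
  have hκ : ∀ C, configWeight p q B C = κ C * configWeight p q Λ C := by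
    intro C
    simp only [configWeight, κ]
    rw [clusterCount_eq_add h, pow_add, ← Finset.prod_sdiff h]
    ring
  have hκc : ∀ C C', (∀ e ∉ Λ, C e = C' e) → κ C = κ C' := by
    intro C C' hC
    simp only [κ]
    rw [exteriorGraph_congr hC]
    congr 1
    refine Finset.prod_congr rfl fun e he => ?_
    rw [hC e (Finset.mem_sdiff.1 he).2]
  have hB : ∀ e, e ∈ B ↔ e ∈ B \ Λ ∨ e ∈ Λ := fun e => by
    rw [Finset.mem_sdiff]
    exact ⟨fun he => or_iff_not_imp_right.2 fun he' => ⟨he, he'⟩, fun he => he.elim (·.1) (h ·)⟩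
  rw [sumOver_of_mem_iff Finset.sdiff_disjoint hB, sumOver_of_mem_iff Finset.sdiff_disjoint hB]
  refine sumOver_congr (fun _ _ => rfl) fun C _ => ?_
  have hpos : 0 < sumOver Λ (configWeight p q Λ) C :=
    sumOver_pos fun B _ => configWeight_pos hp0 hp1 hq Λ B
  calc _ = sumOver Λ (fun C' => (sumOver Λ (fun C' => F C' * configProb p q Λ C') C * κ C) *
        configWeight p q Λ C') C := by
        refine sumOver_congr (fun _ _ => rfl) fun C' hC' => ?_
        rw [hκ, hκc C' C hC', sumOver_congr (A := C') (A' := C) hC' fun _ _ => rfl]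
        ring
    _ = κ C * sumOver Λ (fun C' => F C' * configWeight p q Λ C') C := by
        rw [sumOver_mul_left, sumOver_mul_configProb]
        field_simp
    _ = _ := by
        rw [← sumOver_mul_left]
        refine sumOver_congr (fun _ _ => rfl) fun C' hC' => ?_
        rw [hκ, hκc C' C hC']
        ring

end Clusters

/-! ### DLR equations as invariance under resampling -/

section DLR

variable {V : Type*} {G : SimpleGraph V} {p q : ℝ}

theorem exteriorSigma_le (Λ : Finset G.edgeSet) :
    exteriorSigma Λ ≤ (inferInstance : MeasurableSpace (G.edgeSet → Bool)) :=
  Measurable.comap_le (measurable_pi_lambda _ fun _ => measurable_pi_apply _)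

theorem measurable_eval_exteriorSigma {Λ : Finset G.edgeSet} {e : G.edgeSet} (he : e ∉ Λ) :
    Measurable[exteriorSigma Λ] fun A : G.edgeSet → Bool => A e := by
  have h := comap_measurable (m := MeasurableSpace.pi)
    fun (A : G.edgeSet → Bool) (e : {e : G.edgeSet // e ∉ Λ}) => A e
  exact @Measurable.comp _ _ _ (exteriorSigma Λ) _ _ _ _
    (measurable_pi_apply (⟨e, he⟩ : {e : G.edgeSet // e ∉ Λ})) h

theorem measurable_glue_exteriorSigma (Λ O : Finset G.edgeSet) :
    Measurable[exteriorSigma Λ] fun A : G.edgeSet → Bool => glue Λ O A := by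
  refine @measurable_pi_lambda _ _ _ (exteriorSigma Λ) _ _ fun e => ?_
  by_cases he : e ∈ Λ
  · simp only [glue, he, if_true]
    exact measurable_const
  · simp only [glue, he, if_false]
    exact measurable_eval_exteriorSigma he

theorem measurable_glue {E : Type*} (Λ O : Finset E) :
    Measurable fun A : E → Bool => glue Λ O A := by
  refine measurable_pi_lambda _ fun e => ?_
  by_cases he : e ∈ Λ
  · simp only [glue, he, if_true]
    exact measurable_const
  · simp only [glue, he, if_false]
    exact measurable_pi_apply e

theorem measurable_sumOver {E : Type*} (Λ : Finset E) {F : (E → Bool) → ℝ} (hF : Measurable F) :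
    Measurable (sumOver Λ F) :=
  Finset.measurable_sum _ fun O _ => hF.comp (measurable_glue Λ O)

theorem measurableSet_exteriorGraph_adj (Λ : Finset G.edgeSet) (u v : V) :
    MeasurableSet[exteriorSigma Λ] {A | (exteriorGraph Λ A).Adj u v} := by
  by_cases h : ∃ e : G.edgeSet, (e : Sym2 V) = s(u, v) ∧ e ∉ Λ
  · obtain ⟨e, he, heΛ⟩ := h
    have : {A | (exteriorGraph Λ A).Adj u v} = (fun A : G.edgeSet → Bool => A e) ⁻¹' {true} := by
      ext A
      simp only [Set.mem_ofPred_eq, exteriorGraph_adj, Set.mem_preimage, Set.mem_singleton_iff]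
      constructor
      · rintro ⟨e', he', -, hA⟩
        rwa [Subtype.ext (he.trans he'.symm)]
      · exact fun hA => ⟨e, he, heΛ, hA⟩
    rw [this]
    exact measurable_eval_exteriorSigma heΛ (measurableSet_singleton _)
  · have : {A | (exteriorGraph Λ A).Adj u v} = ∅ := by
      ext A
      simp only [Set.mem_ofPred_eq, exteriorGraph_adj, Set.mem_empty_iff_false, iff_false]
      exact fun ⟨e, he, heΛ, _⟩ => h ⟨e, he, heΛ⟩
    rw [this]
    exact @MeasurableSet.empty _ (exteriorSigma Λ)

/-- `v` can be reached from `u` in exactly `n` steps. -/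
def StepReach (H : SimpleGraph V) (u : V) : ℕ → V → Prop
  | 0, v => u = v
  | n + 1, v => ∃ w, StepReach H u n w ∧ H.Adj w v

theorem reachable_iff_stepReach {H : SimpleGraph V} {u v : V} :
    H.Reachable u v ↔ ∃ n, StepReach H u n v := by
  rw [SimpleGraph.reachable_iff_reflTransGen]
  constructor
  · intro h
    induction h with
    | refl => exact ⟨0, rfl⟩
    | tail _ hadj ih => exact ih.imp' Nat.succ fun n hn => ⟨_, hn, hadj⟩
  · rintro ⟨n, hn⟩
    induction n generalizing v with
    | zero => rw [StepReach] at hn; subst hn; exact .refl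
    | succ n ih =>
      obtain ⟨w, hw, hadj⟩ := hn
      exact (ih hw).tail hadj

/-- A function of a configuration is the sum over the possible restrictions to a finite set. -/
theorem eq_sum_glue {E : Type*} (Λ : Finset E) (F : (E → Bool) → ℝ) (A : E → Bool) :
    F A = ∑ O ∈ Λ.powerset, if glue Λ O A = A then F (glue Λ O A) else 0 := by
  have hiff : ∀ O, glue Λ O A = A ↔ ∀ e ∈ Λ, A e = decide (e ∈ O) := by
    intro O
    constructor
    · intro h e he
      rw [← glue_of_mem he (A := A), h]
    · intro h
      ext e
      by_cases he : e ∈ Λ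
      · rw [glue_of_mem he, h e he]
      · rw [glue_of_notMem he]
  rw [Finset.sum_eq_single (Λ.filter fun e => A e = true)]
  · have : glue Λ (Λ.filter fun e => A e = true) A = A :=
      (hiff _).2 fun e he => by simp [he]
    rw [if_pos this, this]
  · intro O hO hne
    rw [if_neg]
    rw [hiff]
    intro h
    refine hne ?_
    ext e
    rw [Finset.mem_filter]
    constructor
    · intro he
      have heΛ := Finset.mem_powerset.1 hO he
      exact ⟨heΛ, by simp [h e heΛ, he]⟩
    · rintro ⟨heΛ, he⟩
      rw [h e heΛ] at he
      exact of_decide_eq_true he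
  · intro h
    exact absurd (Finset.mem_powerset.2 (Finset.filter_subset _ _)) h

theorem measurableSet_glue_eq {E : Type*} (Λ O : Finset E) :
    MeasurableSet {A : E → Bool | glue Λ O A = A} := by
  have : {A : E → Bool | glue Λ O A = A} =
      ⋂ e ∈ Λ, (fun A : E → Bool => A e) ⁻¹' {decide (e ∈ O)} := by
    ext A
    simp only [Set.mem_ofPred_eq, Set.mem_iInter, Set.mem_preimage, Set.mem_singleton_iff]
    constructor
    · intro h e he
      rw [← glue_of_mem he (A := A), h]
    · intro h
      ext e
      by_cases he : e ∈ Λ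
      · rw [glue_of_mem he, h e he]
      · rw [glue_of_notMem he]
  rw [this]
  exact Finset.measurableSet_biInter _ fun e _ => measurable_pi_apply e (measurableSet_singleton _)

theorem integrable_of_bounded {Ω : Type*} [MeasurableSpace Ω] {ν : Measure Ω} [IsFiniteMeasure ν]
    {F : Ω → ℝ} (hF : Measurable F) {C : ℝ} (hC : ∀ A, |F A| ≤ C) : Integrable F ν :=
  Integrable.of_bound hF.aestronglyMeasurable C (ae_of_all _ hC)

theorem configProb_le_one (hp0 : 0 < p) (hp1 : p < 1) (hq : 1 < q) (Λ : Finset G.edgeSet)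
    (A : G.edgeSet → Bool) : configProb p q Λ A ≤ 1 := by
  have h := sumOver_configProb hp0 hp1 hq Λ A
  have hself : glue Λ (Λ.filter fun e => A e = true) A = A := by
    ext e
    by_cases he : e ∈ Λ <;> simp [glue, he]
  rw [← h, sumOver]
  refine le_trans ?_ (Finset.single_le_sum (fun O _ => configProb_nonneg hp0 hp1 hq Λ _)
    (Finset.mem_powerset.2 (Finset.filter_subset (fun e => A e = true) Λ)))
  rw [hself]

theorem abs_sumOver_configProb_le (hp0 : 0 < p) (hp1 : p < 1) (hq : 1 < q) (Λ : Finset G.edgeSet)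
    {F : (G.edgeSet → Bool) → ℝ} {C : ℝ} (hC : ∀ A, |F A| ≤ C) (A : G.edgeSet → Bool) :
    |sumOver Λ (fun B => F B * configProb p q Λ B) A| ≤ C := by
  calc _ ≤ ∑ O ∈ Λ.powerset, C * configProb p q Λ (glue Λ O A) := by
        refine (Finset.abs_sum_le_sum_abs _ _).trans (Finset.sum_le_sum fun O _ => ?_)
        rw [abs_mul, abs_of_nonneg (configProb_nonneg hp0 hp1 hq _ _)]
        exact mul_le_mul_of_nonneg_right (hC _) (configProb_nonneg hp0 hp1 hq _ _)
    _ = C := by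
        rw [← Finset.mul_sum]
        exact (congrArg _ (sumOver_configProb hp0 hp1 hq Λ A)).trans (mul_one C)

variable [Countable V]

theorem measurableSet_exteriorGraph_reachable (Λ : Finset G.edgeSet) (u v : V) :
    MeasurableSet[exteriorSigma Λ] {A | (exteriorGraph Λ A).Reachable u v} := by
  have hstep : ∀ n v, MeasurableSet[exteriorSigma Λ] {A | StepReach (exteriorGraph Λ A) u n v} := by
    intro n
    induction n with
    | zero => exact fun v => MeasurableSet.const _
    | succ n ih =>
      intro v
      have : {A | StepReach (exteriorGraph Λ A) u (n + 1) v} =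
          ⋃ w, {A | StepReach (exteriorGraph Λ A) u n w} ∩ {A | (exteriorGraph Λ A).Adj w v} := by
        ext A; simp [StepReach]
      rw [this]
      exact MeasurableSet.iUnion fun w => (ih w).inter (measurableSet_exteriorGraph_adj Λ w v)
  have : {A | (exteriorGraph Λ A).Reachable u v} =
      ⋃ n, {A | StepReach (exteriorGraph Λ A) u n v} := by
    ext A; simp [reachable_iff_stepReach]
  rw [this]
  exact MeasurableSet.iUnion fun n => hstep n v

theorem measurableSet_inInfiniteCluster (Λ : Finset G.edgeSet) (u : V) :
    MeasurableSet[exteriorSigma Λ] {A | InInfiniteCluster (exteriorGraph Λ A) u} := by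
  have : {A | InInfiniteCluster (exteriorGraph Λ A) u} =
      ⋂ F : Finset V, ⋃ w : V, ⋃ _ : w ∉ F, {A | (exteriorGraph Λ A).Reachable u w} := by
    ext A
    simp only [Set.mem_ofPred_eq, Set.mem_iInter, Set.mem_iUnion, exists_prop]
    constructor
    · intro h F
      obtain ⟨w, hw, hwF⟩ := Set.Infinite.exists_notMem_finset h F
      exact ⟨w, hwF, hw⟩
    · intro h hfin
      obtain ⟨w, hw, hw'⟩ := h (Set.Finite.toFinset hfin)
      exact hw ((Set.Finite.mem_toFinset _).2 hw')
  rw [this]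
  exact MeasurableSet.iInter fun F => MeasurableSet.iUnion fun w => MeasurableSet.iUnion fun _ =>
    measurableSet_exteriorGraph_reachable Λ u w

/-- There are only finitely many partitions of `verts Λ`, and each is singled out by finitely many
connection events of the exterior. -/
theorem measurable_inducedBoundary (Λ : Finset G.edgeSet) (f : Setoid (verts Λ) → ℝ) :
    Measurable[exteriorSigma Λ] fun A => f (inducedBoundary Λ A) := by
  have hset : ∀ u v : verts Λ, MeasurableSet[exteriorSigma Λ]
      {A | (inducedBoundary Λ A) u v} := by
    intro u v
    exact (measurableSet_exteriorGraph_reachable Λ (u : V) v).union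
      ((measurableSet_inInfiniteCluster Λ (u : V)).inter (measurableSet_inInfiniteCluster Λ (v : V)))
  have hfin : Finite (Setoid (verts Λ)) :=
    Finite.of_injective (fun ξ : Setoid (verts Λ) => fun u v => ξ u v) fun ξ ξ' h => by
      ext u v; exact iff_of_eq (congrFun (congrFun h u) v)
  intro s _
  have : (fun A => f (inducedBoundary Λ A)) ⁻¹' s =
      ⋃ ξ : Setoid (verts Λ), ⋃ _ : f ξ ∈ s, ⋂ u : verts Λ, ⋂ v : verts Λ,
        {A | (inducedBoundary Λ A) u v ↔ ξ u v} := by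
    ext A
    simp only [Set.mem_preimage, Set.mem_iUnion, Set.mem_iInter, Set.mem_ofPred_eq, exists_prop]
    constructor
    · exact fun h => ⟨_, h, fun _ _ => Iff.rfl⟩
    · rintro ⟨ξ, hξ, h⟩
      rwa [Setoid.ext h]
  rw [this]
  refine MeasurableSet.iUnion fun ξ => MeasurableSet.iUnion fun _ => MeasurableSet.iInter fun u =>
    MeasurableSet.iInter fun v => ?_
  by_cases h : ξ u v
  · simpa [h] using hset u v
  · have := (hset u v).compl
    simp only [h, iff_false]
    exact this

theorem measurable_configProb_glue (Λ O : Finset G.edgeSet) :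
    Measurable[exteriorSigma Λ] fun A => configProb p q Λ (glue Λ O A) := by
  simp only [← finiteProb_eq_configProb_glue]
  exact measurable_inducedBoundary Λ
    fun ξ => finiteProb p q Λ ξ fun e => decide ((e : G.edgeSet) ∈ O)

theorem measurable_configProb (Λ : Finset G.edgeSet) : Measurable (configProb p q Λ) := by
  have : configProb p q Λ = fun A => ∑ O ∈ Λ.powerset,
      if glue Λ O A = A then configProb p q Λ (glue Λ O A) else 0 := by
    ext A; exact eq_sum_glue Λ (configProb p q Λ) A
  rw [this]
  refine Finset.measurable_sum _ fun O _ => Measurable.ite (measurableSet_glue_eq Λ O)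
    ((measurable_configProb_glue Λ O).mono (exteriorSigma_le Λ) le_rfl) measurable_const

/-- `ν` is invariant under resampling the edges of `Λ`. -/
def IsResamplingInvariant (p q : ℝ) (Λ : Finset G.edgeSet) (ν : Measure (G.edgeSet → Bool)) :
    Prop :=
  ∀ F : (G.edgeSet → Bool) → ℝ, Measurable F → (∃ C, ∀ A, |F A| ≤ C) →
    ∫ A, F A ∂ν = ∫ A, sumOver Λ (fun B => F B * configProb p q Λ B) A ∂ν

/-- Split `F` according to the restriction of `A` to `Λ`. On each piece `F` equals `F (glue Λ O A)`,
which is exterior-measurable and can be pulled out of the conditional expectation supplied by the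
DLR property. -/
theorem IsWiredGibbsMeasure.isResamplingInvariant (hp0 : 0 < p) (hp1 : p < 1) (hq : 1 < q)
    {ν : Measure (G.edgeSet → Bool)} (h : IsWiredGibbsMeasure G p q ν) (Λ : Finset G.edgeSet) :
    IsResamplingInvariant p q Λ ν := by
  have := h.isProbabilityMeasure
  rintro F hF ⟨C, hC⟩
  have hm := exteriorSigma_le Λ
  have key : ∀ O ∈ Λ.powerset,
      ∫ A, (if glue Λ O A = A then F (glue Λ O A) else 0) ∂ν =
        ∫ A, F (glue Λ O A) * configProb p q Λ (glue Λ O A) ∂ν := by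
    intro O _
    set S : Set (G.edgeSet → Bool) :=
      {A | ∀ e : Λ, A e = decide ((e : G.edgeSet) ∈ O)} with hS
    have hSiff : ∀ A, A ∈ S ↔ glue Λ O A = A := by
      intro A
      constructor
      · intro h
        ext e
        by_cases he : e ∈ Λ
        · rw [glue_of_mem he, h ⟨e, he⟩]; simp
        · rw [glue_of_notMem he]
      · intro h e
        rw [← h, glue_of_mem e.2]
        simp
    have hSm : MeasurableSet S := by
      have : S = {A | glue Λ O A = A} := by ext A; exact hSiff A
      rw [this]; exact measurableSet_glue_eq Λ O
    have hg : Measurable[exteriorSigma Λ] fun A => F (glue Λ O A) :=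
      hF.comp (measurable_glue_exteriorSigma Λ O)
    have h1 : (fun A => if glue Λ O A = A then F (glue Λ O A) else 0) =
        (S.indicator fun _ => (1 : ℝ)) * fun A => F (glue Λ O A) := by
      ext A
      by_cases hA : glue Λ O A = A
      · rw [if_pos hA, Pi.mul_apply, Set.indicator_of_mem ((hSiff A).2 hA), one_mul]
      · rw [if_neg hA, Pi.mul_apply, Set.indicator_of_notMem fun h => hA ((hSiff A).1 h), zero_mul]
    have hint : Integrable (S.indicator fun _ => (1 : ℝ)) ν :=
      (integrable_const 1).indicator hSm
    have hint' : Integrable ((S.indicator fun _ => (1 : ℝ)) * fun A => F (glue Λ O A)) ν := by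
      rw [← h1]
      refine integrable_of_bounded (Measurable.ite (measurableSet_glue_eq Λ O)
        (hg.mono hm le_rfl) measurable_const) (C := C) fun A => ?_
      split_ifs
      · exact hC _
      · simpa using (abs_nonneg _).trans (hC A)
    have h2 := condExp_mul_of_stronglyMeasurable_right (m := exteriorSigma Λ)
      hg.stronglyMeasurable hint' hint
    rw [h1, ← integral_condExp hm]
    refine integral_congr_ae ?_
    filter_upwards [h2, h.dlr Λ fun e => decide ((e : G.edgeSet) ∈ O)] with A hA hA'
    rw [hA, Pi.mul_apply, hA', finiteProb_eq_configProb_glue, mul_comm]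
  calc ∫ A, F A ∂ν = ∫ A, ∑ O ∈ Λ.powerset,
        (if glue Λ O A = A then F (glue Λ O A) else 0) ∂ν :=
        integral_congr_ae (ae_of_all _ fun A => eq_sum_glue Λ F A)
    _ = ∑ O ∈ Λ.powerset, ∫ A, F (glue Λ O A) * configProb p q Λ (glue Λ O A) ∂ν := by
        rw [integral_finsetSum]
        · exact Finset.sum_congr rfl key
        · intro O _
          refine integrable_of_bounded (Measurable.ite (measurableSet_glue_eq Λ O)
            (hF.comp (measurable_glue Λ O)) measurable_const) (C := C) fun A => ?_
          split_ifs
          · exact hC _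
          · simpa using (abs_nonneg _).trans (hC A)
    _ = _ := by
        rw [← integral_finsetSum]
        · rfl
        · intro O _
          refine integrable_of_bounded ((hF.mul (measurable_configProb Λ)).comp
            (measurable_glue Λ O)) (C := C) fun A => ?_
          rw [abs_mul, abs_of_nonneg (configProb_nonneg hp0 hp1 hq _ _)]
          calc _ ≤ |F (glue Λ O A)| * 1 := by gcongr; exact configProb_le_one hp0 hp1 hq _ _
            _ ≤ C := by rw [mul_one]; exact hC _

/-- Resampling invariance for the indicator of `s ∩ S`, with `s` exterior and `S` the event `A(Λ) =
η`, is the defining identity of the conditional expectation, since resampling preserves `s`. -/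
theorem isWiredGibbsMeasure_of_isResamplingInvariant {ν : Measure (G.edgeSet → Bool)}
    (hp0 : 0 < p) (hp1 : p < 1) (hq : 1 < q)
    [IsProbabilityMeasure ν] (h : ∀ Λ, IsResamplingInvariant p q Λ ν) :
    IsWiredGibbsMeasure G p q ν := by
  refine ⟨inferInstance, fun Λ η => ?_⟩
  have hm := exteriorSigma_le Λ
  set S : Set (G.edgeSet → Bool) := {A | ∀ e : Λ, A e = η e} with hS
  have hSm : MeasurableSet S := by
    have : S = ⋂ e : Λ, (fun A : G.edgeSet → Bool => A e) ⁻¹' {η e} := by ext A; simp [hS]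
    rw [this]
    exact MeasurableSet.iInter fun e => measurable_pi_apply (e : G.edgeSet) (measurableSet_singleton _)
  set P : (G.edgeSet → Bool) → ℝ := fun A => finiteProb p q Λ (inducedBoundary Λ A) η with hP
  have hPm : Measurable[exteriorSigma Λ] P :=
    measurable_inducedBoundary Λ fun ξ => finiteProb p q Λ ξ η
  obtain ⟨O, hO, hη⟩ : ∃ O ⊆ Λ, η = fun e : Λ => decide ((e : G.edgeSet) ∈ O) := by
    refine ⟨Λ.filter fun e => ∃ h : e ∈ Λ, η ⟨e, h⟩ = true, Finset.filter_subset _ _, ?_⟩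
    ext e; simp
  have hPO : ∀ A, P A = configProb p q Λ (glue Λ O A) := fun A => by
    rw [hP, hη]; exact finiteProb_eq_configProb_glue p q Λ O A
  have hPint : Integrable P ν := by
    refine integrable_of_bounded (hPm.mono hm le_rfl) (C := 1) fun A => ?_
    rw [hPO, abs_of_nonneg (configProb_nonneg hp0 hp1 hq _ _)]
    exact configProb_le_one hp0 hp1 hq _ _
  refine (ae_eq_condExp_of_forall_setIntegral_eq hm ((integrable_const 1).indicator hSm)
    (fun _ _ _ => hPint.integrableOn) (fun s hs _ => ?_)
    hPm.stronglyMeasurable.aestronglyMeasurable).symm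
  have hs' := hm s hs
  rw [← integral_indicator hs', ← integral_indicator hs',
    h Λ (s.indicator (S.indicator fun _ => (1 : ℝ)))]
  · refine integral_congr_ae (ae_of_all _ fun A => ?_)
    have hsA : ∀ O, glue Λ O A ∈ s ↔ A ∈ s := by
      obtain ⟨t, -, rfl⟩ := hs
      intro O
      have : (fun e : {e : G.edgeSet // e ∉ Λ} => glue Λ O A e) =
          fun e : {e : G.edgeSet // e ∉ Λ} => A e := by
        ext e; rw [glue_of_notMem e.2]
      rw [Set.mem_preimage, Set.mem_preimage, this]
    have hSA : ∀ O' ∈ Λ.powerset, (glue Λ O' A ∈ S ↔ O' = O) := by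
      intro O' hO'
      simp only [hS, hη, Set.mem_ofPred_eq]
      constructor
      · intro h
        ext e
        by_cases he : e ∈ Λ
        · have := h ⟨e, he⟩
          simp only [glue_of_mem he, decide_eq_decide] at this
          exact this
        · exact ⟨fun h => absurd (Finset.mem_powerset.1 hO' h) he, fun h => absurd (hO h) he⟩
      · rintro rfl e
        simp [glue]
    rw [sumOver, Finset.sum_eq_single O]
    · by_cases hA : A ∈ s
      · rw [Set.indicator_of_mem hA, Set.indicator_of_mem ((hsA O).2 hA),
          Set.indicator_of_mem ((hSA O (Finset.mem_powerset.2 hO)).2 rfl), one_mul, hPO]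
      · rw [Set.indicator_of_notMem hA, Set.indicator_of_notMem (fun h => hA ((hsA O).1 h)),
          zero_mul]
    · intro O' hO' hne
      have : glue Λ O' A ∉ S := fun h => hne ((hSA O' hO').1 h)
      have h0 : s.indicator (S.indicator fun _ => (1 : ℝ)) (glue Λ O' A) = 0 := by
        by_cases hA : glue Λ O' A ∈ s
        · rw [Set.indicator_of_mem hA, Set.indicator_of_notMem this]
        · rw [Set.indicator_of_notMem hA]
      rw [h0, zero_mul]
    · exact fun h => absurd (Finset.mem_powerset.2 hO) h
  · exact (measurable_const.indicator hSm).indicator hs'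
  · refine ⟨1, fun A => ?_⟩
    by_cases h1 : A ∈ s <;> by_cases h2 : A ∈ S <;> simp [h1, h2]

/-- By consistency, a resampling of `B` absorbs a further resampling of `Λ ⊆ B`. On the tree it
therefore suffices to treat balls. -/
theorem IsResamplingInvariant.of_subset (hp0 : 0 < p) (hp1 : p < 1) (hq : 1 < q)
    {ν : Measure (G.edgeSet → Bool)} {Λ B : Finset G.edgeSet} (hΛB : Λ ⊆ B)
    (h : IsResamplingInvariant p q B ν) : IsResamplingInvariant p q Λ ν := by
  rintro F hF ⟨C, hC⟩
  rw [h F hF ⟨C, hC⟩, h (sumOver Λ fun B => F B * configProb p q Λ B)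
    (measurable_sumOver Λ (hF.mul (measurable_configProb Λ)))
    ⟨C, abs_sumOver_configProb_le hp0 hp1 hq Λ hC⟩]
  exact integral_congr_ae (ae_of_all _ fun A =>
    (sumOver_configProb_of_subset hp0 hp1 hq hΛB F A).symm)

end DLR

/-! ### Finite and infinite clusters on the rooted tree -/

namespace RootedTree

section Extinct

variable {V E : Type*} (T : RootedTree V E)

/-- The number of vertices `k` generations below `v` that are joined to `v` by open edges. -/
def openDesc (A : E → Bool) : ℕ → V → ℕ
  | 0, _ => 1
  | k + 1, v => ∑ e ∈ T.ch v, if A e = true then openDesc A k (T.hd e) else 0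

/-- The indicator of the event that the open cluster below `v` is finite. -/
def extinct (A : E → Bool) (v : V) : ℝ := if ∃ k, T.openDesc A k v = 0 then 1 else 0

variable {T}

theorem openDesc_congr {A B : E → Bool} {n : ℕ} (h : ∀ e, n ≤ T.depth (T.tl e) → A e = B e)
    (k : ℕ) {v : V} (hv : n ≤ T.depth v) : T.openDesc A k v = T.openDesc B k v := by
  induction k generalizing v with
  | zero => rfl
  | succ k ih =>
    refine Finset.sum_congr rfl fun e he => ?_
    rw [T.mem_ch] at he
    rw [h e (he ▸ hv), ih (by rw [T.depth_hd, he]; omega)]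

theorem extinct_congr {A B : E → Bool} {n : ℕ} (h : ∀ e, n ≤ T.depth (T.tl e) → A e = B e)
    {v : V} (hv : n ≤ T.depth v) : T.extinct A v = T.extinct B v := by
  simp only [extinct, openDesc_congr h _ hv]

theorem extinct_nonneg (A : E → Bool) (v : V) : 0 ≤ T.extinct A v := by
  rw [extinct]; split_ifs <;> simp

theorem extinct_le_one (A : E → Bool) (v : V) : T.extinct A v ≤ 1 := by
  rw [extinct]; split_ifs <;> simp

theorem openDesc_succ_eq_zero {A : E → Bool} {k : ℕ} {v : V} :
    T.openDesc A (k + 1) v = 0 ↔ ∀ e ∈ T.ch v, A e = true → T.openDesc A k (T.hd e) = 0 := by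
  simp [openDesc, Finset.sum_eq_zero_iff]

theorem openDesc_eq_zero_mono {A : E → Bool} {k l : ℕ} (hkl : k ≤ l) {v : V}
    (h : T.openDesc A k v = 0) : T.openDesc A l v = 0 := by
  induction k generalizing l v with
  | zero => simp [openDesc] at h
  | succ k ih =>
    obtain ⟨l, rfl⟩ : ∃ m, l = m + 1 := ⟨l - 1, by omega⟩
    rw [openDesc_succ_eq_zero] at *
    exact fun e he hA => ih (by omega) (h e he hA)

/-- The cluster below `v` is finite exactly when it is finite below each child joined to `v`. This
invariance allows the recursive weight to be unrolled by `wt_eq_prod`. -/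
theorem pull_extinct (A : E → Bool) : T.pull A (T.extinct A) = T.extinct A := by
  ext v
  by_cases hv : ∃ k, T.openDesc A k v = 0
  · rw [extinct, if_pos hv]
    obtain ⟨k, hk⟩ := hv
    refine Finset.prod_eq_one fun e he => ?_
    split_ifs with hA
    · rw [extinct, if_pos]
      refine ⟨k, ?_⟩
      exact openDesc_succ_eq_zero.1 (openDesc_eq_zero_mono k.le_succ hk) e he hA
    · rfl
  · have hex : ∃ e ∈ T.ch v, A e = true ∧ ∀ k, T.openDesc A k (T.hd e) ≠ 0 := by
      by_contra hcon
      push Not at hcon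
      -- Finite branching: the largest extinction time among the open children bounds that of `v`.
      choose! f hf using hcon
      refine hv ⟨(T.ch v).sup f + 1, openDesc_succ_eq_zero.2 fun e he hA => ?_⟩
      exact openDesc_eq_zero_mono (Finset.le_sup he) (hf e he hA)
    obtain ⟨e, he, hA, hk⟩ := hex
    rw [extinct, if_neg hv]
    refine Finset.prod_eq_zero he ?_
    rw [if_pos hA, extinct, if_neg]
    exact fun ⟨k, h⟩ => hk k h

/-- There is an open edge from `a` to `b`, directed away from the root. -/
def OpenStep (T : RootedTree V E) (A : E → Bool) (a b : V) : Prop :=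
  ∃ e, A e = true ∧ T.tl e = a ∧ T.hd e = b

theorem openDesc_ne_zero_of_chain {A : E → Bool} {v w : V}
    (h : Relation.ReflTransGen (T.OpenStep A) v w) (k : ℕ) (hk : T.depth v + k ≤ T.depth w) :
    T.openDesc A k v ≠ 0 := by
  induction h using Relation.ReflTransGen.head_induction_on generalizing k with
  | refl =>
    obtain rfl : k = 0 := by omega
    simp [openDesc]
  | head hab _ ih =>
    obtain ⟨e, hA, rfl, rfl⟩ := hab
    cases k with
    | zero => simp [openDesc]
    | succ k =>
      rw [Ne, openDesc_succ_eq_zero]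
      intro h
      exact ih k (by rw [T.depth_hd]; omega) (h e ((T.mem_ch _ _).2 rfl) hA)

theorem exists_chain_of_openDesc_ne_zero {A : E → Bool} {k : ℕ} {v : V}
    (h : T.openDesc A k v ≠ 0) :
    ∃ w, T.depth w = T.depth v + k ∧ Relation.ReflTransGen (T.OpenStep A) v w := by
  induction k generalizing v with
  | zero => exact ⟨v, rfl, .refl⟩
  | succ k ih =>
    rw [Ne, openDesc_succ_eq_zero] at h
    push Not at h
    obtain ⟨e, he, hA, hk⟩ := h
    obtain ⟨w, hw, hc⟩ := ih hk
    rw [T.mem_ch] at he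
    exact ⟨w, by rw [hw, T.depth_hd, he]; omega, .head ⟨e, hA, he, rfl⟩ hc⟩

theorem finite_depth_le (T : RootedTree V E) (n : ℕ) : {v | T.depth v ≤ n}.Finite := by
  refine ((T.ball n).finite_toSet.image T.hd |>.insert T.root).subset fun v hv => ?_
  by_cases h : v = T.root
  · exact Or.inl h
  · obtain ⟨e, rfl⟩ := T.exists_hd v h
    refine Or.inr ⟨e, ?_, rfl⟩
    have : T.depth (T.hd e) ≤ n := hv
    rw [T.depth_hd] at this
    exact Finset.mem_coe.2 (T.mem_ball.2 (by omega))

theorem infinite_chain_iff {A : E → Bool} {v : V} :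
    {w | Relation.ReflTransGen (T.OpenStep A) v w}.Infinite ↔ T.extinct A v = 0 := by
  have h0 : T.extinct A v = 0 ↔ ∀ k, T.openDesc A k v ≠ 0 := by
    rw [extinct]
    split_ifs with h
    · obtain ⟨k, hk⟩ := h
      simp only [one_ne_zero, false_iff]
      exact fun h => h k hk
    · simpa using h
  rw [h0]
  constructor
  · intro h k hk
    refine h ((T.finite_depth_le (T.depth v + k)).subset fun w hw => ?_)
    by_contra hcon
    exact openDesc_ne_zero_of_chain hw k (le_of_lt (not_le.1 hcon)) hk
  · intro h hfin
    obtain ⟨N, hN⟩ := (hfin.image T.depth).bddAbove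
    obtain ⟨w, hw, hc⟩ := exists_chain_of_openDesc_ne_zero (h (N + 1))
    have := hN ⟨w, hc, rfl⟩
    omega

/-- `t` is the vertex closest to the root of its open cluster. -/
def IsTop (T : RootedTree V E) (A : E → Bool) (t : V) : Prop :=
  ∀ e, T.hd e = t → A e = false

theorem exists_isTop (A : E → Bool) (v : V) :
    ∃ t, T.IsTop A t ∧ T.depth t ≤ T.depth v ∧ Relation.ReflTransGen (T.OpenStep A) t v := by
  induction hn : T.depth v generalizing v with
  | zero =>
    refine ⟨v, fun e he => ?_, by omega, .refl⟩
    have := T.depth_hd e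
    rw [he] at this
    omega
  | succ n ih =>
    obtain ⟨e, rfl⟩ := T.exists_hd v (T.ne_root_of_depth (by omega))
    have hd := T.depth_hd e
    cases hA : A e with
    | false =>
      exact ⟨T.hd e, fun e' he' => T.hd_injective he' ▸ hA, by omega, .refl⟩
    | true =>
      obtain ⟨t, ht, htd, hc⟩ := ih (T.tl e) (by omega)
      exact ⟨t, ht, by omega, hc.tail ⟨e, hA, rfl, rfl⟩⟩

theorem IsTop.eq_of_chain {A : E → Bool} {s t : V} (ht : T.IsTop A t)
    (h : Relation.ReflTransGen (T.OpenStep A) s t) : s = t := by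
  cases h with
  | refl => rfl
  | tail _ hab =>
    obtain ⟨e, hA, -, he⟩ := hab
    rw [ht e he] at hA
    exact absurd hA (by simp)

end Extinct

/-! ### The random-cluster weight on a ball -/

section Graph

variable {V : Type*} {G : SimpleGraph V} {T : RootedTree V G.edgeSet}
  (hT : ∀ e : G.edgeSet, (e : Sym2 V) = s(T.tl e, T.hd e))

include hT

theorem openGraph_adj {A : G.edgeSet → Bool} {a b : V} :
    (exteriorGraph ∅ A).Adj a b ↔ T.OpenStep A a b ∨ T.OpenStep A b a := by
  rw [exteriorGraph_adj]
  constructor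
  · rintro ⟨e, he, -, hA⟩
    rw [hT, Sym2.eq_iff] at he
    rcases he with ⟨h1, h2⟩ | ⟨h1, h2⟩
    · exact Or.inl ⟨e, hA, h1, h2⟩
    · exact Or.inr ⟨e, hA, h1, h2⟩
  · rintro (⟨e, hA, h1, h2⟩ | ⟨e, hA, h1, h2⟩)
    · exact ⟨e, by rw [hT, h1, h2], by simp, hA⟩
    · exact ⟨e, by rw [hT, h1, h2, Sym2.eq_swap], by simp, hA⟩

theorem reachable_of_chain {A : G.edgeSet → Bool} {a b : V}
    (h : Relation.ReflTransGen (T.OpenStep A) a b) : (exteriorGraph ∅ A).Reachable a b := by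
  rw [SimpleGraph.reachable_iff_reflTransGen]
  exact h.lift id fun a b h => (openGraph_adj hT).2 (Or.inl h)

/-- An upward step can only retrace the edge by which the path came down, since `hd` is injective,
and no upward step leaves the top. So connections from a top can be taken downward. -/
theorem IsTop.reachable_iff {A : G.edgeSet → Bool} {t w : V} (ht : T.IsTop A t) :
    (exteriorGraph ∅ A).Reachable t w ↔ Relation.ReflTransGen (T.OpenStep A) t w := by
  refine ⟨fun h => ?_, reachable_of_chain hT⟩
  rw [SimpleGraph.reachable_iff_reflTransGen] at h
  induction h with
  | refl => exact .refl
  | @tail w w' _ hadj ih =>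
    rcases (openGraph_adj hT).1 hadj with h | ⟨e, hA, h1, h2⟩
    · exact ih.tail h
    · cases ih with
      | refl => rw [ht e h2] at hA; exact absurd hA (by simp)
      | tail hc hab =>
        obtain ⟨e', -, h1', h2'⟩ := hab
        obtain rfl := T.hd_injective (h2.trans h2'.symm)
        rw [← h1, h1']
        exact hc

theorem IsTop.inInfiniteCluster_iff {A : G.edgeSet → Bool} {t : V} (ht : T.IsTop A t) :
    InInfiniteCluster (exteriorGraph ∅ A) t ↔ T.extinct A t = 0 := by
  rw [← infinite_chain_iff, InInfiniteCluster]
  simp only [ht.reachable_iff hT]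

theorem mem_verts_ball {n : ℕ} (hn : 1 ≤ n) (hroot : (T.ch T.root).Nonempty) {v : V} :
    v ∈ verts (T.ball n) ↔ T.depth v ≤ n := by
  constructor
  · rintro ⟨e, he, hv⟩
    rw [hT, Sym2.mem_iff] at hv
    rw [T.mem_ball] at he
    rcases hv with rfl | rfl
    · omega
    · rw [T.depth_hd]; omega
  · intro hv
    by_cases h : v = T.root
    · obtain ⟨e, he⟩ := hroot
      rw [T.mem_ch] at he
      exact ⟨e, T.mem_ball.2 (by rw [he, T.depth_root]; omega), by rw [hT, he, h]; simp⟩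
    · obtain ⟨e, rfl⟩ := T.exists_hd v h
      rw [T.depth_hd] at hv
      exact ⟨e, T.mem_ball.2 (by omega), by rw [hT]; simp⟩

/-- Clusters meeting the ball are indexed by their tops: the root and the lower ends of closed
edges. Finite ones are counted separately by the product; the infinite ones form one class, counted
by the first factor. -/
theorem pow_clusterCount_ball {n : ℕ} (hn : 1 ≤ n) (hroot : (T.ch T.root).Nonempty) (q : ℝ)
    (A : G.edgeSet → Bool) :
    q ^ clusterCount (T.ball n) A =
      (if ∃ u ∈ verts (T.ball n), InInfiniteCluster (exteriorGraph (T.ball n) A) u then q else 1) *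
      ((1 + (q - 1) * T.extinct A T.root) *
        ∏ e ∈ T.ball n, if A e = true then 1 else (1 + (q - 1) * T.extinct A (T.hd e))) := by
  set H := exteriorGraph ∅ A with hH
  let S : Finset V := insert T.root (((T.ball n).filter fun e => ¬ A e = true).image T.hd)
  have hS : ∀ t, t ∈ S ↔ T.IsTop A t ∧ T.depth t ≤ n := by
    intro t
    simp only [S, Finset.mem_insert, Finset.mem_image, Finset.mem_filter, T.mem_ball]
    constructor
    · rintro (rfl | ⟨e, ⟨he, hA⟩, rfl⟩)
      · exact ⟨fun e he => absurd he (T.hd_ne_root e), by rw [T.depth_root]; omega⟩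
      · refine ⟨fun e' he' => ?_, by rw [T.depth_hd]; omega⟩
        rw [T.hd_injective he']
        simpa using hA
    · rintro ⟨ht, hd⟩
      by_cases h : t = T.root
      · exact Or.inl h
      · obtain ⟨e, rfl⟩ := T.exists_hd t h
        rw [T.depth_hd] at hd
        exact Or.inr ⟨e, ⟨by omega, by simp [ht e rfl]⟩, rfl⟩
  have hprod : ((1 + (q - 1) * T.extinct A T.root) *
        ∏ e ∈ T.ball n, if A e = true then 1 else (1 + (q - 1) * T.extinct A (T.hd e))) =
      q ^ (S.filter fun t => T.extinct A t = 1).card := by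
    have h1 : q ^ (S.filter fun t => T.extinct A t = 1).card =
        ∏ t ∈ S, (1 + (q - 1) * T.extinct A t) := by
      rw [← Finset.prod_const, Finset.prod_filter]
      refine Finset.prod_congr rfl fun t _ => ?_
      rw [extinct]
      split_ifs <;> simp_all
    rw [h1, Finset.prod_insert, Finset.prod_image fun e _ e' _ h => T.hd_injective h,
      Finset.prod_filter]
    · congr 1
      refine Finset.prod_congr rfl fun e _ => ?_
      by_cases h : A e = true <;> simp [h]
    · simp only [Finset.mem_image, not_exists, not_and]
      exact fun e _ => T.hd_ne_root e
  -- The presence of an infinite cluster is decided by the exterior alone, so its factor is constant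
  -- under resampling of the ball.
  have hex : (∃ u ∈ verts (T.ball n), InInfiniteCluster (exteriorGraph (T.ball n) A) u) ↔
      ∃ u ∈ verts (T.ball n), InInfiniteCluster H u := by
    constructor
    · rintro ⟨u, hu, hi⟩
      exact ⟨u, hu, hi.mono (exteriorGraph_le _ _)⟩
    · rintro ⟨u, hu, hi⟩
      obtain ⟨u', -, hi'⟩ := exists_eqvGen_infinite (T.ball n) A ⟨u, hu⟩ hi
      exact ⟨u', u'.2, hi'⟩
  have hfinite : ∀ t, T.IsTop A t → (¬ InInfiniteCluster H t ↔ T.extinct A t = 1) := by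
    intro t ht
    rw [ht.inInfiniteCluster_iff hT, extinct]
    split_ifs <;> simp
  have hinj : Set.InjOn (wiredClass H) (S.filter fun t => T.extinct A t = 1 : Finset V) := by
    intro t ht t' ht' h
    simp only [Finset.coe_filter, hS, Set.mem_ofPred_eq] at ht ht'
    rcases wiredClass_eq_iff.1 h with h | ⟨h, -⟩
    · exact ht'.1.1.eq_of_chain ((ht.1.1.reachable_iff hT).1 h)
    · exact absurd h ((hfinite t ht.1.1).2 ht.2)
  have htop : ∀ u, T.depth u ≤ n → ∃ t ∈ S, H.Reachable t u := by
    intro u hu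
    obtain ⟨t, ht, htd, hc⟩ := exists_isTop A u
    exact ⟨t, (hS t).2 ⟨ht, htd.trans hu⟩, reachable_of_chain hT hc⟩
  have hsub : wiredClass H '' (S.filter fun t => T.extinct A t = 1 : Finset V) ⊆
      wiredClass H '' verts (T.ball n) := by
    rintro _ ⟨t, ht, rfl⟩
    simp only [Finset.coe_filter, hS, Set.mem_ofPred_eq] at ht
    exact ⟨t, (mem_verts_ball hT hn hroot).2 ht.1.2, rfl⟩
  rw [hprod, clusterCount, ← hH]
  simp only [hex]
  split_ifs with hI
  · obtain ⟨u₀, hu₀, hi₀⟩ := hI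
    have : wiredClass H '' verts (T.ball n) = insert (wiredClass H u₀)
        (wiredClass H '' (S.filter fun t => T.extinct A t = 1 : Finset V)) := by
      refine Set.Subset.antisymm ?_ (Set.insert_subset ⟨u₀, hu₀, rfl⟩ hsub)
      rintro _ ⟨u, hu, rfl⟩
      obtain ⟨t, ht, htu⟩ := htop u ((mem_verts_ball hT hn hroot).1 hu)
      by_cases hi : InInfiniteCluster H t
      · exact Or.inl (wiredClass_eq_iff.2 (Or.inr ⟨hi.of_reachable htu, hi₀⟩))
      · refine Or.inr ⟨t, ?_, wiredClass_eq_iff.2 (Or.inl htu)⟩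
        rw [Finset.mem_coe, Finset.mem_filter]
        exact ⟨ht, (hfinite t ((hS t).1 ht).1).1 hi⟩
    rw [this, Set.ncard_insert_of_notMem, hinj.ncard_image, Set.ncard_coe_finset,
      pow_succ']
    · rintro ⟨t, ht, h⟩
      simp only [Finset.coe_filter, hS, Set.mem_ofPred_eq] at ht
      rcases wiredClass_eq_iff.1 h with h | ⟨h, -⟩
      · exact (hfinite t ht.1.1).2 ht.2 (hi₀.of_reachable h.symm)
      · exact (hfinite t ht.1.1).2 ht.2 h
  · have : wiredClass H '' verts (T.ball n) =
        wiredClass H '' (S.filter fun t => T.extinct A t = 1 : Finset V) := by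
      refine Set.Subset.antisymm ?_ hsub
      rintro _ ⟨u, hu, rfl⟩
      obtain ⟨t, ht, htu⟩ := htop u ((mem_verts_ball hT hn hroot).1 hu)
      refine ⟨t, ?_, wiredClass_eq_iff.2 (Or.inl htu)⟩
      rw [Finset.mem_coe, Finset.mem_filter]
      exact ⟨ht, (hfinite t ((hS t).1 ht).1).1 fun hi => hI ⟨u, hu, hi.of_reachable htu⟩⟩
    rw [this, hinj.ncard_image, Set.ncard_coe_finset, one_mul]

end Graph

/-! ### Resampled means on balls -/

section Ratio

variable {V E : Type*} (T : RootedTree V E)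

/-- The expectation of `F` when the edges of the ball of radius `n` are resampled according to the
random-cluster weight with boundary field `x`. -/
def ballMean (p q : ℝ) (n : ℕ) (F : (E → Bool) → ℝ) (x : V → ℝ) (A : E → Bool) : ℝ :=
  sumOver (T.ball n) (fun B => F B * T.wt p q n B x) A /
    sumOver (T.ball n) (fun B => T.wt p q n B x) A

end Ratio

section Graph

variable {V : Type*} {G : SimpleGraph V} {T : RootedTree V G.edgeSet}

theorem configWeight_ball (hT : ∀ e : G.edgeSet, (e : Sym2 V) = s(T.tl e, T.hd e)) {n : ℕ}
    (hn : 1 ≤ n) (hroot : (T.ch T.root).Nonempty) (p q : ℝ) (A : G.edgeSet → Bool) :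
    configWeight p q (T.ball n) A =
      (if ∃ u ∈ verts (T.ball n), InInfiniteCluster (exteriorGraph (T.ball n) A) u then q else 1) *
        T.wt p q n A (T.extinct A) := by
  rw [configWeight, pow_clusterCount_ball hT hn hroot, wt_eq_prod (pull_extinct A)]
  ring

/-- The factor of the infinite class is the same for all configurations with the given exterior and
cancels in the ratio; so does the dependence of the depth-`n` field on the ball. -/
theorem sumOver_ball_configProb (hT : ∀ e : G.edgeSet, (e : Sym2 V) = s(T.tl e, T.hd e)) {n : ℕ}
    (hn : 1 ≤ n) (hroot : (T.ch T.root).Nonempty) {p q : ℝ} (hq : 1 < q)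
    (F : (G.edgeSet → Bool) → ℝ) (A : G.edgeSet → Bool) :
    sumOver (T.ball n) (fun B => F B * configProb p q (T.ball n) B) A =
      T.ballMean p q n F (T.extinct A) A := by
  set κ : ℝ := if ∃ u ∈ verts (T.ball n), InInfiniteCluster (exteriorGraph (T.ball n) A) u
    then q else 1 with hκ
  have hκ0 : κ ≠ 0 := by rw [hκ]; split_ifs <;> linarith
  have key : ∀ B, (∀ e ∉ T.ball n, B e = A e) →
      configWeight p q (T.ball n) B = κ * T.wt p q n B (T.extinct A) := by
    intro B hB
    rw [configWeight_ball hT hn hroot, exteriorGraph_congr hB]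
    congr 1
    refine wt_congr (fun _ _ => rfl) fun v hv => extinct_congr (n := n) (fun e he => hB e ?_) hv.ge
    rw [T.mem_ball]; omega
  rw [sumOver_mul_configProb, ballMean]
  have h1 : sumOver (T.ball n) (fun B => F B * configWeight p q (T.ball n) B) A =
      κ * sumOver (T.ball n) (fun B => F B * T.wt p q n B (T.extinct A)) A := by
    rw [← sumOver_mul_left]
    exact sumOver_congr (fun _ _ => rfl) fun B hB => by rw [key B hB]; ring
  have h2 : sumOver (T.ball n) (configWeight p q (T.ball n)) A =
      κ * sumOver (T.ball n) (fun B => T.wt p q n B (T.extinct A)) A := by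
    rw [← sumOver_mul_left]
    exact sumOver_congr (fun _ _ => rfl) fun B hB => key B hB
  rw [h1, h2, mul_div_mul_left _ _ hκ0]

end Graph

end RootedTree

/-! ### Rooting a locally finite tree -/

section Construction

variable {V : Type*} {G : SimpleGraph V}

/-- Geodesics from `o` to `a` and to `b`, extended to `v`, are both paths; in a tree they coincide,
and so do their penultimate vertices. -/
theorem parent_unique (hG : G.IsTree) (o : V) {a b v : V} (ha : G.Adj a v) (hb : G.Adj b v)
    (hda : G.dist o v = G.dist o a + 1) (hdb : G.dist o v = G.dist o b + 1) : a = b := by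
  obtain ⟨P, hP⟩ := hG.connected.exists_walk_length_eq_dist o a
  obtain ⟨Q, hQ⟩ := hG.connected.exists_walk_length_eq_dist o b
  have h1 : (P.concat ha).IsPath :=
    SimpleGraph.Walk.isPath_of_length_eq_dist _ (by rw [SimpleGraph.Walk.length_concat]; omega)
  have h2 : (Q.concat hb).IsPath :=
    SimpleGraph.Walk.isPath_of_length_eq_dist _ (by rw [SimpleGraph.Walk.length_concat]; omega)
  have h3 : P.concat ha = Q.concat hb := (hG.existsUnique_path o v).unique h1 h2
  have h4 := congrArg SimpleGraph.Walk.penultimate h3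
  simpa using h4

/-- A locally finite tree, rooted at a vertex. -/
theorem exists_rootedTree [G.LocallyFinite] (hG : G.IsTree) :
    ∃ T : RootedTree V G.edgeSet, (∀ e : G.edgeSet, (e : Sym2 V) = s(T.tl e, T.hd e)) ∧
      (T.ch T.root).card = G.degree T.root ∧
      ∀ v, v ≠ T.root → (T.ch v).card + 1 = G.degree v := by
  obtain ⟨o⟩ := hG.connected.nonempty
  have hor : ∀ e : G.edgeSet, ∃ ab : V × V, (e : Sym2 V) = s(ab.1, ab.2) ∧
      G.dist o ab.2 = G.dist o ab.1 + 1 := by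
    rintro ⟨e, he⟩
    induction e with
    | _ a b =>
      rcases hG.dist_eq_dist_add_one_of_adj o (G.mem_edgeSet.1 he) with h | h
      · exact ⟨(b, a), Sym2.eq_swap, h⟩
      · exact ⟨(a, b), rfl, h⟩
  choose f hf hfd using hor
  have hadj : ∀ e : G.edgeSet, G.Adj (f e).1 (f e).2 := fun e => by
    have := e.2
    rwa [hf e, SimpleGraph.mem_edgeSet] at this
  have hinj : Function.Injective fun e => (f e).2 := by
    intro e e' h
    have h : (f e).2 = (f e').2 := h
    have h1 : (f e).1 = (f e').1 := by
      refine parent_unique hG o (hadj e) (h ▸ hadj e') (hfd e) ?_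
      rw [h]; exact hfd e'
    exact Subtype.ext (by rw [hf e, hf e', h, h1])
  have hfin : ∀ v, {e | (f e).1 = v}.Finite := by
    intro v
    refine Set.Finite.of_finite_image (f := fun e => (f e).2) ?_ hinj.injOn
    refine (G.neighborFinset v).finite_toSet.subset ?_
    rintro _ ⟨e, rfl, rfl⟩
    rw [Finset.mem_coe, SimpleGraph.mem_neighborFinset]
    exact hadj e
  have hedge : ∀ v w, G.Adj v w → G.dist o w = G.dist o v + 1 →
      ∃ e, (f e).1 = v ∧ (f e).2 = w := by
    intro v w h hd
    refine ⟨⟨s(v, w), h⟩, ?_⟩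
    have h1 := hf ⟨s(v, w), h⟩
    have h2 := hfd ⟨s(v, w), h⟩
    rcases Sym2.eq_iff.1 h1 with ⟨h3, h4⟩ | ⟨h3, h4⟩
    · exact ⟨h3.symm, h4.symm⟩
    · rw [← h3, ← h4] at h2; omega
  have hpar : ∀ v, v ≠ o → ∃ e, (f e).2 = v := by
    intro v hv
    obtain ⟨P, hP⟩ := hG.connected.exists_walk_length_eq_dist v o
    cases P with
    | nil => exact absurd rfl hv
    | @cons _ w _ h P =>
      have h1 : G.dist w o ≤ P.length := SimpleGraph.dist_le P
      rw [SimpleGraph.Walk.length_cons] at hP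
      rw [SimpleGraph.dist_comm] at h1 hP
      rcases hG.dist_eq_dist_add_one_of_adj o h with h2 | h2
      · obtain ⟨e, -, he⟩ := hedge w v h.symm h2
        exact ⟨e, he⟩
      · omega
  let T : RootedTree V G.edgeSet :=
    { root := o
      tl := fun e => (f e).1
      hd := fun e => (f e).2
      ch := fun v => (hfin v).toFinset
      depth := G.dist o
      mem_ch := fun v e => by simp
      hd_injective := hinj
      depth_root := SimpleGraph.dist_self
      depth_hd := hfd
      exists_hd := hpar }
  have hch : ∀ v e, e ∈ T.ch v ↔ (f e).1 = v := T.mem_ch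
  have hcard : ∀ v, ((T.ch v).image T.hd).card = (T.ch v).card := fun v =>
    Finset.card_image_of_injective _ hinj
  refine ⟨T, hf, ?_, fun v hv => ?_⟩
  · rw [← hcard, ← SimpleGraph.card_neighborFinset_eq_degree]
    congr 1
    ext w
    rw [Finset.mem_image, SimpleGraph.mem_neighborFinset]
    constructor
    · rintro ⟨e, he, rfl⟩
      rw [← (hch _ _).1 he]
      exact hadj e
    · intro h
      have h' : G.Adj o w := h
      rcases hG.dist_eq_dist_add_one_of_adj o h' with h2 | h2
      · rw [SimpleGraph.dist_self] at h2; omega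
      · obtain ⟨e, he1, he2⟩ := hedge o w h' h2
        exact ⟨e, (hch _ _).2 he1, he2⟩
  · obtain ⟨e₀, he₀⟩ := hpar v hv
    have hnot : (f e₀).1 ∉ (T.ch v).image T.hd := by
      rw [Finset.mem_image]
      rintro ⟨e, he, h⟩
      have h1 := hfd e
      have h2 := hfd e₀
      have h3 : (f e).2 = (f e₀).1 := h
      rw [(hch _ _).1 he, h3] at h1
      rw [he₀] at h2
      omega
    rw [← hcard, ← Finset.card_insert_of_notMem hnot, ← SimpleGraph.card_neighborFinset_eq_degree]
    congr 1
    ext w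
    rw [Finset.mem_insert, Finset.mem_image, SimpleGraph.mem_neighborFinset]
    constructor
    · rintro (rfl | ⟨e, he, rfl⟩)
      · have := (hadj e₀).symm
        rwa [he₀] at this
      · rw [← (hch _ _).1 he]
        exact hadj e
    · intro h
      rcases hG.dist_eq_dist_add_one_of_adj o h with h2 | h2
      · left
        refine parent_unique hG o h.symm ?_ h2 ?_
        · have := hadj e₀
          rwa [he₀] at this
        · have := hfd e₀
          rwa [he₀] at this
      · obtain ⟨e, he1, he2⟩ := hedge v w h h2
        exact Or.inr ⟨e, (hch _ _).2 he1, he2⟩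

end Construction

/-- Convergence in mean implies convergence in measure. A subsequence suffices for the applications,
where the integrals to be identified are constant along the sequence. -/
theorem exists_subseq_ae_tendsto_zero {Ω : Type*} [MeasurableSpace Ω] {ν : Measure Ω}
    [IsFiniteMeasure ν] {f : ℕ → Ω → ℝ} (hm : ∀ k, Measurable (f k)) (h0 : ∀ k A, 0 ≤ f k A)
    (hint : ∀ k, Integrable (f k) ν) (h : Tendsto (fun k => ∫ A, f k A ∂ν) atTop (𝓝 0)) :
    ∃ ns : ℕ → ℕ, StrictMono ns ∧ ∀ᵐ A ∂ν, Tendsto (fun j => f (ns j) A) atTop (𝓝 0) := by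
  have hL : Tendsto (fun k => eLpNorm (f k - 0) 1 ν) atTop (𝓝 0) := by
    have h1 : ∀ k, eLpNorm (f k - 0) 1 ν = ENNReal.ofReal (∫ A, f k A ∂ν) := by
      intro k
      rw [sub_zero, eLpNorm_one_eq_lintegral_enorm,
        ofReal_integral_eq_lintegral_ofReal (hint k) (ae_of_all _ (h0 k))]
      exact lintegral_congr fun A => by rw [Real.enorm_eq_ofReal (h0 k A)]
    simp only [h1]
    simpa [Function.comp_def] using (ENNReal.continuous_ofReal.tendsto 0).comp h
  have hM : TendstoInMeasure ν f atTop (0 : Ω → ℝ) :=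
    tendstoInMeasure_of_tendsto_eLpNorm one_ne_zero (fun k => (hm k).aestronglyMeasurable)
      aestronglyMeasurable_zero hL
  obtain ⟨ns, hns, hae⟩ := hM.exists_seq_tendsto_ae
  exact ⟨ns, hns, hae⟩

/-- `F` depends only on the edges of `L`. -/
def DependsOnEdges {E : Type*} (L : Finset E) (F : (E → Bool) → ℝ) : Prop :=
  ∀ A B, (∀ e ∈ L, A e = B e) → F A = F B

namespace RootedTree

variable {V E : Type*} {T : RootedTree V E} {p q : ℝ}

/-! ### Propagation of boundary fields through balls -/

section BallMean

variable (hp0 : 0 < p) (hp1 : p < 1) (hq : 1 < q)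

include hp0 hp1 hq

theorem sumOver_wt_pos (n : ℕ) {x : V → ℝ} (hx : ∀ v, 0 ≤ x v) (L : Finset E) (A : E → Bool) :
    0 < sumOver L (fun B => T.wt p q n B x) A :=
  sumOver_pos fun B _ => wt_pos hp0 hp1 hq n B hx

/-- Summing out the last level produces the constant `K`, which depends neither on `F` nor on the
configuration and cancels in the ratio. -/
theorem ballMean_push {n : ℕ} {F : (E → Bool) → ℝ} (hF : DependsOnEdges (T.ball n) F)
    {x : V → ℝ} (hx : ∀ v, 0 ≤ x v) (A : E → Bool) :
    T.ballMean p q (n + 1) F x A = T.ballMean p q n F (T.push p q x) A := by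
  set K := ∏ e ∈ T.lev n, (p + (1 - p) * (1 + (q - 1) * x (T.hd e))) with hK
  have hK0 : K ≠ 0 :=
    (Finset.prod_pos fun e _ => msg_denom_pos hp0 hp1 hq (hx (T.hd e))).ne'
  have key : ∀ F' : (E → Bool) → ℝ, DependsOnEdges (T.ball n) F' →
      sumOver (T.ball (n + 1)) (fun B => F' B * T.wt p q (n + 1) B x) A =
        K * sumOver (T.ball n) (fun B => F' B * T.wt p q n B (T.push p q x)) A := by
    intro F' hF'
    rw [ball_succ, sumOver_union (T.disjoint_ball_lev n), ← sumOver_mul_left]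
    refine sumOver_congr (fun _ _ => rfl) fun B _ => ?_
    calc _ = sumOver (T.lev n) (fun C => F' B * T.wt p q (n + 1) C x) B := by
          refine sumOver_congr (fun _ _ => rfl) fun C hC => ?_
          rw [hF' C B fun e he => hC e (Finset.disjoint_left.1 (T.disjoint_ball_lev n) he)]
      _ = _ := by
          rw [sumOver_mul_left, sumOver_lev_wt hp0 hp1 hq n hx]
          ring
  have h1 := key (fun _ => 1) fun _ _ _ => rfl
  simp only [one_mul] at h1
  rw [ballMean, ballMean, key F hF, h1, mul_div_mul_left _ _ hK0]

theorem iterate_push_nonneg {x : V → ℝ} (hx : ∀ v, 0 ≤ x v) (k : ℕ) (v : V) :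
    0 ≤ (T.push p q)^[k] x v := by
  induction k generalizing v with
  | zero => exact hx v
  | succ k ih => rw [Function.iterate_succ_apply']; exact push_nonneg hp0 hp1 hq ih v

theorem iterate_push_le_one {x : V → ℝ} (hx : ∀ v, 0 ≤ x v) (hx1 : ∀ v, x v ≤ 1) (k : ℕ) (v : V) :
    (T.push p q)^[k] x v ≤ 1 := by
  induction k generalizing v with
  | zero => exact hx1 v
  | succ k ih =>
    rw [Function.iterate_succ_apply']
    exact push_le_one hp0 hp1 hq (iterate_push_nonneg hp0 hp1 hq hx k) ih v

theorem ballMean_iterate_push {n : ℕ} {F : (E → Bool) → ℝ} (hF : DependsOnEdges (T.ball n) F)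
    {x : V → ℝ} (hx : ∀ v, 0 ≤ x v) (A : E → Bool) (k : ℕ) :
    T.ballMean p q (n + k) F x A = T.ballMean p q n F ((T.push p q)^[k] x) A := by
  induction k generalizing x with
  | zero => rfl
  | succ k ih =>
    have : DependsOnEdges (T.ball (n + k)) F := fun A B h =>
      hF A B fun e he => h e (T.ball_mono (Nat.le_add_right n k) he)
    rw [Function.iterate_succ_apply, ← ih (push_nonneg hp0 hp1 hq hx), ← add_assoc,
      ballMean_push hp0 hp1 hq this hx]

theorem abs_ballMean_le {n : ℕ} {F : (E → Bool) → ℝ} {C : ℝ} (hC : ∀ A, |F A| ≤ C)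
    {x : V → ℝ} (hx : ∀ v, 0 ≤ x v) (A : E → Bool) : |T.ballMean p q n F x A| ≤ C := by
  have hpos := sumOver_wt_pos (T := T) hp0 hp1 hq n hx (T.ball n) A
  rw [ballMean, abs_div, abs_of_pos hpos, div_le_iff₀ hpos, ← sumOver_mul_left]
  refine (Finset.abs_sum_le_sum_abs _ _).trans (Finset.sum_le_sum fun O _ => ?_)
  have := wt_pos (T := T) hp0 hp1 hq n (glue (T.ball n) O A) hx
  beta_reduce
  rw [abs_mul, abs_of_pos this]
  exact mul_le_mul_of_nonneg_right (hC _) this.le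

theorem tendsto_ballMean {n : ℕ} (F : (E → Bool) → ℝ) {x : V → ℝ} (hx : ∀ v, 0 ≤ x v)
    {y : ℕ → V → ℝ} (hy : ∀ v, T.depth v = n → Tendsto (fun j => y j v) atTop (𝓝 (x v)))
    (A : E → Bool) :
    Tendsto (fun j => T.ballMean p q n F (y j) A) atTop (𝓝 (T.ballMean p q n F x A)) := by
  -- The weight sees the field only at depth `n`; freezing it elsewhere gives convergence at every
  -- vertex, as continuity in the product topology requires.
  let y' : ℕ → V → ℝ := fun j v => if T.depth v = n then y j v else x v
  have hyy' : ∀ j B, T.wt p q n B (y j) = T.wt p q n B (y' j) := fun j B =>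
    wt_congr (fun _ _ => rfl) fun v hv => by simp [y', hv]
  have hlim : Tendsto y' atTop (𝓝 x) := by
    rw [tendsto_pi_nhds]
    intro v
    by_cases hv : T.depth v = n
    · simpa [y', hv] using hy v hv
    · simp [y', hv]
  have hwt : ∀ B, Tendsto (fun j => T.wt p q n B (y j)) atTop (𝓝 (T.wt p q n B x)) := by
    intro B
    simp only [hyy']
    exact ((continuous_wt n B).tendsto x).comp hlim
  exact Tendsto.div (tendsto_finsetSum _ fun O _ => (hwt _).const_mul _)
    (tendsto_finsetSum _ fun O _ => hwt _) (sumOver_wt_pos hp0 hp1 hq n hx _ A).ne'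

omit hp0 hp1 hq

theorem ballMean_congr_field {n : ℕ} (F : (E → Bool) → ℝ) {x y : V → ℝ}
    (h : ∀ v, T.depth v = n → x v = y v) (A : E → Bool) :
    T.ballMean p q n F x A = T.ballMean p q n F y A := by
  have : ∀ B, T.wt p q n B x = T.wt p q n B y := fun B => wt_congr (fun _ _ => rfl) h
  simp only [ballMean, this]

theorem ballMean_congr_config {n : ℕ} {F : (E → Bool) → ℝ} (hF : DependsOnEdges (T.ball n) F)
    (x : V → ℝ) (A B : E → Bool) : T.ballMean p q n F x A = T.ballMean p q n F x B := by
  have h : ∀ F' : (E → Bool) → ℝ, DependsOnEdges (T.ball n) F' →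
      sumOver (T.ball n) F' A = sumOver (T.ball n) F' B := by
    intro F' hF'
    refine Finset.sum_congr rfl fun O _ => hF' _ _ fun e he => ?_
    rw [glue_of_mem he, glue_of_mem he]
  have hw : DependsOnEdges (T.ball n) fun B => T.wt p q n B x :=
    fun A B h => wt_congr h fun _ _ => rfl
  rw [ballMean, ballMean, h _ hw, h _ fun A B h => by rw [hF A B h]; exact congrArg _ (hw A B h)]

end BallMean

/-! ### The multi-affine comparison recursion -/

section Domination

/-- The probability that `v` is joined to a vertex `L` generations below it, when the edges are open
independently with probabilities `α`. -/
def surv (T : RootedTree V E) (α : E → ℝ) : ℕ → V → ℝ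
  | 0, _ => 1
  | L + 1, v => 1 - ∏ e ∈ T.ch v, (1 - α e * surv T α L (T.hd e))

/-- The iterates of a multi-affine lower bound for the truncated logarithmic message recursion. -/
def low (T : RootedTree V E) (a : ℝ) (d : ℕ) (s : V → ℝ) : ℕ → V → ℝ
  | 0, v => s v
  | k + 1, v => a * ∑ e ∈ T.ch v, low T a d s k (T.hd e) -
      (a * d - 1) * ∏ e ∈ T.ch v, low T a d s k (T.hd e)

theorem prod_sub_prod_le {ι : Type*} (s : Finset ι) {w w' : ι → ℝ} (h0 : ∀ i ∈ s, 0 ≤ w i)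
    (h : ∀ i ∈ s, w i ≤ w' i) (h1 : ∀ i ∈ s, w' i ≤ 1) :
    ∏ i ∈ s, w' i - ∏ i ∈ s, w i ≤ ∑ i ∈ s, (w' i - w i) := by
  induction s using Finset.induction_on with
  | empty => simp
  | insert i s hi ih =>
    rw [Finset.prod_insert hi, Finset.prod_insert hi, Finset.sum_insert hi]
    have ih := ih (fun j hj => h0 j (Finset.mem_insert_of_mem hj))
      (fun j hj => h j (Finset.mem_insert_of_mem hj))
      fun j hj => h1 j (Finset.mem_insert_of_mem hj)
    have hi0 := h0 i (Finset.mem_insert_self _ _)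
    have hi1 := h i (Finset.mem_insert_self _ _)
    have hi2 := h1 i (Finset.mem_insert_self _ _)
    have hP : ∏ j ∈ s, w' j ≤ 1 := Finset.prod_le_one
      (fun j hj => (h0 j (Finset.mem_insert_of_mem hj)).trans (h j (Finset.mem_insert_of_mem hj)))
      fun j hj => h1 j (Finset.mem_insert_of_mem hj)
    have hPP : ∏ j ∈ s, w j ≤ ∏ j ∈ s, w' j := Finset.prod_le_prod
      (fun j hj => h0 j (Finset.mem_insert_of_mem hj))
      fun j hj => h j (Finset.mem_insert_of_mem hj)
    nlinarith [mul_le_mul_of_nonneg_left hP (sub_nonneg.2 hi1),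
      mul_le_mul_of_nonneg_right (hi1.trans hi2) (sub_nonneg.2 hPP)]

/-- Inside the unit cube the product grows by at most as much as the sum, so the whole expression
grows by at least `(1 - a * (d - 1)) * ∑ (w' - w)`. -/
theorem low_step_mono {ι : Type*} {s : Finset ι} {a : ℝ} {d : ℕ}
    (had : 1 ≤ a * d) (had' : a * (d - 1) ≤ 1) {w w' : ι → ℝ} (h0 : ∀ i ∈ s, 0 ≤ w i)
    (h : ∀ i ∈ s, w i ≤ w' i) (h1 : ∀ i ∈ s, w' i ≤ 1) :
    a * ∑ i ∈ s, w i - (a * d - 1) * ∏ i ∈ s, w i ≤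
      a * ∑ i ∈ s, w' i - (a * d - 1) * ∏ i ∈ s, w' i := by
  have h2 := prod_sub_prod_le s h0 h h1
  rw [Finset.sum_sub_distrib] at h2
  have h3 : ∑ i ∈ s, w i ≤ ∑ i ∈ s, w' i := Finset.sum_le_sum h
  nlinarith [mul_le_mul_of_nonneg_left h2 (sub_nonneg.2 had)]

variable {a : ℝ} {d : ℕ}

/-- By monotonicity only the corners matter: the step fixes `0`, and the coefficient `a * d - 1` of
the product is chosen so that it also fixes `1`. -/
theorem low_step_mem {ι : Type*} {s : Finset ι} (hs : s.card = d) (hd : 2 ≤ d)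
    (had : 1 ≤ a * d) (had' : a * (d - 1) ≤ 1) {w : ι → ℝ} (h0 : ∀ i ∈ s, 0 ≤ w i)
    (h1 : ∀ i ∈ s, w i ≤ 1) :
    0 ≤ a * ∑ i ∈ s, w i - (a * d - 1) * ∏ i ∈ s, w i ∧
      a * ∑ i ∈ s, w i - (a * d - 1) * ∏ i ∈ s, w i ≤ 1 := by
  constructor
  · have := low_step_mono had had' (w := fun _ => 0) (w' := w) (fun _ _ => le_rfl) h0 h1
    refine le_trans (le_of_eq ?_) this
    simp [hs, show d ≠ 0 by omega]
  · have := low_step_mono had had' (w := w) (w' := fun _ => 1) h0 h1 fun _ _ => le_rfl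
    refine this.trans (le_of_eq ?_)
    simp [hs]

variable (hd : 2 ≤ d) (hreg : ∀ v, v ≠ T.root → (T.ch v).card = d) (had : 1 ≤ a * d)
  (had' : a * (d - 1) ≤ 1)

include hd hreg had had'

theorem low_mem {s : V → ℝ} (h0 : ∀ v, 0 ≤ s v) (h1 : ∀ v, s v ≤ 1) (k : ℕ) {v : V}
    (hv : v ≠ T.root) : 0 ≤ T.low a d s k v ∧ T.low a d s k v ≤ 1 := by
  induction k generalizing v with
  | zero => exact ⟨h0 v, h1 v⟩
  | succ k ih =>
    exact low_step_mem (hreg v hv) hd had had' (fun e _ => (ih (T.hd_ne_root e)).1)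
      fun e _ => (ih (T.hd_ne_root e)).2

theorem low_mono {s s' : V → ℝ} (h0 : ∀ v, 0 ≤ s v) (h : ∀ v, s v ≤ s' v) (h1 : ∀ v, s' v ≤ 1)
    (k : ℕ) {v : V} (hv : v ≠ T.root) : T.low a d s k v ≤ T.low a d s' k v := by
  induction k generalizing v with
  | zero => exact h v
  | succ k ih =>
    exact low_step_mono had had'
      (fun e _ => (low_mem hd hreg had had' h0 (fun v => (h v).trans (h1 v)) k
        (T.hd_ne_root e)).1)
      (fun e _ => ih (T.hd_ne_root e))
      fun e _ => (low_mem hd hreg had had' (fun v => (h0 v).trans (h v)) h1 k (T.hd_ne_root e)).2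

/-- A field which is bounded below away from the root is driven to `1`, at a geometric rate. -/
theorem one_sub_low_le {s : V → ℝ} (h0 : ∀ v, 0 ≤ s v) (h1 : ∀ v, s v ≤ 1) {θ : ℝ}
    (hθ0 : 0 ≤ θ) (hθ1 : θ ≤ 1) (hθ : ∀ v, v ≠ T.root → θ ≤ s v) (k : ℕ) {v : V}
    (hv : v ≠ T.root) :
    1 - (1 - θ) * (1 - (a * d - 1) * θ) ^ k ≤ T.low a d s k v := by
  have hd' : (2 : ℝ) ≤ d := by exact_mod_cast hd
  have had2 : a * d - 1 ≤ 1 := by nlinarith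
  have hρ0 : 0 ≤ 1 - (a * d - 1) * θ := by nlinarith
  have hρ1 : 1 - (a * d - 1) * θ ≤ 1 := by nlinarith
  set m : ℕ → ℝ := fun k => 1 - (1 - θ) * (1 - (a * d - 1) * θ) ^ k with hm
  have hmθ : ∀ k, θ ≤ m k := fun k => by
    have : (1 - (a * d - 1) * θ) ^ k ≤ 1 := pow_le_one₀ hρ0 hρ1
    simp only [hm]
    nlinarith
  have hm1 : ∀ k, m k ≤ 1 := fun k => by
    have : 0 ≤ (1 - (a * d - 1) * θ) ^ k := pow_nonneg hρ0 k
    simp only [hm]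
    nlinarith
  change m k ≤ _
  induction k generalizing v with
  | zero => simpa [hm, low] using hθ v hv
  | succ k ih =>
    have h := low_step_mono (s := T.ch v) had had' (w := fun _ => m k)
      (w' := fun e => T.low a d s k (T.hd e)) (fun _ _ => hθ0.trans (hmθ k))
      (fun e _ => ih (T.hd_ne_root e))
      fun e _ => (low_mem hd hreg had had' h0 h1 k (T.hd_ne_root e)).2
    refine le_trans ?_ h
    rw [Finset.sum_const, Finset.prod_const, hreg v hv, nsmul_eq_mul]
    have hpow : m k ^ d ≤ m k ^ 2 := pow_le_pow_of_le_one (hθ0.trans (hmθ k)) (hm1 k) hd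
    have hrec : 1 - m (k + 1) = (1 - m k) * (1 - (a * d - 1) * θ) := by
      simp only [hm]; ring
    -- At a constant `m` the step equals `m + (a * d - 1) * (m - m ^ d)`, and `m ^ d ≤ m ^ 2` with
    -- `m ≥ θ` bounds the gain.
    have hb : θ * (1 - m k) ≤ m k - m k ^ d := by
      nlinarith [mul_le_mul_of_nonneg_right (hmθ k) (sub_nonneg.2 (hm1 k))]
    nlinarith [mul_le_mul_of_nonneg_left hb (sub_nonneg.2 had)]

end Domination

end RootedTree

/-! ### Comparison with independent percolation -/

section Affine

variable {E : Type*}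

/-- The configuration `A` as a family of numbers. -/
def toReal (A : E → Bool) (e : E) : ℝ := if A e = true then 1 else 0

theorem toReal_nonneg (A : E → Bool) (e : E) : 0 ≤ toReal A e := by
  rw [toReal]; split_ifs <;> simp

theorem toReal_le_one (A : E → Bool) (e : E) : toReal A e ≤ 1 := by
  rw [toReal]; split_ifs <;> simp

theorem measurable_toReal : Measurable (toReal : (E → Bool) → E → ℝ) :=
  measurable_pi_lambda _ fun e =>
    (measurable_of_countable fun b : Bool => if b = true then (1 : ℝ) else 0).comp
      (measurable_pi_apply e)

/-- Conditionally on all other edges, each edge is open with probability at least `r`. -/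
def EdgeBound (r : ℝ) (ν : Measure (E → Bool)) : Prop :=
  ∀ (e : E) (F : (E → Bool) → ℝ), Measurable F → (∃ C, ∀ A, |F A| ≤ C) →
    (∀ A, F (Function.update A e false) ≤ F (Function.update A e true)) →
    ∫ A, (r * F (Function.update A e true) + (1 - r) * F (Function.update A e false)) ∂ν ≤
      ∫ A, F A ∂ν

/-- Comparison with independent percolation, for increasing multi-affine functions. -/
theorem EdgeBound.le_integral {r : ℝ} {ν : Measure (E → Bool)} [IsProbabilityMeasure ν]
    (h : EdgeBound r ν) (hr0 : 0 ≤ r) (hr1 : r ≤ 1) {F : (E → ℝ) → ℝ} (hFm : Measurable F) {C : ℝ}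
    (hC : ∀ α : E → ℝ, (∀ e, 0 ≤ α e) → (∀ e, α e ≤ 1) → |F α| ≤ C)
    (hmono : ∀ α β : E → ℝ, (∀ e, 0 ≤ α e) → (∀ e, α e ≤ β e) → (∀ e, β e ≤ 1) → F α ≤ F β)
    (haff : ∀ α e, ∃ a b : ℝ, ∀ t, F (Function.update α e t) = a + b * t)
    {L : Finset E} (hL : ∀ α β : E → ℝ, (∀ e ∈ L, α e = β e) → F α = F β) :
    F (fun _ => r) ≤ ∫ A, F (toReal A) ∂ν := by
  -- Interpolation: edge variables are replaced by the number `r` one at a time. By affineness, the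
  -- value at `r` is exactly the convex combination on the left of `EdgeBound`.
  let mix : Finset E → (E → Bool) → E → ℝ := fun Λ A e => if e ∈ Λ then r else toReal A e
  have hmix0 : ∀ Λ A e, 0 ≤ mix Λ A e := fun Λ A e => by
    simp only [mix]; split_ifs; exacts [hr0, toReal_nonneg _ _]
  have hmix1 : ∀ Λ A e, mix Λ A e ≤ 1 := fun Λ A e => by
    simp only [mix]; split_ifs; exacts [hr1, toReal_le_one _ _]
  have hmixm : ∀ Λ, Measurable (mix Λ) := fun Λ => by
    refine measurable_pi_lambda _ fun e => ?_
    simp only [mix]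
    split_ifs
    · exact measurable_const
    · exact (measurable_pi_apply e).comp measurable_toReal
  have key : ∀ Λ, ∫ A, F (mix Λ A) ∂ν ≤ ∫ A, F (toReal A) ∂ν := by
    intro Λ
    induction Λ using Finset.induction_on with
    | empty => simp [mix]
    | insert e Λ he ih =>
      refine le_trans ?_ ih
      have hup : ∀ A b, mix Λ (Function.update A e b) =
          Function.update (mix Λ A) e (if b = true then 1 else 0) := by
        intro A b
        ext e'
        by_cases h' : e' = e
        · subst h'; simp [mix, he, toReal]
        · simp [mix, h', toReal]
      have hup' : ∀ A, mix (insert e Λ) A = Function.update (mix Λ A) e r := by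
        intro A
        ext e'
        by_cases h' : e' = e <;> simp [mix, h']
      refine le_trans (le_of_eq ?_) (h e (fun A => F (mix Λ A)) (hFm.comp (hmixm Λ))
        ⟨C, fun A => hC _ (hmix0 Λ A) (hmix1 Λ A)⟩ fun A => ?_)
      · refine integral_congr_ae (ae_of_all _ fun A => ?_)
        obtain ⟨a, b, hab⟩ := haff (mix Λ A) e
        simp only [hup', hup, hab, if_true, Bool.false_eq_true, if_false]
        ring
      · refine hmono _ _ (hmix0 Λ _) (fun e' => ?_) (hmix1 Λ _)
        rw [hup, hup]
        by_cases h' : e' = e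
        · subst h'; simp
        · simp [h']
  refine le_trans (le_of_eq ?_) (key L)
  have : ∀ A, F (mix L A) = F fun _ => r := fun A => hL _ _ fun e he => by simp [mix, he]
  simp [this]

end Affine

namespace RootedTree

variable {V E : Type*} {T : RootedTree V E}

/-! ### Affineness of the comparison recursion in the edge variables -/

section Local

/-- A vertex function of edge variables, affine in each variable, such that each variable matters
for at most one vertex of each depth, and only for vertices that are not below the edge. -/
def IsLocal (T : RootedTree V E) (F : (E → ℝ) → V → ℝ) : Prop :=
  ∀ (α : E → ℝ) (e : E),
    (∀ v, ∃ a b : ℝ, ∀ t, F (Function.update α e t) v = a + b * t) ∧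
    (∀ v, T.depth (T.tl e) < T.depth v → ∀ t, F (Function.update α e t) v = F α v) ∧
    ∀ v v', T.depth v = T.depth v' → v ≠ v' → (∀ t, F (Function.update α e t) v = F α v) ∨
      ∀ t, F (Function.update α e t) v' = F α v'

/-- The analogue of `IsLocal` for edge functions. -/
def IsEdgeLocal (T : RootedTree V E) (Z : (E → ℝ) → E → ℝ) : Prop :=
  ∀ (α : E → ℝ) (e : E),
    (∀ i, ∃ a b : ℝ, ∀ t, Z (Function.update α e t) i = a + b * t) ∧
    (∀ i, T.depth (T.tl e) < T.depth (T.tl i) → ∀ t, Z (Function.update α e t) i = Z α i) ∧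
    ∀ i j, T.depth (T.tl i) = T.depth (T.tl j) → i ≠ j →
      (∀ t, Z (Function.update α e t) i = Z α i) ∨ ∀ t, Z (Function.update α e t) j = Z α j

/-- A given variable enters the value of at most one edge among the children of `v`, so it passes
through a single affine slot of `Φ`. Distinct vertices of equal depth have disjoint child edges, so
locality survives. -/
theorem IsEdgeLocal.isLocal {Z : (E → ℝ) → E → ℝ} (hZ : T.IsEdgeLocal Z) {Φ : (E → ℝ) → V → ℝ}
    (hΦ : ∀ z z' v, (∀ e ∈ T.ch v, z e = z' e) → Φ z v = Φ z' v)
    (hΦ' : ∀ z e v, ∃ a b : ℝ, ∀ t, Φ (Function.update z e t) v = a + b * t) :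
    T.IsLocal fun α => Φ (Z α) := by
  intro α e
  obtain ⟨h1, h2, h3⟩ := hZ α e
  refine ⟨fun v => ?_, fun v hv t => ?_, fun v v' hvv hne => ?_⟩
  · by_cases hdep : ∃ i ∈ T.ch v, ¬ ∀ t, Z (Function.update α e t) i = Z α i
    · obtain ⟨i, hi, hdi⟩ := hdep
      obtain ⟨a, b, hab⟩ := h1 i
      obtain ⟨a', b', hab'⟩ := hΦ' (Z α) i v
      refine ⟨a' + b' * a, b' * b, fun t => ?_⟩
      have : Φ (Z (Function.update α e t)) v =
          Φ (Function.update (Z α) i (Z (Function.update α e t) i)) v := by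
        refine hΦ _ _ _ fun j hj => ?_
        by_cases hji : j = i
        · subst hji; rw [Function.update_self]
        · rw [Function.update_of_ne hji]
          rw [T.mem_ch] at hi hj
          exact ((h3 i j (by rw [hi, hj]) (Ne.symm hji)).resolve_left hdi) t
      beta_reduce
      rw [this, hab', hab]
      ring
    · push Not at hdep
      exact ⟨Φ (Z α) v, 0, fun t => by
        rw [zero_mul, add_zero]; exact hΦ _ _ _ fun i hi => hdep i hi t⟩
  · refine hΦ _ _ _ fun i hi => h2 i ?_ t
    rwa [(T.mem_ch _ _).1 hi]
  · by_cases hdep : ∃ i ∈ T.ch v, ¬ ∀ t, Z (Function.update α e t) i = Z α i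
    · obtain ⟨i, hi, hdi⟩ := hdep
      refine Or.inr fun t => hΦ _ _ _ fun j hj => ?_
      rw [T.mem_ch] at hi hj
      refine ((h3 i j (by rw [hi, hj, hvv]) ?_).resolve_left hdi) t
      rintro rfl
      exact hne (hi.symm.trans hj)
    · push Not at hdep
      exact Or.inl fun t => hΦ _ _ _ fun i hi => hdep i hi t

theorem IsLocal.isEdgeLocal {F : (E → ℝ) → V → ℝ} (hF : T.IsLocal F) :
    T.IsEdgeLocal fun α i => F α (T.hd i) := by
  intro α e
  obtain ⟨h1, h2, h3⟩ := hF α e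
  refine ⟨fun i => h1 _, fun i hi => h2 _ ?_, fun i j hij hne => h3 _ _ ?_ ?_⟩
  · rw [T.depth_hd]; omega
  · rw [T.depth_hd, T.depth_hd, hij]
  · exact fun h => hne (T.hd_injective h)

/-- The new factor `α i` causes no square because `F α (hd i)` does not involve the variable of `i`,
an edge above `hd i`. -/
theorem IsLocal.isEdgeLocal_mul {F : (E → ℝ) → V → ℝ} (hF : T.IsLocal F) :
    T.IsEdgeLocal fun α i => α i * F α (T.hd i) := by
  intro α e
  obtain ⟨h1, h2, h3⟩ := hF α e
  have hlow : ∀ i, T.depth (T.tl i) = T.depth (T.tl e) → ∀ t,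
      F (Function.update α e t) (T.hd i) = F α (T.hd i) := fun i hi =>
    h2 _ (by rw [T.depth_hd]; omega)
  refine ⟨fun i => ?_, fun i hi t => ?_, fun i j hij hne => ?_⟩
  · by_cases hie : i = e
    · subst hie
      exact ⟨0, F α (T.hd i), fun t => by
        beta_reduce; rw [hlow i rfl, Function.update_self]; ring⟩
    · obtain ⟨a, b, hab⟩ := h1 (T.hd i)
      exact ⟨α i * a, α i * b, fun t => by
        beta_reduce; rw [hab, Function.update_of_ne hie]; ring⟩
  · have hie : i ≠ e := by rintro rfl; omega
    beta_reduce
    rw [Function.update_of_ne hie, h2 _ (by rw [T.depth_hd]; omega)]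
  · by_cases hie : i = e
    · subst hie
      refine Or.inr fun t => ?_
      beta_reduce
      rw [Function.update_of_ne (Ne.symm hne), hlow j hij.symm]
    · by_cases hje : j = e
      · subst hje
        refine Or.inl fun t => ?_
        beta_reduce
        rw [Function.update_of_ne hie, hlow i hij]
      · refine (h3 (T.hd i) (T.hd j) (by rw [T.depth_hd, T.depth_hd, hij])
          fun h => hne (T.hd_injective h)).imp (fun h t => ?_) fun h t => ?_
        · beta_reduce
          rw [Function.update_of_ne hie, h]
        · beta_reduce
          rw [Function.update_of_ne hje, h]

theorem prod_update_affine (s : Finset E) (g : ℝ → ℝ) (hg : ∃ a b : ℝ, ∀ t, g t = a + b * t)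
    (z : E → ℝ) (e : E) :
    ∃ a b : ℝ, ∀ t, ∏ i ∈ s, g (Function.update z e t i) = a + b * t := by
  obtain ⟨a, b, hab⟩ := hg
  by_cases he : e ∈ s
  · refine ⟨a * ∏ i ∈ s.erase e, g (z i), b * ∏ i ∈ s.erase e, g (z i), fun t => ?_⟩
    rw [← Finset.mul_prod_erase _ _ he, Function.update_self,
      Finset.prod_congr rfl fun i hi => by rw [Function.update_of_ne (Finset.ne_of_mem_erase hi)],
      hab t]
    ring
  · refine ⟨∏ i ∈ s, g (z i), 0, fun t => ?_⟩
    rw [zero_mul, add_zero]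
    refine Finset.prod_congr rfl fun i hi => ?_
    rw [Function.update_of_ne]
    rintro rfl
    exact he hi

theorem sum_update_affine (s : Finset E) (z : E → ℝ) (e : E) :
    ∃ a b : ℝ, ∀ t, ∑ i ∈ s, Function.update z e t i = a + b * t := by
  by_cases he : e ∈ s
  · refine ⟨∑ i ∈ s.erase e, z i, 1, fun t => ?_⟩
    rw [← Finset.add_sum_erase _ _ he, Function.update_self,
      Finset.sum_congr rfl fun i hi => by rw [Function.update_of_ne (Finset.ne_of_mem_erase hi)]]
    ring
  · refine ⟨∑ i ∈ s, z i, 0, fun t => ?_⟩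
    rw [zero_mul, add_zero]
    refine Finset.sum_congr rfl fun i hi => ?_
    rw [Function.update_of_ne]
    rintro rfl
    exact he hi

theorem isLocal_surv (L : ℕ) : T.IsLocal fun α => T.surv α L := by
  induction L with
  | zero =>
    exact fun α e => ⟨fun v => ⟨1, 0, fun t => by simp [surv]⟩, fun _ _ _ => rfl,
      fun _ _ _ _ => Or.inl fun _ => rfl⟩
  | succ L ih =>
    refine IsEdgeLocal.isLocal (Φ := fun z v => 1 - ∏ e ∈ T.ch v, (1 - z e)) ih.isEdgeLocal_mul
      (fun z z' v h => ?_) fun z e v => ?_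
    · rw [Finset.prod_congr rfl fun e he => by rw [h e he]]
    · obtain ⟨a, b, hab⟩ := prod_update_affine (T.ch v) (fun t => 1 - t)
        ⟨1, -1, fun t => by ring⟩ z e
      exact ⟨1 - a, -b, fun t => by rw [hab]; ring⟩

theorem isLocal_low (a : ℝ) (d L k : ℕ) : T.IsLocal fun α => T.low a d (T.surv α L) k := by
  induction k with
  | zero => exact isLocal_surv L
  | succ k ih =>
    refine IsEdgeLocal.isLocal (Φ := fun z v => a * ∑ e ∈ T.ch v, z e -
      (a * d - 1) * ∏ e ∈ T.ch v, z e) ih.isEdgeLocal (fun z z' v h => ?_) fun z e v => ?_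
    · rw [Finset.prod_congr rfl h, Finset.sum_congr rfl h]
    · obtain ⟨a₁, b₁, h₁⟩ := prod_update_affine (T.ch v) (fun t => t) ⟨0, 1, fun t => by ring⟩ z e
      obtain ⟨a₂, b₂, h₂⟩ := sum_update_affine (T.ch v) z e
      exact ⟨a * a₂ - (a * d - 1) * a₁, a * b₂ - (a * d - 1) * b₁, fun t => by
        rw [h₁, h₂]; ring⟩

end Local

/-! ### Survival probabilities -/

section Surv

theorem surv_mem {α : E → ℝ} (h0 : ∀ e, 0 ≤ α e) (h1 : ∀ e, α e ≤ 1) (L : ℕ) (v : V) :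
    0 ≤ T.surv α L v ∧ T.surv α L v ≤ 1 := by
  induction L generalizing v with
  | zero => simp [surv]
  | succ L ih =>
    have h : ∀ e, 0 ≤ α e * T.surv α L (T.hd e) ∧ α e * T.surv α L (T.hd e) ≤ 1 := fun e =>
      ⟨mul_nonneg (h0 e) (ih _).1, mul_le_one₀ (h1 e) (ih _).1 (ih _).2⟩
    rw [surv]
    have h2 : 0 ≤ ∏ e ∈ T.ch v, (1 - α e * T.surv α L (T.hd e)) :=
      Finset.prod_nonneg fun e _ => sub_nonneg.2 (h e).2
    have h3 : ∏ e ∈ T.ch v, (1 - α e * T.surv α L (T.hd e)) ≤ 1 :=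
      Finset.prod_le_one (fun e _ => sub_nonneg.2 (h e).2) fun e _ => by linarith [(h e).1]
    constructor <;> linarith

theorem surv_mono {α β : E → ℝ} (h0 : ∀ e, 0 ≤ α e) (h : ∀ e, α e ≤ β e) (h1 : ∀ e, β e ≤ 1)
    (L : ℕ) (v : V) : T.surv α L v ≤ T.surv β L v := by
  induction L generalizing v with
  | zero => exact le_rfl
  | succ L ih =>
    rw [surv, surv]
    have hβ := fun e => surv_mem (T := T) (fun e => (h0 e).trans (h e)) h1 L (T.hd e)
    have hα := fun e => surv_mem (T := T) h0 (fun e => (h e).trans (h1 e)) L (T.hd e)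
    refine sub_le_sub_left (Finset.prod_le_prod (fun e _ => ?_) fun e _ => ?_) 1
    · exact sub_nonneg.2 (mul_le_one₀ (h1 e) (hβ e).1 (hβ e).2)
    · exact sub_le_sub_left (mul_le_mul (h e) (ih _) (hα e).1 ((h0 e).trans (h e))) 1

theorem measurable_surv (L : ℕ) (v : V) : Measurable fun α : E → ℝ => T.surv α L v := by
  induction L generalizing v with
  | zero => exact measurable_const
  | succ L ih =>
    exact measurable_const.sub (Finset.measurable_fun_prod _ fun e _ =>
      measurable_const.sub ((measurable_pi_apply e).mul (ih _)))

theorem measurable_low {Ω : Type*} [MeasurableSpace Ω] (a : ℝ) (d : ℕ) {s : Ω → V → ℝ}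
    (hs : ∀ v, Measurable fun ω => s ω v) (k : ℕ) (v : V) :
    Measurable fun ω => T.low a d (s ω) k v := by
  induction k generalizing v with
  | zero => exact hs v
  | succ k ih =>
    exact (measurable_const.mul (Finset.measurable_fun_sum _ fun e _ => ih _)).sub
      (measurable_const.mul (Finset.measurable_fun_prod _ fun e _ => ih _))

theorem surv_congr {α β : E → ℝ} {L : ℕ} {v : V}
    (h : ∀ e ∈ T.ball (T.depth v + L), α e = β e) : T.surv α L v = T.surv β L v := by
  induction L generalizing v with
  | zero => rfl
  | succ L ih =>
    rw [surv, surv]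
    congr 1
    refine Finset.prod_congr rfl fun e he => ?_
    rw [T.mem_ch] at he
    rw [h e (T.mem_ball.2 (by rw [he]; omega)), ih fun e' he' => h e' ?_]
    rw [T.depth_hd, he] at he'
    exact T.ball_mono (by omega) he'

theorem low_surv_congr {α β : E → ℝ} {a : ℝ} {d L k : ℕ} {v : V}
    (h : ∀ e ∈ T.ball (T.depth v + L + k), α e = β e) :
    T.low a d (T.surv α L) k v = T.low a d (T.surv β L) k v := by
  induction k generalizing v with
  | zero => exact surv_congr h
  | succ k ih =>
    have : ∀ e ∈ T.ch v, T.low a d (T.surv α L) k (T.hd e) = T.low a d (T.surv β L) k (T.hd e) := by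
      intro e he
      rw [T.mem_ch] at he
      refine ih fun e' he' => h e' ?_
      rw [T.depth_hd, he] at he'
      exact T.ball_mono (by omega) he'
    rw [low, low, Finset.sum_congr rfl this, Finset.prod_congr rfl this]

/-- At `0`-`1` edge variables the survival polynomial is an indicator. This links the multi-affine
calculus to `extinct`, which is not a local function. -/
theorem surv_toReal (A : E → Bool) (L : ℕ) (v : V) :
    T.surv (toReal A) L v = if T.openDesc A L v = 0 then 0 else 1 := by
  induction L generalizing v with
  | zero => simp [surv, openDesc]
  | succ L ih =>
    rw [surv]
    simp only [ih]
    split_ifs with h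
    · rw [openDesc_succ_eq_zero] at h
      rw [Finset.prod_eq_one, sub_self]
      intro e he
      by_cases hA : A e = true
      · simp [h e he hA]
      · simp [toReal, hA]
    · rw [openDesc_succ_eq_zero] at h
      push Not at h
      obtain ⟨e, he, hA, h⟩ := h
      rw [Finset.prod_eq_zero he, sub_zero]
      simp [toReal, hA, h]

theorem tendsto_surv_toReal (A : E → Bool) (v : V) :
    Tendsto (fun L => T.surv (toReal A) L v) atTop (𝓝 (1 - T.extinct A v)) := by
  simp only [surv_toReal, extinct]
  by_cases h : ∃ k, T.openDesc A k v = 0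
  · obtain ⟨k, hk⟩ := h
    refine tendsto_const_nhds.congr' ?_
    filter_upwards [eventually_ge_atTop k] with L hL
    rw [if_pos ⟨k, hk⟩, if_pos (openDesc_eq_zero_mono hL hk), sub_self]
  · have : ∀ L, T.openDesc A L v ≠ 0 := fun L hL => h ⟨L, hL⟩
    simp [this]

theorem tendsto_low (a : ℝ) (d : ℕ) {s : ℕ → V → ℝ} {s' : V → ℝ}
    (h : ∀ v, Tendsto (fun L => s L v) atTop (𝓝 (s' v))) (k : ℕ) (v : V) :
    Tendsto (fun L => T.low a d (s L) k v) atTop (𝓝 (T.low a d s' k v)) := by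
  induction k generalizing v with
  | zero => exact h v
  | succ k ih =>
    exact ((tendsto_finsetSum _ fun e _ => ih _).const_mul _).sub
      ((tendsto_finsetProd _ fun e _ => ih _).const_mul _)

theorem measurable_extinct (v : V) : Measurable fun A : E → Bool => T.extinct A v := by
  have h : Measurable fun A : E → Bool => 1 - T.extinct A v :=
    measurable_of_tendsto_metrizable (fun L => (measurable_surv L v).comp measurable_toReal)
      (tendsto_pi_nhds.2 fun A => tendsto_surv_toReal A v)
  simpa [Pi.sub_def] using (measurable_const (a := (1 : ℝ))).sub h

/-- The supercritical branching bound `θ = 1 - 1 / (d * r)` is preserved: with `t = r * θ` one has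
`1 + d * t = d * r`, and Bernoulli gives `(1 - t) ^ d ≤ 1 / (1 + d * t)`. -/
theorem le_surv_const {d : ℕ} (hreg : ∀ v, v ≠ T.root → (T.ch v).card = d) {r : ℝ} (hr0 : 0 < r)
    (hr1 : r ≤ 1) (hdr : 1 < d * r) (L : ℕ) {v : V} (hv : v ≠ T.root) :
    (d * r - 1) / (d * r) ≤ T.surv (fun _ => r) L v := by
  set θ := (d * r - 1) / (d * r) with hθ
  have hθd : θ * (d * r) = d * r - 1 := by
    rw [hθ, div_mul_cancel₀]; exact (by linarith : (0 : ℝ) < d * r).ne'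
  have hθ0 : 0 ≤ θ := div_nonneg (by linarith) (by linarith)
  have hθ1 : θ ≤ 1 := by rw [hθ, div_le_one (by linarith)]; linarith
  induction L generalizing v with
  | zero => exact hθ1
  | succ L ih =>
    rw [surv]
    have h1 : ∏ e ∈ T.ch v, (1 - r * T.surv (fun _ => r) L (T.hd e)) ≤ (1 - r * θ) ^ d := by
      rw [← hreg v hv, ← Finset.prod_const]
      refine Finset.prod_le_prod (fun e _ => ?_) fun e _ => ?_
      · have := surv_mem (T := T) (fun _ => hr0.le) (fun _ => hr1) L (T.hd e)
        exact sub_nonneg.2 (mul_le_one₀ hr1 this.1 this.2)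
      · exact sub_le_sub_left (mul_le_mul_of_nonneg_left (ih (T.hd_ne_root e)) hr0.le) 1
    have ht : 0 ≤ r * θ := mul_nonneg hr0.le hθ0
    have h2 : (1 - r * θ) ^ d * (1 + d * (r * θ)) ≤ 1 := by
      calc _ ≤ (1 - r * θ) ^ d * (1 + r * θ) ^ d := by
            refine mul_le_mul_of_nonneg_left ?_ (pow_nonneg ?_ d)
            · exact one_add_mul_le_pow (by linarith) d
            · exact sub_nonneg.2 (mul_le_one₀ hr1 hθ0 hθ1)
        _ = (1 - (r * θ) ^ 2) ^ d := by rw [← mul_pow]; ring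
        _ ≤ 1 := by
            refine pow_le_one₀ ?_ (by nlinarith)
            have : r * θ ≤ 1 := mul_le_one₀ hr1 hθ0 hθ1
            nlinarith
    have h3 : 1 + d * (r * θ) = d * r := by nlinarith
    rw [h3] at h2
    have h4 : (1 - r * θ) ^ d ≤ 1 / (d * r) := by rwa [le_div_iff₀ (by linarith)]
    have h5 : θ = 1 - 1 / (d * r) := by
      rw [hθ, sub_div, div_self (by linarith : (0 : ℝ) < d * r).ne']
    linarith

end Surv

end RootedTree

namespace RootedTree

variable {V E : Type*} {T : RootedTree V E} {p q : ℝ} {d : ℕ}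

theorem measurable_iterate_push {x : (E → Bool) → V → ℝ} (hx : ∀ v, Measurable fun A => x A v)
    (k : ℕ) (v : V) : Measurable fun A => (T.push p q)^[k] (x A) v := by
  induction k generalizing v with
  | zero => exact hx v
  | succ k ih =>
    simp only [Function.iterate_succ_apply']
    refine Finset.measurable_fun_prod _ fun e _ => ?_
    have hm : Measurable (msg p q) := by unfold msg; fun_prop
    exact hm.comp (ih _)

/-! ### Convergence of the averaged field to the fixed point -/

section Convergence

variable (hd : 2 ≤ d) (hreg : ∀ v, v ≠ T.root → (T.ch v).card = d)

include hd hreg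

/-- For survival up to `L` generations, `low` is a local, increasing, multi-affine polynomial, so
its mean is at least its value at the constant `r`, which the geometric rate bounds uniformly in
`L`. Dominated convergence then lets `L` tend to infinity. -/
theorem le_integral_low {r a : ℝ} (hr0 : 0 < r) (hr1 : r ≤ 1) (hdr : 1 < d * r)
    (had : 1 ≤ a * d) (had' : a * (d - 1) ≤ 1)
    {ν : Measure (E → Bool)} [IsProbabilityMeasure ν] (hν : EdgeBound r ν) (k : ℕ) {v : V}
    (hv : v ≠ T.root) :
    1 - (1 - (d * r - 1) / (d * r)) * (1 - (a * d - 1) * ((d * r - 1) / (d * r))) ^ k ≤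
      ∫ A, T.low a d (fun v => 1 - T.extinct A v) k v ∂ν := by
  have hθ0 : 0 ≤ (d * r - 1) / (d * r) := div_nonneg (by linarith) (by linarith)
  have hθ1 : (d * r - 1) / (d * r) ≤ 1 := by rw [div_le_one (by linarith)]; linarith
  have hb : ∀ α : E → ℝ, (∀ e, 0 ≤ α e) → (∀ e, α e ≤ 1) → ∀ L,
      0 ≤ T.low a d (T.surv α L) k v ∧ T.low a d (T.surv α L) k v ≤ 1 := fun α h0 h1 L =>
    low_mem hd hreg had had' (fun v => (surv_mem h0 h1 L v).1) (fun v => (surv_mem h0 h1 L v).2)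
      k hv
  have hL : ∀ L, 1 - (1 - (d * r - 1) / (d * r)) *
      (1 - (a * d - 1) * ((d * r - 1) / (d * r))) ^ k ≤
      ∫ A, T.low a d (T.surv (toReal A) L) k v ∂ν := by
    intro L
    have hs := fun v => surv_mem (T := T) (fun _ => hr0.le) (fun _ => hr1) L v
    refine (one_sub_low_le hd hreg had had' (fun v => (hs v).1) (fun v => (hs v).2) hθ0 hθ1
      (fun v hv => le_surv_const hreg hr0 hr1 hdr L hv) k hv).trans ?_
    refine hν.le_integral hr0.le hr1 (F := fun α => T.low a d (T.surv α L) k v) (C := 1)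
      (measurable_low a d (fun v => measurable_surv L v) k v) (fun α h0 h1 => ?_)
      (fun α β h0 h h1 => ?_) (fun α e => (isLocal_low a d L k α e).1 v)
      (fun α β h => low_surv_congr h)
    · rw [abs_of_nonneg (hb α h0 h1 L).1]; exact (hb α h0 h1 L).2
    · exact low_mono hd hreg had had'
        (fun v => (surv_mem h0 (fun e => (h e).trans (h1 e)) L v).1)
        (fun v => surv_mono h0 h h1 L v)
        (fun v => (surv_mem (fun e => (h0 e).trans (h e)) h1 L v).2) k hv
  refine ge_of_tendsto' (tendsto_integral_of_dominated_convergence (fun _ => (1 : ℝ))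
    (fun L => ?_) (integrable_const _) (fun L => ae_of_all _ fun A => ?_)
    (ae_of_all _ fun A => tendsto_low a d (fun v => tendsto_surv_toReal A v) k v)) hL
  · exact (measurable_low a d (fun v => (measurable_surv L v).comp measurable_toReal) k
      v).aestronglyMeasurable
  · have := hb (toReal A) (toReal_nonneg A) (toReal_le_one A) L
    rw [Real.norm_eq_abs, abs_of_nonneg this.1]
    exact this.2

/-- In logarithmic scale `push` adds up messages of the children. Because `low ≤ 1`, the truncation
at `c` is inactive in the inductive bound, and the product term of `low` is simply subtracted. -/
theorem iterate_push_le_exp_low (hp0 : 0 < p) (hp1 : p < 1) (hq : 1 < q) {a c : ℝ} (hc : 0 ≤ c)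
    (had : 1 ≤ a * d) (had' : a * (d - 1) ≤ 1)
    (hmsg : ∀ u, 0 ≤ u → msg p q (Real.exp (-u)) ≤ Real.exp (-(a * min u c)))
    (A : E → Bool) (k : ℕ) {v : V} (hv : v ≠ T.root) :
    (T.push p q)^[k] (T.extinct A) v ≤
      Real.exp (-(c * T.low a d (fun v => 1 - T.extinct A v) k v)) := by
  have hmem := fun k {v : V} (hv : v ≠ T.root) => low_mem hd hreg had had'
    (s := fun v => 1 - T.extinct A v) (fun v => sub_nonneg.2 (extinct_le_one A v))
    (fun v => by linarith [extinct_nonneg (T := T) A v]) k hv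
  induction k generalizing v with
  | zero =>
    rw [Function.iterate_zero, id, low, extinct]
    split_ifs <;> simp [Real.exp_nonneg]
  | succ k ih =>
    rw [Function.iterate_succ_apply', low]
    set s := fun v => 1 - T.extinct A v
    calc T.push p q ((T.push p q)^[k] (T.extinct A)) v
        ≤ ∏ e ∈ T.ch v, Real.exp (-(a * (c * T.low a d s k (T.hd e)))) := by
          refine Finset.prod_le_prod (fun e _ => (msg_pos hp0 hp1 hq
            (iterate_push_nonneg hp0 hp1 hq (extinct_nonneg A) k _)).le) fun e _ => ?_
          have hl := hmem k (T.hd_ne_root e)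
          refine (msg_mono hp0 hp1 hq (iterate_push_nonneg hp0 hp1 hq (extinct_nonneg A) k _)
            (ih (T.hd_ne_root e))).trans ((hmsg _ (mul_nonneg hc hl.1)).trans_eq ?_)
          rw [min_eq_left (mul_le_of_le_one_right hc hl.2)]
      _ = Real.exp (-(c * (a * ∑ e ∈ T.ch v, T.low a d s k (T.hd e)))) := by
          rw [← Real.exp_sum]
          congr 1
          rw [Finset.mul_sum, Finset.mul_sum, ← Finset.sum_neg_distrib]
          exact Finset.sum_congr rfl fun e _ => by ring
      _ ≤ _ := by
          refine Real.exp_le_exp.2 (neg_le_neg (mul_le_mul_of_nonneg_left ?_ hc))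
          refine sub_le_self _ (mul_nonneg (sub_nonneg.2 had) ?_)
          exact Finset.prod_nonneg fun e _ => (hmem k (T.hd_ne_root e)).1

omit hd in
theorem iterate_zero_le_iterate_push (hp0 : 0 < p) (hp1 : p < 1) (hq : 1 < q) {x : V → ℝ}
    (hx : ∀ v, 0 ≤ x v) (k : ℕ) {v : V} (hv : v ≠ T.root) :
    0 ≤ (fun x => msg p q x ^ d)^[k] 0 ∧
      (fun x => msg p q x ^ d)^[k] 0 ≤ (T.push p q)^[k] x v := by
  induction k generalizing v with
  | zero => exact ⟨le_rfl, hx v⟩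
  | succ k ih =>
    rw [Function.iterate_succ_apply', Function.iterate_succ_apply']
    have h0 := (ih hv).1
    refine ⟨pow_nonneg (msg_pos hp0 hp1 hq h0).le d, ?_⟩
    rw [← hreg v hv, ← Finset.prod_const]
    rw [hreg v hv]
    exact Finset.prod_le_prod (fun _ _ => (msg_pos hp0 hp1 hq h0).le) fun e _ =>
      msg_mono hp0 hp1 hq h0 (ih (T.hd_ne_root e)).2

/-- The averaged field computed from the true boundary values converges in mean to the fixed point
of the message recursion. -/
theorem tendsto_integral_iterate_push (hp0 : 0 < p) (hp1 : p < 1) (hq : 1 < q)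
    (hdp : p + (1 - p) * q < d * p) {z : ℝ} (hz0 : 0 < z) (hz1 : z < 1)
    (hz : Tendsto (fun k => (fun x => msg p q x ^ d)^[k] 0) atTop (𝓝 z))
    (hmsg : ∀ c, 0 < c → c < -Real.log z → ∃ a : ℝ, 1 < a * d ∧ a * (d - 1) ≤ 1 ∧
        ∀ u, 0 ≤ u → msg p q (Real.exp (-u)) ≤ Real.exp (-(a * min u c)))
    {ν : Measure (E → Bool)} [IsProbabilityMeasure ν]
    (hν : EdgeBound (p / (p + (1 - p) * q)) ν) {v : V} (hv : v ≠ T.root) :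
    Tendsto (fun k => ∫ A, |(T.push p q)^[k] (T.extinct A) v - z| ∂ν) atTop (𝓝 0) := by
  have h1p : 0 < 1 - p := by linarith
  have hden : 0 < p + (1 - p) * q := by positivity
  set r := p / (p + (1 - p) * q) with hr
  have hr0 : 0 < r := by positivity
  have hr1 : r ≤ 1 := by rw [hr, div_le_one hden]; nlinarith
  have hdr : 1 < d * r := by rw [hr, ← mul_div_assoc, one_lt_div hden]; exact hdp
  set X : ℕ → (E → Bool) → ℝ := fun k A => (T.push p q)^[k] (T.extinct A) v with hX
  have hX0 : ∀ k A, 0 ≤ X k A := fun k A =>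
    iterate_push_nonneg hp0 hp1 hq (extinct_nonneg A) k v
  have hX1 : ∀ k A, X k A ≤ 1 := fun k A =>
    iterate_push_le_one hp0 hp1 hq (extinct_nonneg A) (extinct_le_one A) k v
  have hXm : ∀ k, Measurable (X k) := fun k =>
    measurable_iterate_push (fun v => measurable_extinct v) k v
  have hXi : ∀ k, Integrable (X k) ν := fun k => integrable_of_bounded (hXm k) (C := 1) fun A => by
    rw [abs_of_nonneg (hX0 k A)]; exact hX1 k A
  set Gk : ℕ → ℝ := fun k => (fun x => msg p q x ^ d)^[k] 0 with hGk
  have hlow : ∀ k A, Gk k ≤ X k A := fun k A =>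
    (iterate_zero_le_iterate_push hreg hp0 hp1 hq (extinct_nonneg A) k hv).2
  have hup : ∀ ε, 0 < ε → ∀ᶠ k in atTop, ∫ A, X k A ∂ν ≤ z + ε := by
    intro ε hε
    -- The slope `a` is available only for `c` strictly below `-log z`, so `c` is taken close to it.
    obtain ⟨c, hc0, hcz, hcε⟩ : ∃ c, 0 < c ∧ c < -Real.log z ∧ Real.exp (-c) < z + ε := by
      have hlog : 0 < -Real.log z := by linarith [Real.log_neg hz0 hz1]
      have : ∀ᶠ c in 𝓝[<] (-Real.log z), Real.exp (-c) < z + ε := by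
        have hcont : Tendsto (fun c => Real.exp (-c)) (𝓝 (-Real.log z)) (𝓝 z) := by
          have : Continuous fun c : ℝ => Real.exp (-c) := by fun_prop
          have h := this.tendsto (-Real.log z)
          rwa [neg_neg, Real.exp_log hz0] at h
        exact nhdsWithin_le_nhds (hcont.eventually_lt_const (by linarith))
      have hpos : ∀ᶠ c in 𝓝[<] (-Real.log z), 0 < c := nhdsWithin_le_nhds (lt_mem_nhds hlog)
      have hltz : ∀ᶠ c in 𝓝[<] (-Real.log z), c < -Real.log z := self_mem_nhdsWithin
      obtain ⟨c, hc1, hc2, hc3⟩ := (this.and (hpos.and hltz)).exists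
      exact ⟨c, hc2, hc3, hc1⟩
    obtain ⟨a, had, had', hm⟩ := hmsg c hc0 hcz
    set θ := (d * r - 1) / (d * r) with hθ
    have hθ0 : 0 < θ := div_pos (by linarith) (by linarith)
    have hθ1 : θ ≤ 1 := by rw [hθ, div_le_one (by linarith)]; linarith
    set m : ℕ → ℝ := fun k => 1 - (1 - θ) * (1 - (a * d - 1) * θ) ^ k with hmdef
    have hd' : (2 : ℝ) ≤ d := by exact_mod_cast hd
    have hmlim : Tendsto m atTop (𝓝 1) := by
      have had2 : a * d - 1 ≤ 1 := by nlinarith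
      have : Tendsto (fun k => (1 - (a * d - 1) * θ) ^ k) atTop (𝓝 0) :=
        tendsto_pow_atTop_nhds_zero_of_lt_one (by nlinarith) (by nlinarith)
      simpa using (this.const_mul (1 - θ)).const_sub 1
    have hbound : ∀ k, ∫ A, X k A ∂ν ≤ 1 - (1 - Real.exp (-c)) * m k := by
      intro k
      set ℓ : (E → Bool) → ℝ := fun A => T.low a d (fun v => 1 - T.extinct A v) k v with hℓ
      have hℓmem : ∀ A, 0 ≤ ℓ A ∧ ℓ A ≤ 1 := fun A => low_mem hd hreg had.le had'
        (fun v => sub_nonneg.2 (extinct_le_one A v))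
        (fun v => by linarith [extinct_nonneg (T := T) A v]) k hv
      have hℓm : Measurable ℓ :=
        measurable_low a d (fun v => measurable_const.sub (measurable_extinct v)) k v
      have hℓi : Integrable ℓ ν := integrable_of_bounded hℓm (C := 1) fun A => by
        rw [abs_of_nonneg (hℓmem A).1]; exact (hℓmem A).2
      have hpt : ∀ A, X k A ≤ 1 - (1 - Real.exp (-c)) * ℓ A := by
        intro A
        refine (iterate_push_le_exp_low hd hreg hp0 hp1 hq hc0.le had.le had' hm A k hv).trans ?_
        -- The chord of `exp` between `0` and `-c` makes the bound linear in `ℓ`, so that only the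
        -- mean of `ℓ` matters.
        have hcx := convexOn_exp.2 (Set.mem_univ 0) (Set.mem_univ (-c))
          (sub_nonneg.2 (hℓmem A).2) (hℓmem A).1 (by ring)
        simp only [smul_eq_mul, mul_zero, zero_add, Real.exp_zero, mul_one] at hcx
        have heq : -(c * ℓ A) = ℓ A * -c := by ring
        change Real.exp (-(c * ℓ A)) ≤ _
        rw [heq]
        linarith
      calc ∫ A, X k A ∂ν ≤ ∫ A, (1 - (1 - Real.exp (-c)) * ℓ A) ∂ν :=
            integral_mono (hXi k) ((integrable_const 1).sub (hℓi.const_mul _)) hpt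
        _ = 1 - (1 - Real.exp (-c)) * ∫ A, ℓ A ∂ν := by
            rw [integral_sub (integrable_const 1) (hℓi.const_mul _), integral_const_mul]
            simp
        _ ≤ _ := by
            have h1 := le_integral_low hd hreg hr0 hr1 hdr had.le had' hν k hv
            have h2 : 0 ≤ 1 - Real.exp (-c) :=
              sub_nonneg.2 (Real.exp_le_one_iff.2 (by linarith))
            exact sub_le_sub_left (mul_le_mul_of_nonneg_left h1 h2) 1
    have hlim : Tendsto (fun k => 1 - (1 - Real.exp (-c)) * m k) atTop (𝓝 (Real.exp (-c))) := by
      have := (hmlim.const_mul (1 - Real.exp (-c))).const_sub 1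
      simpa using this
    filter_upwards [hlim.eventually_lt_const hcε] with k hk
    exact (hbound k).trans hk.le
  -- The pointwise lower bound `Gk k ≤ X k` turns control of the mean of `X k` into control of its
  -- mean distance to `z`.
  have hbd : ∀ k, ∫ A, |X k A - z| ∂ν ≤ (∫ A, X k A ∂ν - Gk k) + |Gk k - z| := by
    intro k
    have hi : Integrable (fun A => |X k A - z|) ν := ((hXi k).sub (integrable_const z)).abs
    have hi' : Integrable (fun A => X k A - Gk k) ν := (hXi k).sub (integrable_const _)
    calc ∫ A, |X k A - z| ∂ν ≤ ∫ A, ((X k A - Gk k) + |Gk k - z|) ∂ν := by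
          refine integral_mono hi (hi'.add (integrable_const _)) fun A => ?_
          calc |X k A - z| ≤ |X k A - Gk k| + |Gk k - z| := abs_sub_le _ _ _
            _ = _ := by rw [abs_of_nonneg (sub_nonneg.2 (hlow k A))]
      _ = _ := by
          rw [integral_add hi' (integrable_const _),
            integral_sub (hXi k) (integrable_const _)]
          simp
  rw [Metric.tendsto_atTop]
  intro ε hε
  have h1 := hup (ε / 4) (by linarith)
  have h2 := (Metric.tendsto_atTop.1 hz) (ε / 4) (by linarith)
  obtain ⟨N₁, hN₁⟩ := eventually_atTop.1 h1
  obtain ⟨N₂, hN₂⟩ := h2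
  refine ⟨max N₁ N₂, fun k hk => ?_⟩
  have a1 := hN₁ k (le_of_max_le_left hk)
  have a2 : |Gk k - z| < ε / 4 := hN₂ k (le_of_max_le_right hk)
  have a3 : 0 ≤ ∫ A, |X k A - z| ∂ν := integral_nonneg fun A => abs_nonneg _
  rw [Real.dist_eq, sub_zero, abs_of_nonneg a3]
  have a4 := hbd k
  have a5 := abs_lt.1 a2
  linarith

end Convergence

/-- If the boundary fields converge in mean at the vertices of depth `n`, the resampled expectations
converge along a subsequence. -/
theorem exists_subseq_tendsto_integral_ballMean (hp0 : 0 < p) (hp1 : p < 1) (hq : 1 < q)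
    {ν : Measure (E → Bool)} [IsProbabilityMeasure ν] {n : ℕ} (hn : 1 ≤ n)
    {F : (E → Bool) → ℝ} {C : ℝ} (hC : ∀ A, |F A| ≤ C)
    {X : ℕ → (E → Bool) → V → ℝ} {Y : (E → Bool) → V → ℝ}
    (hX0 : ∀ k A v, 0 ≤ X k A v) (hX1 : ∀ k A v, X k A v ≤ 1)
    (hXm : ∀ k v, Measurable fun A => X k A v)
    (hY0 : ∀ A v, 0 ≤ Y A v) (hY1 : ∀ A v, Y A v ≤ 1) (hYm : ∀ v, Measurable fun A => Y A v)
    (hlim : ∀ v, T.depth v = n → Tendsto (fun k => ∫ A, |X k A v - Y A v| ∂ν) atTop (𝓝 0))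
    (hmeas : ∀ k, Measurable fun A => T.ballMean p q n F (X k A) A) :
    ∃ ns : ℕ → ℕ, StrictMono ns ∧
      Tendsto (fun j => ∫ A, T.ballMean p q n F (X (ns j) A) A ∂ν) atTop
        (𝓝 (∫ A, T.ballMean p q n F (Y A) A ∂ν)) := by
  have hi : ∀ k v, Integrable (fun A => |X k A v - Y A v|) ν := fun k v =>
    integrable_of_bounded ((hXm k v).sub (hYm v)).norm (C := 1) fun A => by
      rw [abs_abs, abs_le]
      constructor <;> linarith [hX0 k A v, hX1 k A v, hY0 A v, hY1 A v]
  -- Vertices of depth `n ≥ 1` are the lower ends of level `n - 1`; adding their errors yields one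
  -- subsequence for all of them.
  let f : ℕ → (E → Bool) → ℝ := fun k A => ∑ e ∈ T.lev (n - 1), |X k A (T.hd e) - Y A (T.hd e)|
  have hfm : ∀ k, Measurable (f k) := fun k =>
    Finset.measurable_fun_sum _ fun e _ => ((hXm k _).sub (hYm _)).norm
  have hf0 : ∀ k A, 0 ≤ f k A := fun k A => Finset.sum_nonneg fun e _ => abs_nonneg _
  have hfi : ∀ k, Integrable (f k) ν := fun k => integrable_finsetSum _ fun e _ => hi k _
  have hft : Tendsto (fun k => ∫ A, f k A ∂ν) atTop (𝓝 0) := by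
    have h1 : ∀ k, ∫ A, f k A ∂ν =
        ∑ e ∈ T.lev (n - 1), ∫ A, |X k A (T.hd e) - Y A (T.hd e)| ∂ν := fun k =>
      integral_finsetSum _ fun e _ => hi k _
    simp only [h1]
    rw [← Finset.sum_const_zero (s := T.lev (n - 1)) (ι := E) (M := ℝ)]
    refine tendsto_finsetSum _ fun e he => hlim _ ?_
    rw [T.depth_hd, T.mem_lev.1 he]
    omega
  obtain ⟨ns, hns, hae⟩ := exists_subseq_ae_tendsto_zero hfm hf0 hfi hft
  refine ⟨ns, hns, tendsto_integral_of_dominated_convergence (fun _ => C)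
    (fun j => (hmeas _).aestronglyMeasurable) (integrable_const _)
    (fun j => ae_of_all _ fun A => abs_ballMean_le hp0 hp1 hq hC (hX0 _ A) A) ?_⟩
  filter_upwards [hae] with A hA
  refine tendsto_ballMean hp0 hp1 hq F (hY0 A) (fun v hv => ?_) A
  obtain ⟨e, rfl⟩ := T.exists_hd v (T.ne_root_of_depth (by omega))
  have he : e ∈ T.lev (n - 1) := by
    rw [T.depth_hd] at hv
    rw [T.mem_lev]; omega
  rw [tendsto_iff_dist_tendsto_zero]
  refine squeeze_zero (fun _ => dist_nonneg) (fun j => ?_) hA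
  rw [Real.dist_eq]
  exact Finset.single_le_sum (f := fun e => |X (ns j) A (T.hd e) - Y A (T.hd e)|)
    (fun e _ => abs_nonneg _) he

end RootedTree

/-- The configuration `A` with the state of `e` replaced by `b`. -/
def setEdge {E : Type*} (e : E) (b : Bool) (A : E → Bool) : E → Bool := Function.update A e b

theorem setEdge_self {E : Type*} (e : E) (b : Bool) (A : E → Bool) : setEdge e b A e = b := by
  simp [setEdge]

theorem measurable_setEdge {E : Type*} (e : E) (b : Bool) :
    Measurable (setEdge e b : (E → Bool) → E → Bool) := by
  refine measurable_pi_lambda _ fun e' => ?_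
  by_cases he : e' = e
  · subst he; simp [setEdge]
  · simpa [setEdge, Function.update_of_ne he] using measurable_pi_apply e'

theorem sumOver_singleton {E : Type*} (e : E) (F : (E → Bool) → ℝ) (A : E → Bool) :
    sumOver {e} F A = F (setEdge e false A) + F (setEdge e true A) := by
  rw [← insert_empty_eq e, sumOver_insert (by simp), sumOver_empty]
  rfl

theorem edgeBound_iff {E : Type*} {r : ℝ} {ν : Measure (E → Bool)} : EdgeBound r ν ↔
    ∀ (e : E) (F : (E → Bool) → ℝ), Measurable F → (∃ C, ∀ A, |F A| ≤ C) →
      (∀ A, F (setEdge e false A) ≤ F (setEdge e true A)) →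
      ∫ A, (r * F (setEdge e true A) + (1 - r) * F (setEdge e false A)) ∂ν ≤ ∫ A, F A ∂ν :=
  Iff.rfl

/-! ### Conditional probability of a single edge -/

section SingleEdge

variable {V : Type*} {G : SimpleGraph V} {p q : ℝ}

theorem one_le_clusterCount_singleton (e : G.edgeSet) (A : G.edgeSet → Bool) :
    1 ≤ clusterCount {e} A ∧ clusterCount {e} A ≤ 2 ∧ (A e = true → clusterCount {e} A = 1) := by
  obtain ⟨a, b, hab⟩ : ∃ a b, (e : Sym2 V) = s(a, b) := by
    induction h : (e : Sym2 V) with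
    | _ a b => exact ⟨a, b, rfl⟩
  have hv : verts {e} = {a, b} := by
    ext v
    simp [verts, hab]
  rw [clusterCount, hv, Set.image_pair]
  refine ⟨(Set.ncard_pos).2 (Set.insert_nonempty _ _), ?_, fun hA => ?_⟩
  · exact (Set.ncard_insert_le _ _).trans (by rw [Set.ncard_singleton])
  · have : wiredClass (exteriorGraph ∅ A) a = wiredClass (exteriorGraph ∅ A) b :=
      wiredClass_eq_iff.2 (Or.inl (SimpleGraph.Adj.reachable
        (exteriorGraph_adj.2 ⟨e, hab, by simp, hA⟩)))
    rw [this, Set.pair_eq_singleton, Set.ncard_singleton]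

/-- An open edge leaves one cluster at its ends, a closed one at most two; the worst case `p * q /
(p * q + (1 - p) * q ^ 2)` is the stated bound. -/
theorem IsResamplingInvariant.edgeBound [Countable V] (hp0 : 0 < p) (hp1 : p < 1) (hq : 1 < q)
    {ν : Measure (G.edgeSet → Bool)} [IsProbabilityMeasure ν]
    (h : ∀ e, IsResamplingInvariant p q {e} ν) : EdgeBound (p / (p + (1 - p) * q)) ν := by
  rw [edgeBound_iff]
  rintro e F hF ⟨C, hC⟩ hmono
  have hi : ∀ b, Integrable (fun A => F (setEdge e b A)) ν := fun b =>
    integrable_of_bounded (hF.comp (measurable_setEdge e b)) fun A => hC _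
  rw [h e F hF ⟨C, hC⟩]
  have hi' : Integrable (fun A => p / (p + (1 - p) * q) * F (setEdge e true A) +
      (1 - p / (p + (1 - p) * q)) * F (setEdge e false A)) ν :=
    ((hi true).const_mul _).add ((hi false).const_mul _)
  refine integral_mono hi' (integrable_of_bounded (measurable_sumOver _ (hF.mul (measurable_configProb _)))
      (abs_sumOver_configProb_le hp0 hp1 hq _ hC)) fun A => ?_
  have h1p : 0 < 1 - p := by linarith
  rw [sumOver_mul_configProb, sumOver_singleton, sumOver_singleton]
  have w1 : configWeight p q {e} (setEdge e true A) = p * q := by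
    rw [configWeight, (one_le_clusterCount_singleton e _).2.2 (setEdge_self _ _ _)]
    simp [setEdge_self]
  obtain ⟨c, hc1, hc2, w0⟩ : ∃ c, 1 ≤ c ∧ c ≤ 2 ∧
      configWeight p q {e} (setEdge e false A) = (1 - p) * q ^ c := by
    have := one_le_clusterCount_singleton e (setEdge e false A)
    exact ⟨_, this.1, this.2.1, by simp [configWeight, setEdge_self]⟩
  rw [w1, w0, le_div_iff₀ (by positivity)]
  have hqc : q ^ c ≤ q ^ 2 := pow_le_pow_right₀ hq.le hc2
  have hD : 0 < p + (1 - p) * q := by positivity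
  have hr : p / (p + (1 - p) * q) * (p + (1 - p) * q) = p := div_mul_cancel₀ _ hD.ne'
  set r := p / (p + (1 - p) * q)
  have hr1 : 0 ≤ r := div_nonneg hp0.le hD.le
  have key : 0 ≤ p * q - r * (p * q + (1 - p) * q ^ c) := by
    have h1 : r * (p * q + (1 - p) * q ^ c) ≤ r * (p * q + (1 - p) * q ^ 2) := by gcongr
    have h2 : r * (p * q + (1 - p) * q ^ 2) = p * q := by
      linear_combination q * hr
    linarith
  nlinarith [mul_nonneg (sub_nonneg.2 (hmono A)) key]

end SingleEdge

/-! ### Local functions determine measures -/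

section Extension

variable {E : Type*}

/-- A finite measure on configurations is determined by the integrals of local functions. -/
theorem ext_of_dependsOnEdges {ν ν' : Measure (E → Bool)} [IsFiniteMeasure ν] [IsFiniteMeasure ν']
    (h : ∀ (L : Finset E) (F : (E → Bool) → ℝ), DependsOnEdges L F → Measurable F →
      (∀ A, |F A| ≤ 1) → ∫ A, F A ∂ν = ∫ A, F A ∂ν') : ν = ν' := by
  have hset : ∀ (L : Finset E) (s : Set (E → Bool)), MeasurableSet s →
      (∀ A B : E → Bool, (∀ e ∈ L, A e = B e) → (A ∈ s ↔ B ∈ s)) → ν s = ν' s := by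
    intro L s hs hL
    have := h L (s.indicator fun _ => 1) (fun A B hAB => ?_) (measurable_const.indicator hs)
      fun A => by by_cases hA : A ∈ s <;> simp [hA]
    · have h1 := integral_indicator_one (μ := ν) hs
      have h2 := integral_indicator_one (μ := ν') hs
      simp only [Pi.one_def] at h1 h2
      rw [h1, h2] at this
      exact (measureReal_eq_measureReal_iff).1 this
    · by_cases hA : A ∈ s
      · rw [Set.indicator_of_mem hA, Set.indicator_of_mem ((hL A B hAB).1 hA)]
      · rw [Set.indicator_of_notMem hA, Set.indicator_of_notMem fun hB => hA ((hL A B hAB).2 hB)]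
  refine ext_of_generate_finite _ generateFrom_measurableCylinders.symm
    isPiSystem_measurableCylinders (fun s hs => ?_) (hset ∅ _ MeasurableSet.univ (by simp))
  obtain ⟨L, S, hS, rfl⟩ := (mem_measurableCylinders s).1 hs
  refine hset L _ (MeasurableSet.cylinder _ hS) fun A B hAB => ?_
  rw [mem_cylinder, mem_cylinder]
  have : L.restrict A = L.restrict B := by ext e; exact hAB e e.2
  rw [this]

variable {V : Type*} [Countable V] {G : SimpleGraph V} {p q : ℝ}

/-- Resampling invariance may be tested on local functions. -/
theorem IsResamplingInvariant.of_dependsOnEdges (hp0 : 0 < p) (hp1 : p < 1) (hq : 1 < q)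
    {ν : Measure (G.edgeSet → Bool)} [IsProbabilityMeasure ν] {Λ : Finset G.edgeSet}
    (h : ∀ (L : Finset G.edgeSet) (F : (G.edgeSet → Bool) → ℝ), DependsOnEdges L F →
      Measurable F → (∀ A, |F A| ≤ 1) →
      ∫ A, F A ∂ν = ∫ A, sumOver Λ (fun B => F B * configProb p q Λ B) A ∂ν) :
    IsResamplingInvariant p q Λ ν := by
  have hwm : ∀ O, Measurable fun A => configProb p q Λ (glue Λ O A) := fun O =>
    (measurable_configProb Λ).comp (measurable_glue Λ O)
  have hw0 := fun A => configProb_nonneg (G := G) hp0 hp1 hq Λ A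
  -- The law of the configuration after resampling `Λ`. Once it is known to be a finite measure,
  -- agreement with `ν` on local functions forces equality.
  let κ : Measure (G.edgeSet → Bool) := ∑ O ∈ Λ.powerset,
    (ν.withDensity fun A => ENNReal.ofReal (configProb p q Λ (glue Λ O A))).map (glue Λ O)
  have hfin : ∀ O, IsFiniteMeasure
      (ν.withDensity fun A => ENNReal.ofReal (configProb p q Λ (glue Λ O A))) := fun O => by
    refine isFiniteMeasure_withDensity_ofReal (Integrable.hasFiniteIntegral ?_)
    exact integrable_of_bounded (hwm O) fun A => by
      rw [abs_of_nonneg (hw0 _)]; exact configProb_le_one hp0 hp1 hq Λ _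
  have hκ : ∀ F : (G.edgeSet → Bool) → ℝ, Measurable F → (∃ C, ∀ A, |F A| ≤ C) →
      ∫ A, F A ∂κ = ∫ A, sumOver Λ (fun B => F B * configProb p q Λ B) A ∂ν := by
    rintro F hF ⟨C, hC⟩
    rw [integral_finsetSum_measure fun O _ => integrable_of_bounded hF hC]
    have hC0 : 0 ≤ C := (abs_nonneg _).trans (hC fun _ => true)
    simp only [sumOver]
    rw [integral_finsetSum]
    · refine Finset.sum_congr rfl fun O _ => ?_
      rw [integral_map (measurable_glue Λ O).aemeasurable hF.aestronglyMeasurable,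
        integral_withDensity_eq_integral_toReal_smul (hwm O).ennreal_ofReal
          (ae_of_all _ fun _ => ENNReal.ofReal_lt_top)]
      refine integral_congr_ae (ae_of_all _ fun A => ?_)
      beta_reduce
      rw [ENNReal.toReal_ofReal (hw0 _), smul_eq_mul, mul_comm]
    · intro O _
      refine integrable_of_bounded ((hF.comp (measurable_glue Λ O)).mul (hwm O)) (C := C)
        fun A => ?_
      rw [abs_mul, abs_of_nonneg (hw0 _)]
      exact (mul_le_mul (hC _) (configProb_le_one hp0 hp1 hq Λ _) (hw0 _) hC0).trans_eq (mul_one C)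
  have : IsFiniteMeasure κ := by dsimp only [κ]; infer_instance
  have hνκ : ν = κ := ext_of_dependsOnEdges fun L F hL hF hC => by
    rw [hκ F hF ⟨1, hC⟩, h L F hL hF hC]
  intro F hF hC
  rw [← hκ F hF hC, ← hνκ]

end Extension

/-! ### Local expectations of a resampling-invariant measure -/

namespace RootedTree

variable {V E : Type*} {T : RootedTree V E} {p q : ℝ} {d : ℕ}

theorem measurable_wt {Ω : Type*} [MeasurableSpace Ω] {B : Ω → E → Bool} (hB : Measurable B)
    {X : Ω → V → ℝ} (hX : ∀ v, Measurable fun ω => X ω v) (n : ℕ) :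
    Measurable fun ω => T.wt p q n (B ω) (X ω) := by
  have hset : ∀ e, MeasurableSet {ω | B ω e = true} := fun e =>
    ((measurable_pi_apply e).comp hB) (measurableSet_singleton true)
  induction n generalizing X with
  | zero => simp only [wt]; exact measurable_const.add (measurable_const.mul (hX _))
  | succ n ih =>
    simp only [wt]
    refine Measurable.mul (Finset.measurable_fun_prod _ fun e _ => Measurable.ite (hset e)
      measurable_const (measurable_const.mul (measurable_const.add (measurable_const.mul (hX _)))))
      (ih fun v => Finset.measurable_fun_prod _ fun e _ => Measurable.ite (hset e) (hX _)
        measurable_const)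

theorem measurable_ballMean {X : (E → Bool) → V → ℝ} (hX : ∀ v, Measurable fun A => X A v) (n : ℕ)
    {F : (E → Bool) → ℝ} (hF : Measurable F) :
    Measurable fun A => T.ballMean p q n F (X A) A := by
  have hw : ∀ O, Measurable fun A => T.wt p q n (glue (T.ball n) O A) (X A) := fun O =>
    measurable_wt (measurable_glue _ O) hX n
  exact (Finset.measurable_fun_sum _ fun O _ => (hF.comp (measurable_glue _ O)).mul (hw O)).div
    (Finset.measurable_fun_sum _ fun O _ => hw O)

/-- A measure that is invariant under resampling has the local expectations given by the fixed point
of the message recursion. -/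
theorem integral_eq_ballMean_const (hd : 2 ≤ d) (hreg : ∀ v, v ≠ T.root → (T.ch v).card = d)
    (hp0 : 0 < p) (hp1 : p < 1) (hq : 1 < q)
    (hdp : p + (1 - p) * q < d * p) {z : ℝ} (hz0 : 0 < z) (hz1 : z < 1)
    (hz : Tendsto (fun k => (fun x => msg p q x ^ d)^[k] 0) atTop (𝓝 z))
    (hmsg : ∀ c, 0 < c → c < -Real.log z → ∃ a : ℝ, 1 < a * d ∧ a * (d - 1) ≤ 1 ∧
        ∀ u, 0 ≤ u → msg p q (Real.exp (-u)) ≤ Real.exp (-(a * min u c)))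
    {ν : Measure (E → Bool)} [IsProbabilityMeasure ν]
    (hν : EdgeBound (p / (p + (1 - p) * q)) ν)
    (hres : ∀ n, 1 ≤ n → ∀ F : (E → Bool) → ℝ, Measurable F → (∃ C, ∀ A, |F A| ≤ C) →
      ∫ A, F A ∂ν = ∫ A, T.ballMean p q n F (T.extinct A) A ∂ν)
    {n : ℕ} (hn : 1 ≤ n) {F : (E → Bool) → ℝ} (hF : DependsOnEdges (T.ball n) F)
    (hFm : Measurable F) {C : ℝ} (hC : ∀ A, |F A| ≤ C) (A₀ : E → Bool) :
    ∫ A, F A ∂ν = T.ballMean p q n F (fun _ => z) A₀ := by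
  obtain ⟨ns, -, hns⟩ := exists_subseq_tendsto_integral_ballMean (T := T) hp0 hp1 hq (ν := ν) hn hC
    (X := fun k A => (T.push p q)^[k] (T.extinct A)) (Y := fun _ _ => z)
    (fun k A => iterate_push_nonneg hp0 hp1 hq (extinct_nonneg A) k)
    (fun k A => iterate_push_le_one hp0 hp1 hq (extinct_nonneg A) (extinct_le_one A) k)
    (fun k => measurable_iterate_push measurable_extinct k)
    (fun _ _ => hz0.le) (fun _ _ => hz1.le) (fun _ => measurable_const)
    (fun v hv => tendsto_integral_iterate_push hd hreg hp0 hp1 hq hdp hz0 hz1 hz hmsg hν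
      (T.ne_root_of_depth (by omega)))
    fun k => measurable_ballMean (measurable_iterate_push measurable_extinct k) n hFm
  -- Invariance on the ball of radius `n + k`, with the outer `k` levels summed out, represents the
  -- same number for every `k`.
  have hconst : ∀ k, ∫ A, T.ballMean p q n F ((T.push p q)^[k] (T.extinct A)) A ∂ν =
      ∫ A, F A ∂ν := fun k => by
    rw [hres (n + k) (by omega) F hFm ⟨C, hC⟩]
    exact integral_congr_ae (ae_of_all _ fun A =>
      (ballMean_iterate_push hp0 hp1 hq hF (extinct_nonneg A) A k).symm)
  simp only [hconst] at hns
  rw [tendsto_nhds_unique tendsto_const_nhds hns]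
  simp [ballMean_congr_config hF (fun _ => z) _ A₀]

end RootedTree

section Local

variable {E : Type*} {L : Finset E} {F : (E → Bool) → ℝ}

theorem DependsOnEdges.mono (hF : DependsOnEdges L F) {L' : Finset E} (h : L ⊆ L') :
    DependsOnEdges L' F := fun A B hAB => hF A B fun e he => hAB e (h he)

theorem DependsOnEdges.exists_eq_comp_restrict (hF : DependsOnEdges L F) :
    ∃ f : (L → Bool) → ℝ, F = fun A => f (fun e : L => A e) := by
  refine ⟨fun η => F fun e => if h : e ∈ L then η ⟨e, h⟩ else false, ?_⟩
  ext A
  exact hF _ _ fun e he => by simp [he]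

theorem DependsOnEdges.measurable (hF : DependsOnEdges L F) : Measurable F := by
  obtain ⟨f, rfl⟩ := hF.exists_eq_comp_restrict
  exact (measurable_of_countable f).comp
    (measurable_pi_lambda _ fun e : L => measurable_pi_apply (e : E))

theorem DependsOnEdges.continuous (hF : DependsOnEdges L F) : Continuous F := by
  obtain ⟨f, rfl⟩ := hF.exists_eq_comp_restrict
  exact (continuous_of_discreteTopology (f := f)).comp
    (continuous_pi fun e : L => continuous_apply (e : E))

theorem DependsOnEdges.exists_abs_le (hF : DependsOnEdges L F) : ∃ C, ∀ A, |F A| ≤ C := by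
  obtain ⟨f, rfl⟩ := hF.exists_eq_comp_restrict
  exact ⟨∑ η, |f η|, fun A => Finset.single_le_sum (f := fun η => |f η|)
    (fun _ _ => abs_nonneg _) (Finset.mem_univ _)⟩

end Local

namespace RootedTree

variable {V E : Type*} {T : RootedTree V E} {p q : ℝ} {d : ℕ}

/-! ### The candidate measure with constant field `z` -/

section Volume

variable (hp0 : 0 < p) (hp1 : p < 1) (hq : 1 < q)

include hp0 hp1 hq

theorem exists_measure_ballMean [Countable E] (n : ℕ) {x : V → ℝ} (hx : ∀ v, 0 ≤ x v)
    (A : E → Bool) : ∃ ν : ProbabilityMeasure (E → Bool), ∀ F : (E → Bool) → ℝ,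
      Measurable F → (∃ C, ∀ A, |F A| ≤ C) →
      ∫ B, F B ∂(ν : Measure (E → Bool)) = T.ballMean p q n F x A := by
  set Z := sumOver (T.ball n) (fun B => T.wt p q n B x) A with hZ
  have hZ0 : 0 < Z := sumOver_wt_pos hp0 hp1 hq n hx _ A
  let w : Finset E → ℝ := fun O => T.wt p q n (glue (T.ball n) O A) x / Z
  have hw : ∀ O, 0 ≤ w O := fun O => div_nonneg (wt_pos hp0 hp1 hq n _ hx).le hZ0.le
  let ν : Measure (E → Bool) := ∑ O ∈ (T.ball n).powerset,
    ENNReal.ofReal (w O) • Measure.dirac (glue (T.ball n) O A)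
  have hν : IsProbabilityMeasure ν := by
    constructor
    simp only [ν, Measure.coe_finsetSum, Finset.sum_apply, Measure.smul_apply, measure_univ,
      smul_eq_mul, mul_one]
    rw [← ENNReal.ofReal_sum_of_nonneg fun O _ => hw O, ← Finset.sum_div]
    change ENNReal.ofReal (Z / Z) = 1
    rw [div_self hZ0.ne', ENNReal.ofReal_one]
  refine ⟨⟨ν, hν⟩, ?_⟩
  rintro F hF ⟨C, hC⟩
  change ∫ B, F B ∂ν = _
  rw [integral_finsetSum_measure fun O _ => (integrable_of_bounded hF hC).smul_measure
    ENNReal.ofReal_ne_top, ballMean, sumOver, Finset.sum_div]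
  refine Finset.sum_congr rfl fun O _ => ?_
  rw [integral_smul_measure, integral_dirac, ENNReal.toReal_ofReal (hw O), smul_eq_mul]
  simp only [w]
  ring

/-- The local expectations given by a fixed point of the message recursion are consistent. -/
theorem ballMean_const_of_le (hreg : ∀ v, v ≠ T.root → (T.ch v).card = d) {z : ℝ} (hz0 : 0 < z)
    (hz : msg p q z ^ d = z) {n m : ℕ} (hn : 1 ≤ n) (hnm : n ≤ m) {F : (E → Bool) → ℝ}
    (hF : DependsOnEdges (T.ball n) F) (A : E → Bool) :
    T.ballMean p q m F (fun _ => z) A = T.ballMean p q n F (fun _ => z) A := by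
  induction m, hnm using Nat.le_induction with
  | base => rfl
  | succ m hm ih =>
    rw [← ih, ballMean_push hp0 hp1 hq (hF.mono (T.ball_mono hm)) fun _ => hz0.le]
    refine ballMean_congr_field F (fun v hv => ?_) A
    rw [push, Finset.prod_const, hreg v (T.ne_root_of_depth (by omega)), hz]

/-- The configuration space is compact, so the finite-volume laws have a limit along an ultrafilter.
Local functions are continuous, and by consistency their finite-volume means are eventually
constant. -/
theorem exists_measure_eq_ballMean_const [Countable E]
    (hreg : ∀ v, v ≠ T.root → (T.ch v).card = d) {z : ℝ} (hz0 : 0 < z)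
    (hz : msg p q z ^ d = z) (A : E → Bool) :
    ∃ ν : Measure (E → Bool), IsProbabilityMeasure ν ∧
      ∀ n, 1 ≤ n → ∀ F : (E → Bool) → ℝ, DependsOnEdges (T.ball n) F →
        ∫ B, F B ∂ν = T.ballMean p q n F (fun _ => z) A := by
  choose νs hνs using fun n => exists_measure_ballMean (T := T) hp0 hp1 hq n (x := fun _ => z)
    (fun _ => hz0.le) A
  obtain ⟨ν, -, hν⟩ := (isCompact_univ (X := ProbabilityMeasure (E → Bool))).ultrafilter_le_nhds
    ((hyperfilter ℕ).map νs) (by simp)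
  have hlim : Tendsto νs (hyperfilter ℕ) (𝓝 ν) := hν
  rw [ProbabilityMeasure.tendsto_iff_forall_integral_tendsto] at hlim
  refine ⟨ν, inferInstance, fun n hn F hF => ?_⟩
  obtain ⟨C, hC⟩ := hF.exists_abs_le
  have h1 := hlim (BoundedContinuousFunction.ofNormedAddCommGroup F hF.continuous C hC)
  refine tendsto_nhds_unique h1 (tendsto_const_nhds.congr' ?_)
  have : ∀ᶠ m in (hyperfilter ℕ : Filter ℕ), n ≤ m :=
    (Nat.hyperfilter_le_atTop) (eventually_ge_atTop n)
  filter_upwards [this] with m hm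
  rw [← ballMean_const_of_le hp0 hp1 hq hreg hz0 hz hn hm hF]
  exact (hνs m F hF.measurable ⟨C, hC⟩).symm

end Volume

/-! ### Exact resampling of a ball inside a larger ball -/

section Factorization

/-- The contribution of the levels `n, …, n + k - 1` to the weight on the ball of radius `n + k`. -/
def outerWt (T : RootedTree V E) (p q : ℝ) (n : ℕ) : ℕ → (E → Bool) → (V → ℝ) → ℝ
  | 0, _, _ => 1
  | k + 1, A, x =>
    (∏ e ∈ T.lev (n + k), if A e = true then p else (1 - p) * (1 + (q - 1) * x (T.hd e))) *
      outerWt T p q n k A (T.pull A x)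

theorem wt_add (n k : ℕ) (A : E → Bool) (x : V → ℝ) :
    T.wt p q (n + k) A x = T.outerWt p q n k A x * T.wt p q n A ((T.pull A)^[k] x) := by
  induction k generalizing x with
  | zero => simp [outerWt]
  | succ k ih =>
    rw [← add_assoc, wt, ih, outerWt, Function.iterate_succ_apply, mul_assoc]

theorem pull_congr_of_le {n : ℕ} {A B : E → Bool} (hA : ∀ e ∉ T.ball n, A e = B e) {x y : V → ℝ}
    (hx : ∀ v, n ≤ T.depth v → x v = y v) (v : V) (hv : n ≤ T.depth v) :
    T.pull A x v = T.pull B y v := by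
  refine pull_congr (fun e he => hA e ?_) fun e he => hx _ ?_ <;> rw [T.mem_ch] at he
  · rw [T.mem_ball, he]; omega
  · rw [T.depth_hd, he]; omega

theorem outerWt_congr {n : ℕ} {A B : E → Bool} (hA : ∀ e ∉ T.ball n, A e = B e) (k : ℕ)
    {x y : V → ℝ} (hx : ∀ v, n ≤ T.depth v → x v = y v) :
    T.outerWt p q n k A x = T.outerWt p q n k B y := by
  induction k generalizing x y with
  | zero => rfl
  | succ k ih =>
    rw [outerWt, outerWt, ih (pull_congr_of_le hA hx)]
    congr 1
    refine Finset.prod_congr rfl fun e he => ?_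
    rw [T.mem_lev] at he
    rw [hA e (by rw [T.mem_ball]; omega), hx _ (by rw [T.depth_hd]; omega)]

theorem iterate_pull_congr {n : ℕ} {A B : E → Bool} (hA : ∀ e ∉ T.ball n, A e = B e) (k : ℕ)
    (x : V → ℝ) (v : V) (hv : n ≤ T.depth v) :
    (T.pull A)^[k] x v = (T.pull B)^[k] x v := by
  induction k generalizing v with
  | zero => rfl
  | succ k ih =>
    rw [Function.iterate_succ_apply', Function.iterate_succ_apply']
    exact pull_congr_of_le hA ih v hv

/-- Each descendant of generation `k` joined to `v` transmits one factor `z`. Existence reduces to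
this power tending to `extinct`. -/
theorem iterate_pull_const (A : E → Bool) (z : ℝ) (k : ℕ) (v : V) :
    (T.pull A)^[k] (fun _ => z) v = z ^ T.openDesc A k v := by
  induction k generalizing v with
  | zero => simp [openDesc]
  | succ k ih =>
    rw [Function.iterate_succ_apply', pull, openDesc, ← Finset.prod_pow_eq_pow_sum]
    refine Finset.prod_congr rfl fun e _ => ?_
    split_ifs <;> simp [ih]

theorem iterate_pull_nonneg {A : E → Bool} {x : V → ℝ} (hx : ∀ v, 0 ≤ x v) (k : ℕ) (v : V) :
    0 ≤ (T.pull A)^[k] x v := by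
  induction k generalizing v with
  | zero => exact hx v
  | succ k ih => rw [Function.iterate_succ_apply']; exact pull_nonneg ih v

/-- Resampling the ball of radius `n` inside the ball of radius `n + k`. -/
theorem ballMean_ballMean (hp0 : 0 < p) (hp1 : p < 1) (hq : 1 < q) (n k : ℕ)
    (F : (E → Bool) → ℝ) {x : V → ℝ} (hx : ∀ v, 0 ≤ x v) (A : E → Bool) :
    T.ballMean p q (n + k) (fun B => T.ballMean p q n F ((T.pull B)^[k] x) B) x A =
      T.ballMean p q (n + k) F x A := by
  rw [ballMean, ballMean]
  congr 1
  have hB : ∀ e, e ∈ T.ball (n + k) ↔ e ∈ T.ball (n + k) \ T.ball n ∨ e ∈ T.ball n := fun e => by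
    rw [Finset.mem_sdiff, T.mem_ball, T.mem_ball]
    omega
  rw [sumOver_of_mem_iff Finset.sdiff_disjoint hB, sumOver_of_mem_iff Finset.sdiff_disjoint hB]
  refine sumOver_congr (fun _ _ => rfl) fun C _ => ?_
  set y := (T.pull C)^[k] x with hy
  have hy0 : ∀ v, 0 ≤ y v := iterate_pull_nonneg hx k
  -- The outer factor and the inner field are both read off the exterior of the inner ball, hence
  -- constant in the inner sum.
  have hw : ∀ B, (∀ e ∉ T.ball n, B e = C e) →
      T.wt p q (n + k) B x = T.outerWt p q n k C x * T.wt p q n B y := fun B hBC => by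
    rw [wt_add, outerWt_congr hBC k fun _ _ => rfl]
    congr 1
    exact wt_congr (fun _ _ => rfl) fun v hv => iterate_pull_congr hBC k x v hv.ge
  have hpos := sumOver_wt_pos (T := T) hp0 hp1 hq n hy0 (T.ball n) C
  calc _ = sumOver (T.ball n) (fun B => (T.ballMean p q n F y C * T.outerWt p q n k C x) *
        T.wt p q n B y) C := by
        refine sumOver_congr (fun _ _ => rfl) fun B hBC => ?_
        rw [hw B hBC, mul_assoc]
        congr 1
        rw [ballMean_congr_field (T := T) F (y := y)
          (fun v hv => iterate_pull_congr hBC k x v hv.ge), ballMean, ballMean,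
          sumOver_congr hBC fun _ _ => rfl, sumOver_congr hBC fun _ _ => rfl]
    _ = T.outerWt p q n k C x * sumOver (T.ball n) (fun B => F B * T.wt p q n B y) C := by
        rw [sumOver_mul_left, ballMean]
        field_simp
    _ = _ := by
        rw [← sumOver_mul_left]
        refine sumOver_congr (fun _ _ => rfl) fun B hBC => ?_
        rw [hw B hBC]
        ring

end Factorization

end RootedTree

namespace RootedTree

variable {V E : Type*} {T : RootedTree V E} {p q : ℝ} {d : ℕ}

/-! ### The next generation of an open cluster -/

section OpenDescEdges

/-- The edges leading down from the vertices `k` generations below `v` that are joined to `v`. -/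
def openDescEdges (T : RootedTree V E) (A : E → Bool) : ℕ → V → Finset E
  | 0, v => T.ch v
  | k + 1, v => (T.ch v).biUnion fun e => if A e = true then openDescEdges T A k (T.hd e) else ∅

theorem depth_of_mem_openDescEdges {A : E → Bool} {k : ℕ} {v : V} {e : E}
    (h : e ∈ T.openDescEdges A k v) : T.depth (T.tl e) = T.depth v + k := by
  induction k generalizing v with
  | zero => rw [openDescEdges, T.mem_ch] at h; rw [h, add_zero]
  | succ k ih =>
    rw [openDescEdges, Finset.mem_biUnion] at h
    obtain ⟨e', he', h⟩ := h
    rw [T.mem_ch] at he'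
    split_ifs at h
    · rw [ih h, T.depth_hd, he']; omega
    · simp at h

theorem card_openDescEdges_le (hreg : ∀ v, v ≠ T.root → (T.ch v).card = d) (A : E → Bool) (k : ℕ)
    {v : V} (hv : v ≠ T.root) : (T.openDescEdges A k v).card ≤ d * T.openDesc A k v := by
  induction k generalizing v with
  | zero => simp [openDescEdges, openDesc, hreg v hv]
  | succ k ih =>
    rw [openDescEdges, openDesc, Finset.mul_sum]
    refine Finset.card_biUnion_le.trans (Finset.sum_le_sum fun e _ => ?_)
    split_ifs
    · exact ih (T.hd_ne_root e)
    · simp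

theorem openDesc_congr_of_lt {A B : E → Bool} {k : ℕ} {v : V}
    (h : ∀ e, T.depth (T.tl e) < T.depth v + k → A e = B e) :
    T.openDesc A k v = T.openDesc B k v := by
  induction k generalizing v with
  | zero => rfl
  | succ k ih =>
    refine Finset.sum_congr rfl fun e he => ?_
    rw [T.mem_ch] at he
    rw [h e (by rw [he]; omega), ih fun e' he' => h e' (by rw [T.depth_hd, he] at he'; omega)]

theorem openDesc_succ_eq_zero_of_closed {A B : E → Bool} {k : ℕ} {v : V}
    (h : ∀ e, T.depth (T.tl e) < T.depth v + k → A e = B e)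
    (hS : ∀ e ∈ T.openDescEdges B k v, A e = false) : T.openDesc A (k + 1) v = 0 := by
  induction k generalizing v with
  | zero =>
    rw [openDesc_succ_eq_zero]
    intro e he hA
    rw [hS e he] at hA
    simp at hA
  | succ k ih =>
    rw [openDesc_succ_eq_zero]
    intro e he hA
    have htl := (T.mem_ch v e).1 he
    have hB : B e = true := by rw [← h e (by rw [htl]; omega), hA]
    refine ih (fun e' he' => h e' (by rw [T.depth_hd, htl] at he'; omega)) fun e' he' => hS e' ?_
    rw [openDescEdges, Finset.mem_biUnion]
    exact ⟨e, he, by rwa [if_pos hB]⟩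

end OpenDescEdges

/-! ### Lower bound for the probability of dying out -/

section Closing

variable (hp0 : 0 < p) (hp1 : p < 1) (hq : 1 < q)

include hp0 hp1 hq

/-- An edge of the last level is closed with conditional probability at least `1 - p`: closing it
adds a factor at least `1` and raises the field passed upward, because `x ≤ 1`. -/
theorem wt_update_le {n : ℕ} {e : E} (he : e ∈ T.lev n) {x : V → ℝ} (hx : ∀ v, 0 ≤ x v)
    (hx1 : ∀ v, x v ≤ 1) (B : E → Bool) :
    (1 - p) * (T.wt p q (n + 1) (Function.update B e false) x +
      T.wt p q (n + 1) (Function.update B e true) x) ≤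
      T.wt p q (n + 1) (Function.update B e false) x := by
  have h1p : 0 < 1 - p := by linarith
  have h1q : 0 < q - 1 := by linarith
  set R := ∏ e' ∈ (T.lev n).erase e, if B e' = true then p else
    (1 - p) * (1 + (q - 1) * x (T.hd e')) with hR
  have hR0 : 0 < R := Finset.prod_pos fun e' _ => by
    have := hx (T.hd e')
    split_ifs <;> positivity
  have hprod : ∀ b, (∏ e' ∈ T.lev n, if Function.update B e b e' = true then p else
      (1 - p) * (1 + (q - 1) * x (T.hd e'))) =
      (if b = true then p else (1 - p) * (1 + (q - 1) * x (T.hd e))) * R := by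
    intro b
    rw [← Finset.mul_prod_erase _ _ he, Function.update_self]
    congr 1
    refine Finset.prod_congr rfl fun e' he' => ?_
    rw [Function.update_of_ne (Finset.ne_of_mem_erase he')]
  have hwt : ∀ b y, T.wt p q n (Function.update B e b) y = T.wt p q n B y := fun b y =>
    wt_congr (fun e' he' => Function.update_of_ne (by
      rintro rfl; exact Finset.disjoint_left.1 (T.disjoint_ball_lev n) he' he) _ _) fun _ _ => rfl
  have hpull : ∀ v, T.pull (Function.update B e true) x v ≤
      T.pull (Function.update B e false) x v := by
    refine fun v => Finset.prod_le_prod (fun e' _ => by split_ifs <;> simp [hx]) fun e' _ => ?_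
    by_cases h : e' = e
    · subst h; simpa using hx1 _
    · simp [Function.update_of_ne h]
  have hle := wt_mono (T := T) hp0 hp1 hq n B (pull_nonneg (T := T) (A := Function.update B e true) hx) hpull
  have hpos := wt_pos (T := T) hp0 hp1 hq n B (pull_nonneg (T := T) (A := Function.update B e true) hx)
  rw [wt, wt, hprod, hprod, hwt, hwt]
  simp only [if_true, Bool.false_eq_true, if_false]
  set W1 := T.wt p q n B (T.pull (Function.update B e true) x)
  set W0 := T.wt p q n B (T.pull (Function.update B e false) x)
  have hx0 := hx (T.hd e)
  have h2 : W1 ≤ (1 + (q - 1) * x (T.hd e)) * W0 := by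
    refine hle.trans (le_mul_of_one_le_left (hpos.le.trans hle) ?_)
    have := mul_nonneg h1q.le hx0
    linarith
  nlinarith [mul_le_mul_of_nonneg_left h2 (mul_pos (mul_pos h1p hp0) hR0).le]

theorem pow_mul_sumOver_wt_le {n : ℕ} {S : Finset E} (hS : S ⊆ T.lev n) {x : V → ℝ}
    (hx : ∀ v, 0 ≤ x v) (hx1 : ∀ v, x v ≤ 1) (A : E → Bool) :
    (1 - p) ^ S.card * sumOver (T.lev n) (fun B => T.wt p q (n + 1) B x) A ≤
      sumOver (T.lev n)
        (fun B => (if ∀ e ∈ S, B e = false then 1 else 0) * T.wt p q (n + 1) B x) A := by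
  have h1p : 0 < 1 - p := by linarith
  induction S using Finset.induction_on with
  | empty => simp
  | insert e S he ih =>
    have hlev : e ∈ T.lev n := hS (Finset.mem_insert_self _ _)
    rw [Finset.card_insert_of_notMem he, pow_succ', mul_assoc]
    refine (mul_le_mul_of_nonneg_left
      (ih fun e' he' => hS (Finset.mem_insert_of_mem he')) h1p.le).trans ?_
    rw [← sumOver_mul_left, ← Finset.insert_erase hlev, sumOver_insert (Finset.notMem_erase _ _),
      sumOver_insert (Finset.notMem_erase _ _)]
    refine sumOver_mono fun B _ => ?_
    have hcl : ∀ b, (∀ e' ∈ S, Function.update B e b e' = false) ↔ ∀ e' ∈ S, B e' = false := by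
      intro b
      refine forall₂_congr fun e' he' => ?_
      rw [Function.update_of_ne (by rintro rfl; exact he he')]
    simp only [Finset.forall_mem_insert, hcl, Function.update_self, true_and, Bool.true_eq_false,
      false_and, if_false, zero_mul, add_zero]
    have := wt_update_le hp0 hp1 hq hlev hx hx1 B
    split_ifs
    · linarith
    · simp

/-- Conditionally on the first `k` generations of its cluster, a vertex is cut off in the next one
with a probability bounded below by an exponential of the size of the `k`-th generation. -/
theorem ballMean_pow_openDesc_le (hreg : ∀ v, v ≠ T.root → (T.ch v).card = d) {v : V}
    (hv : v ≠ T.root) (k : ℕ) {x : V → ℝ} (hx : ∀ v, 0 ≤ x v) (hx1 : ∀ v, x v ≤ 1)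
    (A : E → Bool) :
    T.ballMean p q (T.depth v + k + 1)
        (fun B => if T.openDesc B k v = 0 then 0 else ((1 - p) ^ d) ^ T.openDesc B k v) x A ≤
      T.ballMean p q (T.depth v + k + 1)
        (fun B => (if T.openDesc B (k + 1) v = 0 then 1 else 0) -
          if T.openDesc B k v = 0 then 1 else 0) x A := by
  refine div_le_div_of_nonneg_right ?_ (sumOver_wt_pos hp0 hp1 hq _ hx _ A).le
  set M := T.depth v + k
  rw [ball_succ, sumOver_union (T.disjoint_ball_lev M), sumOver_union (T.disjoint_ball_lev M)]
  refine sumOver_mono fun C _ => ?_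
  have hlt : ∀ B : E → Bool, (∀ e ∉ T.lev M, B e = C e) →
      ∀ e, T.depth (T.tl e) < M → B e = C e := fun B hB e he =>
    hB e (by rw [T.mem_lev]; omega)
  have hZ : ∀ B : E → Bool, (∀ e ∉ T.lev M, B e = C e) → T.openDesc B k v = T.openDesc C k v :=
    fun B hB => openDesc_congr_of_lt (hlt B hB)
  -- If generation `k` is already empty, both sides vanish. Otherwise closing the at most `d *
  -- openDesc C k v` edges below it empties generation `k + 1`.
  by_cases h0 : T.openDesc C k v = 0
  · refine sumOver_mono fun B hB => ?_
    have h1 : T.openDesc B k v = 0 := (hZ B hB).trans h0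
    simp [h1, openDesc_eq_zero_mono k.le_succ h1]
  · have hS : T.openDescEdges C k v ⊆ T.lev M := fun e he => by
      rw [T.mem_lev, depth_of_mem_openDescEdges he]
    have h1p : 0 < 1 - p := by linarith
    calc _ = ((1 - p) ^ d) ^ T.openDesc C k v *
          sumOver (T.lev M) (fun B => T.wt p q (M + 1) B x) C := by
          rw [← sumOver_mul_left]
          refine sumOver_congr (fun _ _ => rfl) fun B hB => ?_
          beta_reduce
          rw [hZ B hB, if_neg h0]
      _ ≤ (1 - p) ^ (T.openDescEdges C k v).card *
          sumOver (T.lev M) (fun B => T.wt p q (M + 1) B x) C := by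
          refine mul_le_mul_of_nonneg_right ?_ (sumOver_wt_pos hp0 hp1 hq _ hx _ C).le
          rw [← pow_mul]
          exact pow_le_pow_of_le_one h1p.le (by linarith) (card_openDescEdges_le hreg C k hv)
      _ ≤ _ := pow_mul_sumOver_wt_le hp0 hp1 hq hS hx hx1 C
      _ ≤ _ := by
          refine sumOver_mono fun B hB => mul_le_mul_of_nonneg_right ?_
            (wt_pos hp0 hp1 hq _ B hx).le
          beta_reduce
          rw [hZ B hB, if_neg h0, sub_zero]
          split_ifs with h1 h2
          · exact le_rfl
          · exact absurd (openDesc_succ_eq_zero_of_closed (hlt B hB) h1) h2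
          · exact zero_le_one
          · exact le_rfl

end Closing

/-! ### Resampling invariance of the candidate measure -/

section Existence

variable (hp0 : 0 < p) (hp1 : p < 1) (hq : 1 < q)
  (hreg : ∀ v, v ≠ T.root → (T.ch v).card = d) {z : ℝ} (hz0 : 0 < z) (hz1 : z < 1)
  {ν : Measure (E → Bool)} [IsProbabilityMeasure ν] {A₀ : E → Bool}
  (hν : ∀ n, 1 ≤ n → ∀ F : (E → Bool) → ℝ, DependsOnEdges (T.ball n) F →
    ∫ B, F B ∂ν = T.ballMean p q n F (fun _ => z) A₀)

theorem dependsOnEdges_openDesc (f : ℕ → ℝ) (k : ℕ) {v : V} {n : ℕ} (hn : T.depth v + k ≤ n) :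
    DependsOnEdges (T.ball n) fun A => f (T.openDesc A k v) := fun A B h => by
  beta_reduce
  rw [openDesc_congr_of_lt fun e he => h e (T.mem_ball.2 (he.trans_le hn))]

theorem tendsto_ite_openDesc (A : E → Bool) (v : V) :
    Tendsto (fun k => if T.openDesc A k v = 0 then (1 : ℝ) else 0) atTop (𝓝 (T.extinct A v)) := by
  have := (tendsto_surv_toReal (T := T) A v).const_sub 1
  rw [sub_sub_cancel] at this
  refine this.congr fun k => ?_
  rw [surv_toReal]
  split_ifs <;> simp

include hp0 hp1 hq hreg hz0 hz1 hν

/-- The probabilities of extinction by generation `k` converge, so their increments vanish; these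
dominate the mean of `δ ^ openDesc` on survival, which therefore tends to `0`. Hence survival to
generation `k` with bounded size becomes unlikely, and `z ^ openDesc` tends to the extinction
indicator. -/
theorem tendsto_integral_pow_openDesc {v : V} (hv : v ≠ T.root) :
    Tendsto (fun k => ∫ A, |z ^ T.openDesc A k v - T.extinct A v| ∂ν) atTop (𝓝 0) := by
  set δ := (1 - p) ^ d with hδ
  have hδ0 : 0 < δ := pow_pos (by linarith) d
  have hδ1 : δ ≤ 1 := pow_le_one₀ (by linarith) (by linarith)
  have hdepth : 1 ≤ T.depth v := Nat.one_le_iff_ne_zero.2 fun h => hv (T.eq_root_of_depth h)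
  set u : ℕ → (E → Bool) → ℝ := fun k A => if T.openDesc A k v = 0 then 1 else 0 with hu
  set g : ℝ → ℕ → (E → Bool) → ℝ := fun t k A =>
    if T.openDesc A k v = 0 then 0 else t ^ T.openDesc A k v with hg
  have hum : ∀ k, Measurable (u k) := fun k =>
    (dependsOnEdges_openDesc (fun m => if m = 0 then 1 else 0) k le_rfl).measurable
  have hgm : ∀ t k, Measurable (g t k) := fun t k =>
    (dependsOnEdges_openDesc (fun m => if m = 0 then 0 else t ^ m) k le_rfl).measurable
  have hu1 : ∀ k A, |u k A| ≤ 1 := fun k A => by simp only [hu]; split_ifs <;> simp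
  have hgmem : ∀ t k A, 0 ≤ t → t ≤ 1 → 0 ≤ g t k A ∧ g t k A ≤ 1 := fun t k A h0 h1 => by
    simp only [hg]
    split_ifs
    · simp
    · exact ⟨pow_nonneg h0 _, pow_le_one₀ h0 h1⟩
  have hui : ∀ k, Integrable (u k) ν := fun k => integrable_of_bounded (hum k) (hu1 k)
  have hgi : ∀ t k, 0 ≤ t → t ≤ 1 → Integrable (g t k) ν := fun t k h0 h1 =>
    integrable_of_bounded (hgm t k) (C := 1) fun A => by
      rw [abs_of_nonneg (hgmem t k A h0 h1).1]; exact (hgmem t k A h0 h1).2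
  have hei : Integrable (fun A => T.extinct A v) ν :=
    integrable_of_bounded (measurable_extinct v) (C := 1) fun A => by
      rw [abs_of_nonneg (extinct_nonneg A v)]; exact extinct_le_one A v
  have hulim : Tendsto (fun k => ∫ A, u k A ∂ν) atTop (𝓝 (∫ A, T.extinct A v ∂ν)) :=
    tendsto_integral_of_dominated_convergence (fun _ => 1)
      (fun k => (hum k).aestronglyMeasurable) (integrable_const _)
      (fun k => ae_of_all _ fun A => hu1 k A) (ae_of_all _ fun A => tendsto_ite_openDesc A v)
  have hδlim : Tendsto (fun k => ∫ A, g δ k A ∂ν) atTop (𝓝 0) := by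
    have h1 : Tendsto (fun k => ∫ A, u (k + 1) A ∂ν - ∫ A, u k A ∂ν) atTop (𝓝 0) := by
      have := ((tendsto_add_atTop_iff_nat 1).2 hulim).sub hulim
      rwa [sub_self] at this
    refine squeeze_zero (fun k => integral_nonneg fun A => (hgmem δ k A hδ0.le hδ1).1)
      (fun k => ?_) h1
    have h2 := ballMean_pow_openDesc_le hp0 hp1 hq hreg hv k (x := fun _ => z)
      (fun _ => hz0.le) (fun _ => hz1.le) A₀
    rw [← integral_sub (hui _) (hui _)]
    rw [← hν _ (by omega) _ (dependsOnEdges_openDesc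
      (fun m => if m = 0 then 0 else ((1 - p) ^ d) ^ m) k (by omega)), ← hν _ (by omega) _ ?_] at h2
    · exact h2
    · intro A B h
      have e1 := dependsOnEdges_openDesc (T := T) (fun m => if m = 0 then 1 else 0) (k + 1) (v := v)
        (n := T.depth v + k + 1) (by omega) A B h
      have e2 := dependsOnEdges_openDesc (T := T) (fun m => if m = 0 then 1 else 0) k (v := v)
        (n := T.depth v + k + 1) (by omega) A B h
      exact congrArg₂ _ e1 e2
  have hzlim : Tendsto (fun k => ∫ A, g z k A ∂ν) atTop (𝓝 0) := by
    rw [Metric.tendsto_atTop]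
    intro ε hε
    obtain ⟨N, hN⟩ := exists_pow_lt_of_lt_one (half_pos hε) hz1
    -- Change of base: a generation of size at least `N` makes `z ^ size` small, and for a smaller
    -- one the second term is at least `1`.
    have hpt : ∀ k A, g z k A ≤ ε / 2 + (δ ^ N)⁻¹ * g δ k A := by
      intro k A
      simp only [hg]
      split_ifs with h
      · rw [mul_zero, add_zero]; exact (half_pos hε).le
      · by_cases hle : N ≤ T.openDesc A k v
        · have h1 : z ^ T.openDesc A k v ≤ z ^ N := pow_le_pow_of_le_one hz0.le hz1.le hle
          have h2 : 0 ≤ (δ ^ N)⁻¹ * δ ^ T.openDesc A k v := by positivity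
          linarith
        · have h1 : z ^ T.openDesc A k v ≤ 1 := pow_le_one₀ hz0.le hz1.le
          have h2 : 1 ≤ (δ ^ N)⁻¹ * δ ^ T.openDesc A k v := by
            rw [inv_mul_eq_div, one_le_div (pow_pos hδ0 N)]
            exact pow_le_pow_of_le_one hδ0.le hδ1 (not_le.1 hle).le
          linarith
    have hint : ∀ k, ∫ A, g z k A ∂ν ≤ ε / 2 + (δ ^ N)⁻¹ * ∫ A, g δ k A ∂ν := by
      intro k
      have hi := (hgi δ k hδ0.le hδ1).const_mul (δ ^ N)⁻¹
      have hi' : Integrable (fun A => ε / 2 + (δ ^ N)⁻¹ * g δ k A) ν := (integrable_const _).add hi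
      refine (integral_mono (hgi z k hz0.le hz1.le) hi' (hpt k)).trans_eq ?_
      rw [integral_add (integrable_const _) hi, integral_const_mul]
      simp
    have hev := (hδlim.const_mul (δ ^ N)⁻¹).eventually_lt_const
      (show (δ ^ N)⁻¹ * 0 < ε / 2 by rw [mul_zero]; exact half_pos hε)
    obtain ⟨K, hK⟩ := eventually_atTop.1 hev
    refine ⟨K, fun k hk => ?_⟩
    have h0 : 0 ≤ ∫ A, g z k A ∂ν := integral_nonneg fun A => (hgmem z k A hz0.le hz1.le).1
    rw [Real.dist_eq, sub_zero, abs_of_nonneg h0]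
    linarith [hint k, hK k hk]
  have hlim := hzlim.add (hulim.const_sub (∫ A, T.extinct A v ∂ν))
  rw [sub_self, add_zero] at hlim
  refine squeeze_zero (fun k => integral_nonneg fun A => abs_nonneg _) (fun k => ?_) hlim
  have hi2 : Integrable (fun A => T.extinct A v - u k A) ν := hei.sub (hui k)
  have hi3 : Integrable (fun A => g z k A + (T.extinct A v - u k A)) ν :=
    (hgi z k hz0.le hz1.le).add hi2
  rw [← integral_sub hei (hui k), ← integral_add (hgi z k hz0.le hz1.le) hi2]
  refine integral_mono_of_nonneg (ae_of_all _ fun A => abs_nonneg _) hi3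
    (ae_of_all _ fun A => ?_)
  simp only [hg, hu]
  split_ifs with h
  · have : T.extinct A v = 1 := by rw [extinct, if_pos ⟨k, h⟩]
    simp [h, this]
  · have h1 := extinct_nonneg (T := T) A v
    have h2 : 0 ≤ z ^ T.openDesc A k v := pow_nonneg hz0.le _
    rw [abs_le]
    constructor <;> linarith

/-- Under `ν`, resampling the inner ball with the field pulled in from a larger ball preserves the
mean of `F`. As the larger ball grows, this field becomes `extinct`. -/
theorem integral_eq_integral_ballMean_extinct {n : ℕ} (hn : 1 ≤ n) {L : Finset E}
    {F : (E → Bool) → ℝ} (hF : DependsOnEdges L F) :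
    ∫ A, F A ∂ν = ∫ A, T.ballMean p q n F (T.extinct A) A ∂ν := by
  obtain ⟨m, -, hm⟩ := T.exists_subset_ball L
  obtain ⟨C, hC⟩ := hF.exists_abs_le
  have hXeq : ∀ (A : E → Bool) k v, (T.pull A)^[k] (fun _ => z) v = z ^ T.openDesc A k v :=
    fun A k v => iterate_pull_const A z k v
  have hXm : ∀ k v, Measurable fun A : E → Bool => (T.pull A)^[k] (fun _ => z) v := fun k v => by
    simp only [hXeq]
    exact (dependsOnEdges_openDesc (fun m => z ^ m) k le_rfl).measurable
  -- The shift by `m` ensures that every ball of radius `n + (k + m)` contains the edges on which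
  -- `F` depends.
  obtain ⟨ns, -, hns⟩ := exists_subseq_tendsto_integral_ballMean (T := T) hp0 hp1 hq (ν := ν) hn hC
    (X := fun k A => (T.pull A)^[k + m] fun _ => z) (Y := T.extinct)
    (fun k A v => by rw [hXeq]; exact pow_nonneg hz0.le _)
    (fun k A v => by rw [hXeq]; exact pow_le_one₀ hz0.le hz1.le)
    (fun k => hXm (k + m)) extinct_nonneg extinct_le_one measurable_extinct
    (fun v hv => by
      simp only [hXeq]
      exact (tendsto_add_atTop_iff_nat m).2 (tendsto_integral_pow_openDesc hp0 hp1 hq hreg hz0 hz1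
        hν (T.ne_root_of_depth (by omega))))
    fun k => measurable_ballMean (hXm (k + m)) n hF.measurable
  have hconst : ∀ k, ∫ A, T.ballMean p q n F ((T.pull A)^[k + m] fun _ => z) A ∂ν =
      ∫ A, F A ∂ν := by
    intro k
    have hF' : DependsOnEdges (T.ball (n + (k + m))) F :=
      hF.mono (hm.trans (T.ball_mono (by omega)))
    rw [hν (n + (k + m)) (by omega) F hF', ← ballMean_ballMean hp0 hp1 hq n (k + m) F
      (fun _ => hz0.le) A₀]
    refine hν _ (by omega) _ fun A B hAB => ?_
    have hfield : ∀ v, T.depth v = n → (T.pull A)^[k + m] (fun _ => z) v =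
        (T.pull B)^[k + m] (fun _ => z) v := fun v hv => by
      rw [hXeq, hXeq]
      exact dependsOnEdges_openDesc (fun m => z ^ m) (k + m) (by omega) A B hAB
    have hsum : ∀ F' : (E → Bool) → ℝ, DependsOnEdges (T.ball (n + (k + m))) F' →
        sumOver (T.ball n) F' A = sumOver (T.ball n) F' B := fun F' hF' =>
      Finset.sum_congr rfl fun O _ => hF' _ _ fun e he => by
        by_cases h : e ∈ T.ball n
        · rw [glue_of_mem h, glue_of_mem h]
        · rw [glue_of_notMem h, glue_of_notMem h, hAB e he]
    have hw : ∀ y, DependsOnEdges (T.ball (n + (k + m))) fun B => T.wt p q n B y := fun y A B h =>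
      wt_congr (fun e he => h e (T.ball_mono (by omega) he)) fun _ _ => rfl
    rw [ballMean_congr_field F hfield, ballMean, ballMean, hsum _ (hw _),
      hsum _ fun A B h => by rw [hF' A B h]; exact congrArg _ (hw _ A B h)]
  simp only [hconst] at hns
  exact tendsto_nhds_unique tendsto_const_nhds hns

end Existence

end RootedTree

/-! ### Existence and uniqueness combined -/

namespace RootedTree

variable {V : Type*} {G : SimpleGraph V} {T : RootedTree V G.edgeSet} {p q : ℝ} {d : ℕ}

theorem countable_vertices {E : Type*} (T : RootedTree V E) : Countable V := by
  have := T.countable_edges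
  have h : (Set.univ : Set V) ⊆ insert T.root (Set.range T.hd) := fun v _ => by
    by_cases hv : v = T.root
    · exact Or.inl hv
    · exact Or.inr (T.exists_hd v hv)
  exact Set.countable_univ_iff.1 (((Set.countable_range T.hd).insert T.root).mono h)

theorem existsUnique_isWiredGibbsMeasure
    (hT : ∀ e : G.edgeSet, (e : Sym2 V) = s(T.tl e, T.hd e)) (hroot : (T.ch T.root).Nonempty)
    (hd : 2 ≤ d) (hreg : ∀ v, v ≠ T.root → (T.ch v).card = d)
    (hp0 : 0 < p) (hp1 : p < 1) (hq : 1 < q) (hdp : p + (1 - p) * q < d * p) :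
    ∃! ν : Measure (G.edgeSet → Bool), IsWiredGibbsMeasure G p q ν := by
  have := T.countable_vertices
  have := T.countable_edges
  obtain ⟨z, hz0, hz1, hz, hzlim, hmsg⟩ := exists_msg_fixedPoint hp0 hp1 hq hd hdp
  obtain ⟨ν, hνp, hν⟩ := exists_measure_eq_ballMean_const (T := T) hp0 hp1 hq hreg hz0 hz
    fun _ => false
  refine ⟨ν, isWiredGibbsMeasure_of_isResamplingInvariant hp0 hp1 hq fun Λ => ?_,
    fun ν' hν' => ?_⟩
  · obtain ⟨n, hn, hΛ⟩ := T.exists_subset_ball Λ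
    refine IsResamplingInvariant.of_subset hp0 hp1 hq hΛ
      (IsResamplingInvariant.of_dependsOnEdges hp0 hp1 hq fun L F hF _ _ => ?_)
    simp only [sumOver_ball_configProb hT hn hroot hq]
    exact integral_eq_integral_ballMean_extinct hp0 hp1 hq hreg hz0 hz1 hν hn hF
  · have := hν'.isProbabilityMeasure
    have hres := hν'.isResamplingInvariant hp0 hp1 hq
    refine ext_of_dependsOnEdges fun L F hF hFm hC => ?_
    obtain ⟨n, hn, hL⟩ := T.exists_subset_ball L
    rw [hν n hn F (hF.mono hL)]
    refine integral_eq_ballMean_const hd hreg hp0 hp1 hq hdp hz0 hz1 hzlim hmsg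
      (IsResamplingInvariant.edgeBound hp0 hp1 hq fun e => hres {e}) (fun m hm F hF hC => ?_) hn
      (hF.mono hL) hFm hC _
    rw [hres (T.ball m) F hF hC]
    simp only [sumOver_ball_configProb hT hm hroot hq]

end RootedTree

end RandomCluster

end

theorem theorem1p1 {V : Type*} (G : SimpleGraph V) [G.LocallyFinite] (hG : G.IsTree)
    (Δ : ℕ) (hΔ : 3 ≤ Δ) (hreg : G.IsRegularOfDegree Δ)
    (q : ℝ) (hq : 1 < q) (p : ℝ) (hp : q / ((Δ : ℝ) + q - 2) < p) (hp1 : p < 1) :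
    ∃! ν : MeasureTheory.Measure (G.edgeSet → Bool),
      RandomCluster.IsWiredGibbsMeasure G p q ν := by
  obtain ⟨T, hT, hroot, hch⟩ := RandomCluster.exists_rootedTree hG
  have hΔ' : (3 : ℝ) ≤ Δ := by exact_mod_cast hΔ
  have hden : 0 < (Δ : ℝ) + q - 2 := by linarith
  have hp0 : 0 < p := (div_pos (by linarith) hden).trans hp
  rw [div_lt_iff₀ hden] at hp
  refine RandomCluster.RootedTree.existsUnique_isWiredGibbsMeasure (d := Δ - 1) hT ?_ (by omega)
    (fun v hv => ?_) hp0 hp1 hq ?_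
  · rw [← Finset.card_pos, hroot, hreg]
    omega
  · have := hch v hv
    rw [hreg] at this
    omega
  -- With `d = Δ - 1`, the inequality `p + (1 - p) * q < d * p` is `q < p * (Δ + q - 2)` rearranged.
  · rw [Nat.cast_sub (by omega), Nat.cast_one]
    nlinarith
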